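/- Let $d\ge 1$ and let $(X,Y)\in\mathbb R^d\times\mathbb R$ be a couple of square integrable random variables. Put $R(\theta)=\mathbb E[(Y-\langle\theta,X\rangle)^2]$, let $\theta_*\in\arg\min_{\theta\in\mathbb R^d}R(\theta)$, and for $(\theta,\xi)\in\mathbb R^{d}\times\mathbb R$ put $N(\theta,\xi)=\mathbb E[(\xi Y-\langle\theta,X\rangle)^2]$. Let $G=\mathbb E(XX^\top)=U\,\mathrm{diag}(\lambda_1,\dots,\lambda_d)\,U^\top$ be the Gram matrix and $G^{-1/2}=U\,\mathrm{diag}(\mathbf 1(\lambda_i>0)\lambda_i^{-1/2})\,U^\top$. Let $W=Y-\langle\theta_*,X\rangle$ be the noise, and define $$\kappa_1=\sup\{\mathbb E(\langle\theta,X\rangle^4):\theta\in\mathbb R^d,\ \mathbb E(\langle\theta,X\rangle^2)\le 1\},\qquad \kappa_2=\begin{cases}\mathbb E(W^4)/\mathbb E(W^2)^2,&\mathbb E(W^2)>0,\\0,&\text{otherwise},\end{cases}\qquad K=(\sqrt{\kappa_1}+\sqrt{\kappa_2})^2 .$$ Let $p\in(1,2]$ and $q\in(1,2]$, and assume that $\mathbb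 E(|W|^{2q(p+1)})<\infty$ and $\mathbb E(\|G^{-1/2}X\|^{2q(p+1)})<\infty$. Assume also $K>1$ (this is automatic when neither $X$ nor $W$ vanishes almost surely). Let $k=4$ if $q<2$ and $k=3$ if $q=2$. For $\epsilon>0$ and $n\ge1$ let $L=\log(\epsilon^{-1})+0.73\,(d+1)$ and $$\mu=\sqrt{\frac{2(K-1)L}{n}}+6.81\sqrt K\sqrt{\frac{2(d+1)}{n}},\qquad \widehat\delta=\frac{\mu}{1-2\mu},\qquad C_q=\frac{q^{q-1}}{2(q-1)^{q-1}(1-q/2)^{(2-q)/q}}\quad(C_2=1),$$ $$M(s)=\frac{\mathbb E(|W|^{2s})^{1/s}}{\mathbb E(W^2)}+\mathbb E(\|G^{-1/2}X\|^{2s})^{1/s}\qquad(\text{with }0/0=0),$$ $$\widetilde\gamma_+=\frac1{p+1}\Bigl(\frac{2L}{(K-1)n}\Bigr)^{p/2}(1+\widehat\delta)^{p+1}\Bigl[M(p+1)^{p+1}+\frac{C_q}{\epsilon^{1/q}n^{1-1/q}}\,M(q(p+1))^{p+1}\Bigr],\qquad \delta=\frac{\widehat\delta+\widetilde\gamma_+}{(1-\widehat\delta)_+(1-\widetilde\gamma_+)_+},$$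 where $z_+=\max\{z,0\}$ and $\delta=+\infty$ if $\widehat\delta\ge1$ or $\widetilde\gamma_+\ge1$. **Non-asymptotic bounds.** Let $\epsilon>0$ and let $n$ satisfy $$n>\Bigl[20\sqrt K\sqrt{d+1}+\Bigl(\frac52+\frac1{2(K-1)}\Bigr)\sqrt{2(K-1)L}\Bigr]^2 .$$ Let $(X_1,Y_1),\dots,(X_n,Y_n)$ be independent copies of $(X,Y)$ and $\overline N(\theta,\xi)=\frac1n\sum_{i=1}^n(\xi Y_i-\langle\theta,X_i\rangle)^2$. With probability at least $1-k\epsilon$ (that is, on a measurable event of at least this probability) the following holds. For any $(\theta,\xi)\in\mathbb R^{d}\times\mathbb R$, $$\Bigl|\frac{\overline N(\theta,\xi)}{N(\theta,\xi)}-1\Bigr|\le\delta\qquad(\text{with }0/0=1\text{, and }z/0=+\infty\text{ for }z>0;\text{ nothing is claimed if }\delta=+\infty).$$ Moreover, if $\delta<1$, any empirical risk minimizer $\widehat\theta\in\arg\min_{\theta}\sum_{i=1}^n(Y_i-\langle\theta,X_i\rangle)^2$ satisfies $$R(\widehat\theta)-R(\theta_*)\le\frac{\delta^2}{(1-\delta)(1-\delta^2)\,n}\sum_{i=1}^n(Y_i-\langle\widehat\theta,X_i\rangle)^2\le\frac{\delta^2}{(1-\delta)^2}R(\theta_*).$$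 **Order of magnitude.** There is a numerical constant $c>0$, independent of $d,p,q,\epsilon$ and of the law of $(X,Y)$, such that for any $\epsilon\in(0,1)$, for all $n$ large enough (depending on all the other parameters), $0<\widehat\delta<1$, $0\le\widetilde\gamma_+<1$, $\delta<1$, and $$\delta^2\le c\,\widehat\delta^{\,2},\qquad \widehat\delta^{\,2}\le c\,\frac{(\kappa_1+\kappa_2)\,[d+\log(\epsilon^{-1})]}{n},\qquad \delta^2\le c\,\frac{(\kappa_1+\kappa_2)\,[d+\log(\epsilon^{-1})]}{n}.$$ -/

import Mathlib

open MeasureTheory ProbabilityTheory Filter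

noncomputable section

namespace GramOLS

/-! The population: a couple `(X, Y)` of random variables with values in `ℝ^d × ℝ`, defined on a
probability space `(Ω, P)`. -/

section population

variable {Ω : Type*} [MeasurableSpace Ω] {d : ℕ}

/-- The quadratic risk `R(θ) = E[(Y - ⟨θ, X⟩)²]`. -/
def risk (P : Measure Ω) (X : Ω → EuclideanSpace ℝ (Fin d)) (Y : Ω → ℝ)
    (θ : EuclideanSpace ℝ (Fin d)) : ℝ :=
  ∫ ω, (Y ω - inner ℝ θ (X ω)) ^ 2 ∂P

/-- The homogeneous quadratic form `N(θ, ξ) = E[(ξ Y - ⟨θ, X⟩)²]`. -/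
def quadForm (P : Measure Ω) (X : Ω → EuclideanSpace ℝ (Fin d)) (Y : Ω → ℝ)
    (θ : EuclideanSpace ℝ (Fin d)) (ξ : ℝ) : ℝ :=
  ∫ ω, (ξ * Y ω - inner ℝ θ (X ω)) ^ 2 ∂P

/-- The Gram matrix `G = E[X Xᵀ]`. -/
def gram (P : Measure Ω) (X : Ω → EuclideanSpace ℝ (Fin d)) : Matrix (Fin d) (Fin d) ℝ :=
  Matrix.of fun i j => ∫ ω, X ω i * X ω j ∂P

theorem gram_isHermitian (P : Measure Ω) (X : Ω → EuclideanSpace ℝ (Fin d)) :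
    (gram P X).IsHermitian := by
  ext i j
  simp [gram, mul_comm]

/-- The (pseudo-)inverse square root `G^{-1/2} = U diag(1(λᵢ > 0) λᵢ^{-1/2}) Uᵀ`, where
`G = U diag(λ₁, …, λ_d) Uᵀ` is a spectral decomposition of the Gram matrix. -/
def gramInvSqrt (P : Measure Ω) (X : Ω → EuclideanSpace ℝ (Fin d)) : Matrix (Fin d) (Fin d) ℝ :=
  ((gram_isHermitian P X).eigenvectorUnitary : Matrix (Fin d) (Fin d) ℝ) *
    Matrix.diagonal (fun i => if 0 < (gram_isHermitian P X).eigenvalues i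
      then (Real.sqrt ((gram_isHermitian P X).eigenvalues i))⁻¹ else 0) *
    ((gram_isHermitian P X).eigenvectorUnitary : Matrix (Fin d) (Fin d) ℝ).transpose

/-- The random variable `‖G^{-1/2} X‖` (Euclidean norm). -/
def whitenedNorm (P : Measure Ω) (X : Ω → EuclideanSpace ℝ (Fin d)) (ω : Ω) : ℝ :=
  ‖Matrix.toEuclideanLin (gramInvSqrt P X) (X ω)‖

/-- The kurtosis coefficient `κ₁ = sup {E(⟨θ, X⟩⁴) : E(⟨θ, X⟩²) ≤ 1}` of the design. The set is
nonempty, and it is bounded above as soon as `E(‖G^{-1/2} X‖⁴) < ∞`. -/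
def kappaDesign (P : Measure Ω) (X : Ω → EuclideanSpace ℝ (Fin d)) : ℝ :=
  sSup {t : ℝ | ∃ θ : EuclideanSpace ℝ (Fin d),
    ∫ ω, (inner ℝ θ (X ω)) ^ 2 ∂P ≤ 1 ∧ t = ∫ ω, (inner ℝ θ (X ω)) ^ 4 ∂P}

open Classical in
/-- The kurtosis coefficient `κ₂ = E(W⁴) / E(W²)²` of the noise `W = Y - ⟨θ⋆, X⟩`,
and `κ₂ = 0` if `E(W²) = 0`. -/
def kappaNoise (P : Measure Ω) (X : Ω → EuclideanSpace ℝ (Fin d)) (Y : Ω → ℝ)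
    (θstar : EuclideanSpace ℝ (Fin d)) : ℝ :=
  if 0 < ∫ ω, (Y ω - inner ℝ θstar (X ω)) ^ 2 ∂P then
    (∫ ω, (Y ω - inner ℝ θstar (X ω)) ^ 4 ∂P) /
      (∫ ω, (Y ω - inner ℝ θstar (X ω)) ^ 2 ∂P) ^ 2
  else 0

/-- `E(|Y - ⟨θ⋆, X⟩|^{2s})^{1/s} / E[(Y - ⟨θ⋆, X⟩)²] + E(‖G^{-1/2} X‖^{2s})^{1/s}`, with the
convention `0 / 0 = 0`. -/
def momentSum (P : Measure Ω) (X : Ω → EuclideanSpace ℝ (Fin d)) (Y : Ω → ℝ)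
    (θstar : EuclideanSpace ℝ (Fin d)) (s : ℝ) : ℝ :=
  (∫ ω, |Y ω - inner ℝ θstar (X ω)| ^ (2 * s) ∂P) ^ (1 / s) /
      (∫ ω, (Y ω - inner ℝ θstar (X ω)) ^ 2 ∂P) +
    (∫ ω, whitenedNorm P X ω ^ (2 * s) ∂P) ^ (1 / s)

end population

/-- The empirical quadratic form `N̄(θ, ξ) = (1/n) ∑ᵢ (ξ Yᵢ - ⟨θ, Xᵢ⟩)²` of a sample. -/
def empForm {d n : ℕ} (x : Fin n → EuclideanSpace ℝ (Fin d)) (y : Fin n → ℝ)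
    (θ : EuclideanSpace ℝ (Fin d)) (ξ : ℝ) : ℝ :=
  (1 / (n : ℝ)) * ∑ i, (ξ * y i - inner ℝ θ (x i)) ^ 2

/-- `θhat` is an empirical risk minimizer (ordinary least squares estimate). -/
def IsOLS {d n : ℕ} (x : Fin n → EuclideanSpace ℝ (Fin d)) (y : Fin n → ℝ)
    (θhat : EuclideanSpace ℝ (Fin d)) : Prop :=
  ∀ θ : EuclideanSpace ℝ (Fin d),
    ∑ i, (y i - inner ℝ θhat (x i)) ^ 2 ≤ ∑ i, (y i - inner ℝ θ (x i)) ^ 2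

/-! Explicit bounds. Below, `K` stands for `(√κ₁ + √κ₂)²`. -/

/-- `log(ε⁻¹) + 0.73 (d + 1)`. -/
def logTerm (d : ℕ) (ε : ℝ) : ℝ := Real.log ε⁻¹ + 0.73 * ((d : ℝ) + 1)

/-- The condition relating the sample size `n` and the confidence parameter `ε`. -/
def SampleSizeCond (d : ℕ) (K ε : ℝ) (n : ℕ) : Prop :=
  (n : ℝ) > (20 * Real.sqrt K * Real.sqrt ((d : ℝ) + 1) +
    (5 / 2 + 1 / (2 * (K - 1))) * Real.sqrt (2 * (K - 1) * logTerm d ε)) ^ 2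

/-- `μ = (2 (K - 1) [log(ε⁻¹) + 0.73 (d + 1)] / n)^{1/2} + 6.81 √K √(2 (d + 1) / n)`. -/
def muBound (d : ℕ) (K ε : ℝ) (n : ℕ) : ℝ :=
  Real.sqrt (2 * (K - 1) / n * logTerm d ε) +
    6.81 * Real.sqrt K * Real.sqrt (2 * ((d : ℝ) + 1) / n)

/-- `δ̂ = μ / (1 - 2 μ)`. -/
def deltaHat (d : ℕ) (K ε : ℝ) (n : ℕ) : ℝ :=
  muBound d K ε n / (1 - 2 * muBound d K ε n)

/-- `C_q = q^{q-1} / (2 (q-1)^{q-1} (1 - q/2)^{(2-q)/q})` for `1 < q ≤ 2`; since `0 ^ 0 = 1`, this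
gives the limit value `C_2 = 1` at `q = 2`. -/
def Cq (q : ℝ) : ℝ :=
  q ^ (q - 1) / (2 * (q - 1) ^ (q - 1) * (1 - q / 2) ^ ((2 - q) / q))

/-- The second order term `γ̃₊`, as a function of `K` and of the moment sums
`M₁ = momentSum (p + 1)` and `M₂ = momentSum (q (p + 1))`. -/
def gammaTilde (d : ℕ) (K M₁ M₂ p q ε : ℝ) (n : ℕ) : ℝ :=
  1 / (p + 1) * (2 * logTerm d ε / ((K - 1) * n)) ^ (p / 2) *
    (1 + deltaHat d K ε n) ^ (p + 1) *
    (M₁ ^ (p + 1) + Cq q / (ε ^ (1 / q) * (n : ℝ) ^ (1 - 1 / q)) * M₂ ^ (p + 1))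

/-- `(δ̂ + γ) / ((1 - δ̂)₊ (1 - γ)₊)`. It is meant to be `+∞` when `δ̂ ≥ 1` or `γ ≥ 1`; it is only
used when `δ̂ < 1` and `γ < 1`. -/
def relError (δhat γ : ℝ) : ℝ :=
  (δhat + γ) / (max (1 - δhat) 0 * max (1 - γ) 0)

end GramOLS

end

/-! Whitening. Since θ⋆ minimizes the risk, the noise W is uncorrelated with every ⟨θ, X⟩, and the
components of X in an eigenbasis of G are uncorrelated with one another. Dropping the degenerate
coordinates among these and scaling the others to unit second moment gives an isotropic vector Z in
dimension at most d + 1. Almost surely ξY - ⟨θ, X⟩ = ⟨u, Z⟩ for all (θ, ξ) at once, with ‖u‖² = N(θ,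
ξ). Minkowski in L⁴ gives E⟨u, Z⟩⁴ ≤ K‖u‖⁴ (`isIsotropic_whitened`), and ‖Z‖² = W²/E(W²) +
‖G^{-1/2}X‖², so M(s) bounds the L^s norm of ‖Z‖². It remains to compare the empirical mean of ⟨u,
Zᵢ⟩² with ‖u‖², uniformly in u.

Clipped deviations. Fourth moments give no exponential moments, so ⟨u, Z⟩² - l is first passed
through a bounded odd function ψ = `softClip` with exp ψ(t) ≤ 1 + t + t²/2. A PAC-Bayesian argument
makes the bound uniform in u: the parameter gets a Gaussian perturbation, an exponential integral
over the prior is controlled by Markov, and recentring the Gaussian at v costs the relative entropy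
‖v‖²/2 (`pacBayes_gaussian`). The average of ψ over the perturbation is not ψ at the centre; because
ψ is semiconvex and bounded, the gap is absorbed by a logarithmic term that costs only a multiple of
second order moments (`softClip_le_integral_perturbedClip`). With l of order √(L/((K-1)n)), where L
is `logTerm`, and a well chosen perturbation variance, the right-hand side is nonpositive on the
spheres ‖u‖² = (1 ∓ δ̂)l (`deviation_bound_nonpos`).

Removing the clipping. As ψ(t) differs from t by at most |t|^{p+1}/(p+1) on the relevant side, the
ordinary empirical form is recovered up to γ̃₊. From below the error is deterministic, because ⟨u,
Zᵢ⟩² ≥ 0. From above it involves the empirical mean of ‖Zᵢ‖^{2(p+1)}, controlled by Chebyshev if q =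
2, and by truncation plus Chebyshev if q < 2. Two clipped events and one or two moment events give k
= 3 or k = 4 (`IsIsotropic.measure_deviation_le`).

Least squares. Empirical and population risks are quadratic with minimizers θ̂ and θ⋆. Comparing
them at the two points θ̂ ± δ⁻¹(θ̂ - θ⋆), where the empirical risk takes the same value, bounds the
excess risk by δ²/(1 - δ²) R(θ⋆), hence with a rate δ² instead of δ (`IsOLS.excess_risk_le`).

Order of magnitude. γ̃₊ is of order l^p with p > 1, hence negligible before δ̂, which is of order
l(K - 1) plus the dimension term. -/

namespace GramOLS

/-! ### The influence function and its elementary inequalities -/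

/-- A differentiable function whose derivative is nonpositive on `[a, c]` and nonnegative on
`[c, ∞)` is minimal at `c` on `[a, ∞)`. -/
theorem le_of_deriv_sign {f f' : ℝ → ℝ} {a c : ℝ} (hac : a ≤ c)
    (hd : ∀ y, a ≤ y → HasDerivAt f (f' y) y) (hneg : ∀ y, a ≤ y → y ≤ c → f' y ≤ 0)
    (hpos : ∀ y, c ≤ y → 0 ≤ f' y) {y : ℝ} (hy : a ≤ y) : f c ≤ f y := by
  rcases le_total c y with h | h
  · have hm : MonotoneOn f (Set.Ici c) := by
      refine monotoneOn_of_hasDerivWithinAt_nonneg (f' := f') (convex_Ici c)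
        (fun z hz => (hd z (hac.trans hz)).continuousAt.continuousWithinAt)
        (fun z hz => ?_) (fun z hz => ?_)
      · rw [interior_Ici] at hz
        exact (hd z (hac.trans (le_of_lt hz))).hasDerivWithinAt
      · rw [interior_Ici] at hz
        exact hpos z (le_of_lt hz)
    exact hm (Set.mem_Ici.2 le_rfl) h h
  · have hm : AntitoneOn f (Set.Icc a c) := by
      refine antitoneOn_of_hasDerivWithinAt_nonpos (f' := f') (convex_Icc a c)
        (fun z hz => (hd z hz.1).continuousAt.continuousWithinAt)
        (fun z hz => ?_) (fun z hz => ?_)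
      · rw [interior_Icc] at hz
        exact (hd z hz.1.le).hasDerivWithinAt
      · rw [interior_Icc] at hz
        exact hneg z hz.1.le hz.2.le
    exact hm ⟨hy, h⟩ ⟨hac, le_rfl⟩ h

/-- Quadratic lower bound of `log (1 + y²)` around the point `x`. -/
theorem log_one_add_sq_tangent (x y : ℝ) :
    Real.log (1 + x ^ 2) + 2 * x / (1 + x ^ 2) * (y - x) - (y - x) ^ 2 / 8 ≤
      Real.log (1 + y ^ 2) := by
  have hd : ∀ z, min x y ≤ z → HasDerivAt
      (fun z => Real.log (1 + z ^ 2) - 2 * x / (1 + x ^ 2) * (z - x) + (z - x) ^ 2 / 8)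
      (2 * z / (1 + z ^ 2) - 2 * x / (1 + x ^ 2) + (z - x) / 4) z := by
    intro z _
    have h1 : HasDerivAt (fun z : ℝ => 1 + z ^ 2) (2 * z) z := by
      simpa using (hasDerivAt_pow 2 z).const_add 1
    have h2 := h1.log (by positivity)
    have h3 : HasDerivAt (fun z : ℝ => z - x) 1 z := (hasDerivAt_id z).sub_const x
    refine ((h2.sub (h3.const_mul (2 * x / (1 + x ^ 2)))).add ((h3.pow 2).div_const 8)).congr_deriv ?_
    ring
  -- The coefficient 1/8 is half of 1/4, the largest value of minus the second derivative of log(1 +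
  -- z²), reached at z² = 3. It makes the second factor a sum of two squares, so the derivative has
  -- the sign of z - x.
  have key : ∀ z, 2 * z / (1 + z ^ 2) - 2 * x / (1 + x ^ 2) + (z - x) / 4 =
      (z - x) * (((x * z - 3) ^ 2 + (x - z) ^ 2) / (4 * (1 + x ^ 2) * (1 + z ^ 2))) := by
    intro z
    have h1 : (1 + z ^ 2) ≠ 0 := by positivity
    have h2 : (1 + x ^ 2) ≠ 0 := by positivity
    field_simp
    ring
  have := le_of_deriv_sign (c := x) (min_le_left x y) hd
    (fun z _ hz => by
      rw [key]
      exact mul_nonpos_of_nonpos_of_nonneg (by linarith) (by positivity))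
    (fun z hz => by
      rw [key]
      exact mul_nonneg (by linarith) (by positivity)) (min_le_right x y)
  simp only [sub_self, mul_zero, sub_zero] at this
  norm_num at this
  linarith

/-- The influence function: the cubic `t - t³ / 6` clipped at `±√2`. -/
noncomputable def softClip (t : ℝ) : ℝ :=
  max (-√2) (min t √2) - max (-√2) (min t √2) ^ 3 / 6

theorem softClip_of_le {t : ℝ} (h : t ≤ -√2) : softClip t = -(2 * √2 / 3) := by
  have h0 := Real.sqrt_nonneg 2
  have hs : √2 ^ 2 = 2 := Real.sq_sqrt (by norm_num)
  have : max (-√2) (min t √2) = -√2 := by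
    rw [min_eq_left (by linarith), max_eq_left h]
  rw [softClip, this]
  linear_combination (√2 / 6) * hs

theorem softClip_of_ge {t : ℝ} (h : √2 ≤ t) : softClip t = 2 * √2 / 3 := by
  have h0 := Real.sqrt_nonneg 2
  have hs : √2 ^ 2 = 2 := Real.sq_sqrt (by norm_num)
  have : max (-√2) (min t √2) = √2 := by
    rw [min_eq_right h, max_eq_right (by linarith)]
  rw [softClip, this]
  linear_combination (-√2 / 6) * hs

theorem softClip_of_mem {t : ℝ} (h1 : -√2 ≤ t) (h2 : t ≤ √2) : softClip t = t - t ^ 3 / 6 := by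
  have : max (-√2) (min t √2) = t := by
    rw [min_eq_left h2, max_eq_right h1]
  rw [softClip, this]

theorem continuous_softClip : Continuous softClip := by
  unfold softClip; fun_prop

theorem softClip_neg (t : ℝ) : softClip (-t) = -softClip t := by
  rcases le_total t (-√2) with h | h
  · rw [softClip_of_le h, softClip_of_ge (by linarith)]; ring
  rcases le_total t √2 with h' | h'
  · rw [softClip_of_mem h h', softClip_of_mem (by linarith) (by linarith)]; ring
  · rw [softClip_of_ge h', softClip_of_le (by linarith)]

theorem sqrt_two_bounds : (1.414 : ℝ) ≤ √2 ∧ √2 ≤ 1.4143 := by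
  constructor
  · exact Real.le_sqrt_of_sq_le (by norm_num)
  · exact Real.sqrt_le_iff.2 ⟨by norm_num, by norm_num⟩

theorem softClip_le (t : ℝ) : softClip t ≤ 0.943 := by
  obtain ⟨b1, b2⟩ := sqrt_two_bounds
  have hs : √2 ^ 2 = 2 := Real.sq_sqrt (by norm_num)
  rcases le_total t (-√2) with h | h
  · rw [softClip_of_le h]; linarith
  rcases le_total t √2 with h' | h'
  · rw [softClip_of_mem h h']
    -- The gap 2√2/3 - (t - t³/6) has a double root at √2, where the cubic is stationary.
    have : 0 ≤ (√2 - t) ^ 2 * (2 * √2 + t) := by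
      apply mul_nonneg (sq_nonneg _); linarith
    have e : (√2 - t) ^ 2 * (2 * √2 + t) = 4 * √2 - 6 * t + t ^ 3 := by
      linear_combination (2 * √2 - 3 * t) * hs
    linarith
  · rw [softClip_of_ge h']; linarith

theorem neg_le_softClip (t : ℝ) : -0.943 ≤ softClip t := by
  have := softClip_le (-t)
  rw [softClip_neg] at this
  linarith

/-- `softClip` is semiconvex: it lies above its tangents, up to a quadratic term. -/
theorem exists_softClip_tangent (t : ℝ) :
    ∃ m : ℝ, ∀ h, softClip t + m * (h - t) - 0.7072 * (h - t) ^ 2 ≤ softClip h := by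
  obtain ⟨b1, b2⟩ := sqrt_two_bounds
  have hs : √2 ^ 2 = 2 := Real.sq_sqrt (by norm_num)
  -- √2/2 is half the maximum of t, which is minus the second derivative of the cubic, over [-√2,
  -- √2].
  suffices H : ∃ m : ℝ, ∀ h, softClip t + m * (h - t) - √2 / 2 * (h - t) ^ 2 ≤ softClip h by
    obtain ⟨m, hm⟩ := H
    refine ⟨m, fun h => le_trans ?_ (hm h)⟩
    nlinarith [sq_nonneg (h - t)]
  have inner_bound : ∀ t h : ℝ, -√2 ≤ t → t ≤ √2 →
      softClip t + (1 - t ^ 2 / 2) * (h - t) - √2 / 2 * (h - t) ^ 2 ≤ softClip h := by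
    intro t h h1 h2
    rw [softClip_of_mem h1 h2]
    have hin : ∀ x : ℝ, -√2 ≤ x → x ≤ √2 →
        t - t ^ 3 / 6 + (1 - t ^ 2 / 2) * (x - t) - √2 / 2 * (x - t) ^ 2 ≤ x - x ^ 3 / 6 := by
      intro x hx1 hx2
      -- This is six times the gap between the two sides: the Taylor remainder of the cubic at t is
      -- -(x - t)²(x + 2t)/6.
      have : 0 ≤ (x - t) ^ 2 * (3 * √2 - x - 2 * t) :=
        mul_nonneg (sq_nonneg _) (by linarith)
      nlinarith
    rcases le_total h (-√2) with g | g
    · have h3 := hin (-√2) le_rfl (by linarith)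
      rw [softClip_of_le g]
      have e1 : (-√2 : ℝ) - (-√2) ^ 3 / 6 = -(2 * √2 / 3) := by
        linear_combination (√2 / 6) * hs
      have h4 : 0 ≤ (-√2 - h) * ((1 - t ^ 2 / 2) + √2 / 2 * (2 * (t + √2) + (-√2 - h))) := by
        apply mul_nonneg (by linarith)
        have : t ^ 2 ≤ 2 := by nlinarith
        have : 0 ≤ √2 / 2 * (2 * (t + √2) + (-√2 - h)) :=
          mul_nonneg (by linarith) (by linarith)
        linarith
      nlinarith
    rcases le_total h √2 with g' | g'
    · rw [softClip_of_mem g g']; exact hin h g g'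
    · have h3 := hin √2 (by linarith) le_rfl
      rw [softClip_of_ge g']
      have e1 : (√2 : ℝ) - √2 ^ 3 / 6 = 2 * √2 / 3 := by
        linear_combination (-√2 / 6) * hs
      have h4 : 0 ≤ (h - √2) * (√2 / 2 * (2 * (√2 - t) + (h - √2)) - (1 - t ^ 2 / 2)) := by
        apply mul_nonneg (by linarith)
        have e2 : √2 / 2 * (2 * (√2 - t) + (h - √2)) - (1 - t ^ 2 / 2) =
          (√2 - t) ^ 2 / 2 + √2 / 2 * (h - √2) := by linear_combination (1/2) * hs
        rw [e2]
        have : 0 ≤ √2 / 2 * (h - √2) := mul_nonneg (by linarith) (by linarith)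
        positivity
      nlinarith
  rcases le_total t (-√2) with g | g
  · refine ⟨0, fun h => ?_⟩
    have := inner_bound (-√2) h le_rfl (by linarith)
    have hl : -(2 * √2 / 3) ≤ softClip h := by
      rcases le_total h (-√2) with q | q
      · rw [softClip_of_le q]
      rcases le_total h √2 with q' | q'
      · rw [softClip_of_mem q q']
        have : 0 ≤ (√2 + h) ^ 2 * (2 * √2 - h) := by
          apply mul_nonneg (sq_nonneg _); linarith
        nlinarith
      · rw [softClip_of_ge q']; linarith
    rw [softClip_of_le g]
    have : 0 ≤ √2 / 2 * (h - t) ^ 2 := by positivity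
    linarith
  rcases le_total t √2 with g' | g'
  · exact ⟨_, fun h => inner_bound t h g g'⟩
  · refine ⟨0, fun h => ?_⟩
    rw [softClip_of_ge g']
    have h3 : 0 ≤ √2 / 2 * (h - t) ^ 2 := by positivity
    rcases le_total √2 h with q | q
    · rw [softClip_of_ge q]; linarith
    · have h4 := inner_bound √2 h (by linarith) le_rfl
      rw [softClip_of_ge le_rfl, hs] at h4
      have h5 : (h - √2) ^ 2 ≤ (h - t) ^ 2 := by nlinarith
      have h6 : √2 / 2 * (h - √2) ^ 2 ≤ √2 / 2 * (h - t) ^ 2 := by gcongr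
      linarith

/-- On [-2, ∞), the derivative of log(1 + z + z²/2) - z + z³/6 is z³ times a nonnegative factor, so
this function is minimal at 0, where it vanishes. Beyond ±√2 the left side is constant while the
quadratic moves up away from its minimum at -1. -/
theorem exp_softClip_le (t : ℝ) : Real.exp (softClip t) ≤ 1 + t + t ^ 2 / 2 := by
  obtain ⟨b1, b2⟩ := sqrt_two_bounds
  have hs : √2 ^ 2 = 2 := Real.sq_sqrt (by norm_num)
  have hq : ∀ y : ℝ, 0 < 1 + y + y ^ 2 / 2 := fun y => by nlinarith [sq_nonneg (y + 1)]
  have hin : ∀ y : ℝ, -2 ≤ y → Real.exp (y - y ^ 3 / 6) ≤ 1 + y + y ^ 2 / 2 := by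
    intro y hy
    rw [← Real.le_log_iff_exp_le (hq y)]
    have hd : ∀ z : ℝ, -2 ≤ z → HasDerivAt
        (fun z => Real.log (1 + z + z ^ 2 / 2) - z + z ^ 3 / 6)
        (z ^ 3 * ((1 + z / 2) / (2 * (1 + z + z ^ 2 / 2)))) z := by
      intro z _
      have h1 : HasDerivAt (fun z : ℝ => 1 + z + z ^ 2 / 2) (1 + z) z := by
        refine (((hasDerivAt_id z).const_add 1).add ((hasDerivAt_pow 2 z).div_const 2)).congr_deriv ?_
        simp
      refine (((h1.log (hq z).ne').sub (hasDerivAt_id z)).add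
        ((hasDerivAt_pow 3 z).div_const 6)).congr_deriv ?_
      have hne := (hq z).ne'
      simp only [Nat.cast_ofNat, Nat.add_one_sub_one]
      set w := 1 + z + z ^ 2 / 2 with hw
      field_simp
      rw [hw]
      ring
    have := le_of_deriv_sign (c := 0) (by norm_num) hd
      (fun z h1 h2 => by
        apply mul_nonpos_of_nonpos_of_nonneg
        · exact Odd.pow_nonpos (by decide) h2
        · exact div_nonneg (by linarith) (by linarith [hq z]))
      (fun z h1 => mul_nonneg (by positivity) (by positivity)) hy
    norm_num at this
    linarith
  rcases le_total t (-√2) with h | h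
  · have := hin (-√2) (by linarith)
    rw [softClip_of_le h]
    have e1 : (-√2 : ℝ) - (-√2) ^ 3 / 6 = -(2 * √2 / 3) := by
      linear_combination (√2 / 6) * hs
    rw [e1] at this
    nlinarith
  rcases le_total t √2 with h' | h'
  · rw [softClip_of_mem h h']; exact hin t (by linarith)
  · have := hin √2 (by linarith)
    rw [softClip_of_ge h']
    have e1 : (√2 : ℝ) - √2 ^ 3 / 6 = 2 * √2 / 3 := by
      linear_combination (-√2 / 6) * hs
    rw [e1] at this
    nlinarith

theorem exp_softClip_le_const (t : ℝ) : Real.exp (softClip t) ≤ 2.6 := by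
  have h1 : Real.exp (softClip t) ≤ Real.exp (1 + (-0.057)) :=
    Real.exp_le_exp.2 (by linarith [softClip_le t])
  have h2 : Real.exp (-0.057) ≤ 1 / 1.057 := by
    rw [Real.exp_neg, ← one_div]
    apply one_div_le_one_div_of_le (by norm_num)
    have := Real.add_one_le_exp (0.057 : ℝ)
    linarith
  rw [Real.exp_add] at h1
  have h3 := Real.exp_one_lt_d9
  have h4 := Real.exp_pos 1
  calc _ ≤ _ := h1
    _ ≤ 2.7182818286 * (1 / 1.057) := by gcongr
    _ ≤ 2.6 := by norm_num

theorem softClip_le_self {t : ℝ} (ht : 0 ≤ t) : softClip t ≤ t := by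
  obtain ⟨b1, b2⟩ := sqrt_two_bounds
  rcases le_total t √2 with h' | h'
  · rw [softClip_of_mem (by linarith) h']
    have : 0 ≤ t ^ 3 := by positivity
    linarith
  · rw [softClip_of_ge h']; linarith

/-- For t ≤ 1 the cubic error t³/6 is below t^{p+1}/(p+1) because p + 1 ≤ 3. For t ≥ 1 Bernoulli
bounds the left side by 1 - 1/(p+1) ≤ 2/3, which ψ exceeds. -/
theorem sub_rpow_le_softClip {p t : ℝ} (hp : 1 < p) (hp2 : p ≤ 2) (ht : 0 ≤ t) :
    t - t ^ (p + 1) / (p + 1) ≤ softClip t := by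
  obtain ⟨b1, b2⟩ := sqrt_two_bounds
  have hp0 : 0 < p + 1 := by linarith
  rcases le_total t 1 with h | h
  · rw [softClip_of_mem (by linarith) (by linarith)]
    have h1 : t ^ 3 ≤ t ^ (p + 1) := by
      rw [← Real.rpow_natCast t 3]
      rcases ht.eq_or_lt with h0 | h0
      · rw [← h0, Real.zero_rpow hp0.ne', Real.zero_rpow (by norm_num)]
      · exact Real.rpow_le_rpow_of_exponent_ge h0 h (by push_cast; linarith)
    have h2 : t ^ 3 / 3 ≤ t ^ (p + 1) / (p + 1) := by
      have h3 : 0 ≤ t ^ 3 := by positivity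
      calc t ^ 3 / 3 ≤ t ^ 3 / (p + 1) := by gcongr; linarith
        _ ≤ _ := by gcongr
    have : 0 ≤ t ^ 3 := by positivity
    linarith
  · have hb := one_add_mul_self_le_rpow_one_add (s := t - 1) (by linarith) (p := p + 1) (by linarith)
    rw [add_sub_cancel] at hb
    have h1 : (1 + (p + 1) * (t - 1)) / (p + 1) ≤ t ^ (p + 1) / (p + 1) := by gcongr
    have h2 : (1 + (p + 1) * (t - 1)) / (p + 1) = 1 / (p + 1) + (t - 1) := by field_simp
    have h3 : (1 : ℝ) / 3 ≤ 1 / (p + 1) := one_div_le_one_div_of_le hp0 (by linarith)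
    have h4 : 2 / 3 ≤ softClip t := by
      rcases le_total t √2 with h' | h'
      · rw [softClip_of_mem (by linarith) h']
        have : 0 ≤ (t - 1) * (5 - t - t ^ 2) := mul_nonneg (by linarith) (by nlinarith)
        linarith
      · rw [softClip_of_ge h']; linarith
    linarith

theorem le_softClip_add {p t : ℝ} (hp : 1 < p) (hp2 : p ≤ 2) :
    t ≤ softClip t + max t 0 ^ (p + 1) / (p + 1) := by
  obtain ⟨b1, b2⟩ := sqrt_two_bounds
  rcases le_total 0 t with h | h
  · rw [max_eq_left h]; linarith [sub_rpow_le_softClip hp hp2 h]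
  · rw [max_eq_right h, Real.zero_rpow (by linarith), zero_div, add_zero]
    have := softClip_le_self (t := -t) (by linarith)
    rw [softClip_neg] at this
    linarith

theorem softClip_le_add {p t l : ℝ} (hp : 1 < p) (hp2 : p ≤ 2) (hl : 0 ≤ l) (ht : -l ≤ t) :
    softClip t ≤ t + l ^ (p + 1) / (p + 1) := by
  rcases le_total 0 t with h | h
  · have : 0 ≤ l ^ (p + 1) / (p + 1) := by positivity
    linarith [softClip_le_self h]
  · have h1 := sub_rpow_le_softClip hp hp2 (t := -t) (by linarith)
    rw [softClip_neg] at h1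
    have h2 : (-t) ^ (p + 1) / (p + 1) ≤ l ^ (p + 1) / (p + 1) := by
      gcongr <;> linarith
    linarith

/-- The chord of exp on [0, 2] has slope (e² - 1)/2 < 3.2. -/
theorem exp_le_one_add_mul {x : ℝ} (h0 : 0 ≤ x) (h2 : x ≤ 2) : Real.exp x ≤ 1 + 3.2 * x := by
  have hc := convexOn_exp.2 (Set.mem_univ (0 : ℝ)) (Set.mem_univ (2 : ℝ)) 
    (show 0 ≤ 1 - x / 2 by linarith) (show 0 ≤ x / 2 by linarith) (by ring)
  simp only [smul_eq_mul, mul_zero, zero_add, Real.exp_zero, mul_one] at hc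
  rw [div_mul_cancel₀ x two_ne_zero] at hc
  have he : Real.exp 2 ≤ 7.39 := by
    have := Real.exp_one_lt_d9
    have h := Real.exp_pos 1
    rw [show (2 : ℝ) = 1 + 1 by norm_num, Real.exp_add]
    nlinarith
  nlinarith

/-! ### Smoothing the clipped form by a Gaussian perturbation -/

/-- The function whose average under a Gaussian perturbation of variance `v` dominates the
clipped quadratic function. -/
noncomputable def perturbedClip (τ l v s : ℝ) : ℝ :=
  softClip (τ * (s ^ 2 - v - l)) + Real.log (1 + 11 * v ^ 2 + 11 * v * s ^ 2)

/-- A polynomial upper bound for `exp (perturbedClip τ l v s) - 1`. -/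
noncomputable def perturbedQuad (τ l v s : ℝ) : ℝ :=
  τ * (s ^ 2 - v - l) + (s ^ 2 - v - l) ^ 2 / 2 + 28.6 * (v ^ 2 + v * s ^ 2)

/-- The factor 1 + 11(v² + vs²) multiplies exp ψ. The bound 1 + t + t²/2 is used for the unit term
and the constant bound 2.6 for the rest, so that 28.6 = 2.6 · 11 and no product of the two
quadratics appears. -/
theorem exp_perturbedClip_le {τ l v s : ℝ} (hτ : τ ^ 2 = 1) (hv : 0 ≤ v) :
    Real.exp (perturbedClip τ l v s) ≤ 1 + perturbedQuad τ l v s := by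
  have hw : 0 ≤ 11 * v ^ 2 + 11 * v * s ^ 2 := by positivity
  rw [perturbedClip, Real.exp_add, Real.exp_log (by linarith), perturbedQuad]
  have h1 := exp_softClip_le (τ * (s ^ 2 - v - l))
  have h2 := exp_softClip_le_const (τ * (s ^ 2 - v - l))
  rw [mul_pow, hτ, one_mul] at h1
  nlinarith

section smoothing

variable {Γ : Type*} [MeasurableSpace Γ] {ρ : Measure Γ} [IsProbabilityMeasure ρ]

theorem integrable_softClip_comp {g : Γ → ℝ} (hg : AEStronglyMeasurable g ρ) :
    Integrable (fun x => softClip (g x)) ρ := by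
  refine Integrable.of_bound (continuous_softClip.comp_aestronglyMeasurable hg) 0.943
    (Eventually.of_forall fun x => ?_)
  rw [Real.norm_eq_abs, abs_le]
  exact ⟨neg_le_softClip _, softClip_le _⟩

/-- Jensen type inequality for the semiconvex bounded function `softClip`. -/
theorem softClip_integral_le {g : Γ → ℝ} (hg : Integrable g ρ)
    (hg2 : Integrable (fun x => (g x - ∫ x, g x ∂ρ) ^ 2) ρ) :
    softClip (∫ x, g x ∂ρ) ≤ ∫ x, softClip (g x) ∂ρ +
      min (0.7072 * ∫ x, (g x - ∫ x, g x ∂ρ) ^ 2 ∂ρ) 1.886 := by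
  set T := ∫ x, g x ∂ρ with hT
  have hi := integrable_softClip_comp hg.aestronglyMeasurable
  -- The variance bound integrates the quadratic minorant at the mean, where the linear term
  -- cancels. The constant 1.886 = 2 · 0.943 bounds the oscillation of ψ.
  rw [← sub_le_iff_le_add', le_min_iff]
  constructor
  · obtain ⟨m, hm⟩ := exists_softClip_tangent T
    have h3 : Integrable (fun x => m * (g x - T)) ρ := (hg.sub (integrable_const T)).const_mul m
    have h0 : Integrable (fun x => softClip T + m * (g x - T)) ρ := (integrable_const _).add h3
    have h1 : Integrable (fun x => softClip T + m * (g x - T) - 0.7072 * (g x - T) ^ 2) ρ :=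
      h0.sub (hg2.const_mul 0.7072)
    have h2 := integral_mono h1 hi (fun x => hm (g x))
    rw [integral_sub h0 (hg2.const_mul 0.7072),
      integral_add (integrable_const _) h3,
      integral_const_mul, integral_const_mul,
      integral_sub hg (integrable_const T)] at h2
    simp only [integral_const, probReal_univ, smul_eq_mul, one_mul] at h2
    rw [← hT, sub_self, mul_zero] at h2
    linarith
  · have h2 : ∫ _, (-0.943 : ℝ) ∂ρ ≤ ∫ x, softClip (g x) ∂ρ :=
      integral_mono (integrable_const _) hi (fun x => neg_le_softClip (g x))
    simp only [integral_const, probReal_univ, smul_eq_mul, one_mul] at h2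
    linarith [softClip_le T]

theorem integrable_log_one_add {s : Γ → ℝ} (hs : AEStronglyMeasurable s ρ)
    (hs2 : Integrable (fun x => s x ^ 2) ρ) {a b : ℝ} (ha : 0 ≤ a) (hb : 0 ≤ b) :
    Integrable (fun x => Real.log (1 + a + b * s x ^ 2)) ρ := by
  refine ((integrable_const a).add (hs2.const_mul b)).mono ?_ (Eventually.of_forall fun x => ?_)
  · have : Measurable fun y : ℝ => Real.log (1 + a + b * y ^ 2) := by fun_prop
    exact (this.comp_aemeasurable hs.aemeasurable).aestronglyMeasurable
  · have h1 : 0 ≤ b * s x ^ 2 := by positivity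
    have h2 : 0 ≤ Real.log (1 + a + b * s x ^ 2) := Real.log_nonneg (by linarith)
    have h3 := Real.log_le_sub_one_of_pos (show 0 < 1 + a + b * s x ^ 2 by linarith)
    rw [Real.norm_eq_abs, abs_of_nonneg h2, Pi.add_apply, Real.norm_eq_abs,
      abs_of_nonneg (by linarith)]
    linarith

/-- Lower bound for the mean of `log (1 + a + b s²)` in terms of the mean and variance of `s`. -/
theorem log_le_integral_log_one_add {s : Γ → ℝ} {s₀ v a b : ℝ} (hs : Integrable s ρ)
    (hs2 : Integrable (fun x => s x ^ 2) ρ) (ha : 0 ≤ a) (hb : 0 ≤ b)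
    (h1 : ∫ x, s x ∂ρ = s₀) (h2 : ∫ x, s x ^ 2 ∂ρ = s₀ ^ 2 + v) :
    Real.log (1 + a + b * s₀ ^ 2) - b * v / (8 * (1 + a)) ≤
      ∫ x, Real.log (1 + a + b * s x ^ 2) ∂ρ := by
  have ha1 : 0 < 1 + a := by linarith
  set k := √(b / (1 + a)) with hk
  have hk2 : k ^ 2 = b / (1 + a) := Real.sq_sqrt (by positivity)
  -- Factoring out 1 + a reduces to log(1 + (ky)²), so the tangent inequality costs k²v/8 = bv/(8(1
  -- + a)) on average.
  have hfac : ∀ y : ℝ, Real.log (1 + a + b * y ^ 2) =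
      Real.log (1 + a) + Real.log (1 + (k * y) ^ 2) := by
    intro y
    rw [← Real.log_mul ha1.ne' (by positivity), mul_pow, hk2]
    congr 1
    field_simp
  set m := 2 * (k * s₀) / (1 + (k * s₀) ^ 2) * k with hm
  have hle : ∀ x, Real.log (1 + a + b * s₀ ^ 2) + m * (s x - s₀) -
      b / (8 * (1 + a)) * (s x ^ 2 - 2 * s₀ * s x + s₀ ^ 2) ≤
      Real.log (1 + a + b * s x ^ 2) := by
    intro x
    rw [hfac, hfac]
    have := log_one_add_sq_tangent (k * s₀) (k * s x)
    have e : (k * s x - k * s₀) ^ 2 / 8 =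
        b / (8 * (1 + a)) * (s x ^ 2 - 2 * s₀ * s x + s₀ ^ 2) := by
      rw [← mul_sub, mul_pow, hk2]
      field_simp
      ring
    have e2 : 2 * (k * s₀) / (1 + (k * s₀) ^ 2) * (k * s x - k * s₀) = m * (s x - s₀) := by
      rw [hm]; ring
    rw [e, e2] at this
    linarith
  have i1 : Integrable (fun x => m * (s x - s₀)) ρ := (hs.sub (integrable_const s₀)).const_mul m
  have i3 : Integrable (fun x => s x ^ 2 - 2 * s₀ * s x) ρ := hs2.sub (hs.const_mul _)
  have i2 : Integrable (fun x => b / (8 * (1 + a)) * (s x ^ 2 - 2 * s₀ * s x + s₀ ^ 2)) ρ :=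
    (i3.add (integrable_const _)).const_mul _
  have i4 : Integrable (fun x => Real.log (1 + a + b * s₀ ^ 2) + m * (s x - s₀)) ρ :=
    (integrable_const _).add i1
  have := integral_mono (i4.sub i2)
    (integrable_log_one_add hs.aestronglyMeasurable hs2 ha hb) hle
  simp only [Pi.sub_apply] at this
  rw [integral_sub i4 i2, integral_add (integrable_const _) i1,
    integral_const_mul, integral_const_mul, integral_add i3 (integrable_const _),
    integral_sub hs2 (hs.const_mul _), integral_const_mul, integral_sub hs (integrable_const _),
    h1, h2] at this
  simp only [integral_const, probReal_univ, smul_eq_mul, one_mul] at this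
  calc _ = _ := ?_
    _ ≤ _ := this
  ring

/-- The hypotheses are the moments of a Gaussian with mean s₀ and variance v. Then s² - v has mean
s₀², and s² has variance 4s₀²v + 2v². The Jensen gap of ψ grows with this variance but stays
bounded, as a logarithm of 1 + 11v² + 11vs² can, and the mean of this logarithm pays for the gap. -/
theorem softClip_le_integral_perturbedClip {s : Γ → ℝ} {s₀ v l τ : ℝ} (hτ : τ ^ 2 = 1) (hv : 0 ≤ v)
    (hs : Integrable s ρ) (hs2 : Integrable (fun x => s x ^ 2) ρ)
    (hs4 : Integrable (fun x => s x ^ 4) ρ)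
    (h1 : ∫ x, s x ∂ρ = s₀) (h2 : ∫ x, s x ^ 2 ∂ρ = s₀ ^ 2 + v)
    (h4 : ∫ x, s x ^ 4 ∂ρ = s₀ ^ 4 + 6 * s₀ ^ 2 * v + 3 * v ^ 2) :
    softClip (τ * (s₀ ^ 2 - l)) ≤ ∫ x, perturbedClip τ l v (s x) ∂ρ := by
  set g : Γ → ℝ := fun x => τ * (s x ^ 2 - v - l) with hg
  have ig0 : Integrable (fun x => s x ^ 2 - v) ρ := hs2.sub (integrable_const _)
  have ig1 : Integrable (fun x => s x ^ 2 - v - l) ρ := ig0.sub (integrable_const _)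
  have ig : Integrable g ρ := ig1.const_mul τ
  have hT : ∫ x, g x ∂ρ = τ * (s₀ ^ 2 - l) := by
    simp only [hg]
    rw [integral_const_mul, integral_sub ig0 (integrable_const _),
      integral_sub hs2 (integrable_const _), h2]
    simp
  have hsq : ∀ x, (g x - ∫ x, g x ∂ρ) ^ 2 =
      s x ^ 4 - 2 * (v + s₀ ^ 2) * s x ^ 2 + (v + s₀ ^ 2) ^ 2 := by
    intro x
    rw [hT]
    simp only [hg]
    linear_combination ((s x ^ 2 - v - s₀ ^ 2) ^ 2) * hτ
  have i1 : Integrable (fun x => s x ^ 4 - 2 * (v + s₀ ^ 2) * s x ^ 2) ρ :=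
    hs4.sub (hs2.const_mul _)
  have hvar : ∫ x, (g x - ∫ x, g x ∂ρ) ^ 2 ∂ρ = 4 * s₀ ^ 2 * v + 2 * v ^ 2 := by
    simp only [hsq]
    rw [integral_add i1 (integrable_const _), integral_sub hs4 (hs2.const_mul _),
      integral_const_mul, h2, h4]
    simp only [integral_const, probReal_univ, smul_eq_mul, one_mul]
    ring
  have hA := softClip_integral_le ig (by
    simp only [hsq]
    exact i1.add (integrable_const _))
  rw [hvar, hT] at hA
  have hB := log_le_integral_log_one_add (a := 11 * v ^ 2) (b := 11 * v) hs hs2 (by positivity)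
    (by positivity) h1 h2
  set y := 4 * s₀ ^ 2 * v + 2 * v ^ 2 with hy
  have hy0 : 0 ≤ y := by positivity
  -- The chord of exp turns the left side into 1 + 2.2631y, with 3.2 · 0.7072 < 2.2631. The loss r
  -- in the mean logarithm is at most 1/8, so 11 suffices: 11 · 7/8 exceeds 4 · 2.2631, the
  -- coefficient of vs₀² in 2.2631y.
  have hC : min (0.7072 * y) 1.886 ≤
      Real.log (1 + 11 * v ^ 2 + 11 * v * s₀ ^ 2) - 11 * v * v / (8 * (1 + 11 * v ^ 2)) := by
    set r := 11 * v * v / (8 * (1 + 11 * v ^ 2)) with hr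
    have hr1 : r ≤ 1 / 8 := by
      rw [hr, div_le_div_iff₀ (by positivity) (by norm_num)]
      nlinarith [sq_nonneg v]
    have hr0 : 0 ≤ r := by positivity
    have hr2 : r * (1 + 11 * v ^ 2) = 11 * v ^ 2 / 8 := by
      rw [hr]; field_simp
    have e1 : Real.exp (min (0.7072 * y) 1.886) ≤ 1 + 2.2631 * y := by
      have hm0 : 0 ≤ min (0.7072 * y) 1.886 := le_min (by positivity) (by norm_num)
      have := exp_le_one_add_mul hm0 ((min_le_right _ _).trans (by norm_num))
      have h5 := min_le_left (0.7072 * y) 1.886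
      linarith
    have hw : 0 < 1 + 11 * v ^ 2 + 11 * v * s₀ ^ 2 := by positivity
    have e2 : 1 + 2.2631 * y ≤ (1 + 11 * v ^ 2 + 11 * v * s₀ ^ 2) * (1 - r) := by
      have e3 : (1 + 11 * v ^ 2 + 11 * v * s₀ ^ 2) * (1 - r) =
        1 + 11 * v ^ 2 - 11 * v ^ 2 / 8 + 11 * v * s₀ ^ 2 * (1 - r) := by
        rw [← hr2]; ring
      have e4 : 11 * v * s₀ ^ 2 * (1 - 1 / 8) ≤ 11 * v * s₀ ^ 2 * (1 - r) := by gcongr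
      have e5 : 0 ≤ v * s₀ ^ 2 := by positivity
      rw [e3, hy]
      nlinarith [sq_nonneg v]
    have e6 : 1 - r ≤ Real.exp (-r) := by linarith [Real.add_one_le_exp (-r)]
    rw [← Real.exp_le_exp, Real.exp_sub, Real.exp_log hw]
    calc _ ≤ _ := e1
      _ ≤ _ := e2
      _ ≤ (1 + 11 * v ^ 2 + 11 * v * s₀ ^ 2) * Real.exp (-r) := by gcongr
      _ = _ := by rw [Real.exp_neg]; rfl
  have hsplit : ∫ x, perturbedClip τ l v (s x) ∂ρ = ∫ x, softClip (g x) ∂ρ +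
      ∫ x, Real.log (1 + 11 * v ^ 2 + 11 * v * s x ^ 2) ∂ρ := by
    rw [← integral_add (integrable_softClip_comp ig.aestronglyMeasurable)
      (integrable_log_one_add hs.aestronglyMeasurable hs2 (by positivity) (by positivity))]
    rfl
  rw [hsplit]
  linarith

/-- The variance of s², halved, adds 2s₀²v + v² to (s₀² - l)²/2, and the mean of 28.6(v² + vs²) is
28.6(s₀²v + 2v²), whence 30.6 and 58.2. -/
theorem integral_perturbedQuad {s : Γ → ℝ} {s₀ v l τ : ℝ}
    (hs2 : Integrable (fun x => s x ^ 2) ρ)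
    (hs4 : Integrable (fun x => s x ^ 4) ρ)
    (h2 : ∫ x, s x ^ 2 ∂ρ = s₀ ^ 2 + v)
    (h4 : ∫ x, s x ^ 4 ∂ρ = s₀ ^ 4 + 6 * s₀ ^ 2 * v + 3 * v ^ 2) :
    ∫ x, perturbedQuad τ l v (s x) ∂ρ = τ * (s₀ ^ 2 - l) + (s₀ ^ 2 - l) ^ 2 / 2 +
      30.6 * (s₀ ^ 2 * v) + 58.2 * v ^ 2 := by
  have e : ∀ x, perturbedQuad τ l v (s x) = (1 / 2) * s x ^ 4 + (τ - v - l + 28.6 * v) * s x ^ 2 +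
      (-τ * (v + l) + (v + l) ^ 2 / 2 + 28.6 * v ^ 2) := by
    intro x; rw [perturbedQuad]; ring
  simp only [e]
  have i1 : Integrable (fun x => (1 / 2) * s x ^ 4 + (τ - v - l + 28.6 * v) * s x ^ 2) ρ :=
    (hs4.const_mul _).add (hs2.const_mul _)
  rw [integral_add i1 (integrable_const _),
    integral_add (hs4.const_mul _) (hs2.const_mul _), integral_const_mul, integral_const_mul, h2, h4]
  simp only [integral_const, probReal_univ, smul_eq_mul, one_mul]
  ring

end smoothing

/-! ### Product measures and product densities -/

section product

variable {ι : Type*} [Fintype ι] {α : ι → Type*} [∀ i, MeasurableSpace (α i)]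

theorem lintegral_pi_prod (μ : ∀ i, Measure (α i)) [∀ i, IsProbabilityMeasure (μ i)]
    {g : ∀ i, α i → ENNReal} (hg : ∀ i, Measurable (g i)) :
    ∫⁻ x, ∏ i, g i (x i) ∂(Measure.pi μ) = ∏ i, ∫⁻ y, g i y ∂(μ i) := by
  have hind : iIndepFun (fun i (x : ∀ i, α i) => g i (x i)) (Measure.pi μ) :=
    iIndepFun_pi (μ := μ) (X := g) (fun i => (hg i).aemeasurable)
  rw [lintegral_prod_eq_prod_lintegral_of_indepFun Finset.univ _ hind
    (fun i => (hg i).comp (measurable_pi_apply i))]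
  refine Finset.prod_congr rfl fun i _ => ?_
  exact (measurePreserving_eval μ i).lintegral_comp (hg i)

theorem pi_withDensity (μ : ∀ i, Measure (α i)) [∀ i, IsProbabilityMeasure (μ i)]
    {g : ∀ i, α i → ENNReal} (hg : ∀ i, Measurable (g i))
    [∀ i, SigmaFinite ((μ i).withDensity (g i))] :
    (Measure.pi μ).withDensity (fun x => ∏ i, g i (x i)) =
      Measure.pi (fun i => (μ i).withDensity (g i)) := by
  refine (Measure.pi_eq fun s hs => ?_).symm
  rw [withDensity_apply _ (MeasurableSet.univ_pi hs), ← lintegral_indicator (MeasurableSet.univ_pi hs)]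
  have : ∀ x : ∀ i, α i, (Set.univ.pi s).indicator (fun x => ∏ i, g i (x i)) x =
      ∏ i, (s i).indicator (g i) (x i) := by
    intro x
    by_cases hx : x ∈ Set.univ.pi s
    · rw [Set.indicator_of_mem hx]
      exact Finset.prod_congr rfl fun i _ => by rw [Set.indicator_of_mem (hx i (Set.mem_univ i))]
    · rw [Set.indicator_of_notMem hx]
      simp only [Set.mem_pi, Set.mem_univ, true_implies, not_forall] at hx
      obtain ⟨i, hi⟩ := hx
      exact (Finset.prod_eq_zero (Finset.mem_univ i) (Set.indicator_of_notMem hi _)).symm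
  simp only [this]
  rw [lintegral_pi_prod μ (fun i => (hg i).indicator (hs i))]
  refine Finset.prod_congr rfl fun i _ => ?_
  rw [lintegral_indicator (hs i), withDensity_apply _ (hs i)]

end product

/-! ### Translations and moments of the standard Gaussian measure -/

section gaussian

theorem gaussianReal_withDensity_exp (c : ℝ) :
    (gaussianReal 0 1).withDensity (fun x => ENNReal.ofReal (Real.exp (c * x - c ^ 2 / 2))) =
      gaussianReal c 1 := by
  rw [gaussianReal_of_var_ne_zero _ one_ne_zero, gaussianReal_of_var_ne_zero _ one_ne_zero,
    ← withDensity_mul _ (measurable_gaussianPDF 0 1) (by fun_prop)]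
  congr 1
  ext x
  rw [Pi.mul_apply, gaussianPDF, gaussianPDF, ← ENNReal.ofReal_mul (gaussianPDFReal_nonneg _ _ _),
    gaussianPDFReal, gaussianPDFReal, mul_assoc, ← Real.exp_add]
  congr 3
  simp only [NNReal.coe_one]
  ring

variable {ι : Type*} [Fintype ι]

/-- Change of variables formula for a shift of the standard Gaussian measure. -/
theorem lintegral_stdGaussian_shift (v : EuclideanSpace ℝ ι) {H : EuclideanSpace ℝ ι → ENNReal}
    (hH : Measurable H) :
    ∫⁻ x, H (x + v) ∂(stdGaussian (EuclideanSpace ℝ ι)) =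
      ∫⁻ x, ENNReal.ofReal (Real.exp (inner ℝ v x - ‖v‖ ^ 2 / 2)) * H x
        ∂(stdGaussian (EuclideanSpace ℝ ι)) := by
  have hm : Measurable (WithLp.toLp 2 : (ι → ℝ) → EuclideanSpace ℝ ι) := by fun_prop
  rw [← map_pi_eq_stdGaussian, lintegral_map (f := fun x => H (x + v)) (by fun_prop) hm,
    lintegral_map (by fun_prop) hm]
  have h1 : ∀ x : ι → ℝ, ENNReal.ofReal
      (Real.exp (inner ℝ v (WithLp.toLp 2 x : EuclideanSpace ℝ ι) - ‖v‖ ^ 2 / 2)) =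
      ∏ i, ENNReal.ofReal (Real.exp (v i * x i - v i ^ 2 / 2)) := by
    intro x
    rw [← ENNReal.ofReal_prod_of_nonneg (fun i _ => (Real.exp_pos _).le), ← Real.exp_sum,
      Finset.sum_sub_distrib, EuclideanSpace.real_norm_sq_eq, Finset.sum_div]
    simp [PiLp.inner_apply, mul_comm]
  have h2 : Measure.pi (fun i => gaussianReal (v i) 1) =
      (Measure.pi (fun _ : ι => gaussianReal 0 1)).withDensity
        (fun x => ∏ i, ENNReal.ofReal (Real.exp (v i * x i - v i ^ 2 / 2))) := by
    have hsf : ∀ i, SigmaFinite ((gaussianReal 0 1).withDensity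
        (fun x => ENNReal.ofReal (Real.exp (v i * x - v i ^ 2 / 2)))) := by
      intro i; rw [gaussianReal_withDensity_exp]; infer_instance
    rw [pi_withDensity (fun _ : ι => gaussianReal 0 1)
      (g := fun i x => ENNReal.ofReal (Real.exp (v i * x - v i ^ 2 / 2))) (fun i => by fun_prop)]
    simp only [gaussianReal_withDensity_exp]
  have h3 : (Measure.pi (fun _ : ι => gaussianReal 0 1)).map (fun x i => x i + v i) =
      Measure.pi (fun i => gaussianReal (v i) 1) := by
    have := Measure.pi_map_pi (μ := fun _ : ι => gaussianReal 0 1) (f := fun i x => x + v i)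
      (hμ := fun i => by rw [gaussianReal_map_add_const]; infer_instance)
      (fun i => by fun_prop)
    rw [this]
    simp only [gaussianReal_map_add_const, zero_add]
  have h4 : ∀ x : ι → ℝ, H (WithLp.toLp 2 x + v) = (H ∘ WithLp.toLp 2) (fun i => x i + v i) := by
    intro x; rfl
  simp only [h4]
  rw [← lintegral_map (f := H ∘ WithLp.toLp 2) (g := fun (x : ι → ℝ) i => x i + v i)
    (hH.comp hm) (by fun_prop), h3, h2, lintegral_withDensity_eq_lintegral_mul _ (by fun_prop)
      (hH.comp hm)]
  simp only [h1]
  rfl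

/-- The moments are the successive derivatives at 0 of the moment generating function exp(wt²/2). -/
theorem gaussianReal_moments (w : NNReal) :
    ∫ x, x ^ 2 ∂(gaussianReal 0 w) = w ∧ ∫ x, x ^ 3 ∂(gaussianReal 0 w) = 0 ∧
      ∫ x, x ^ 4 ∂(gaussianReal 0 w) = 3 * (w : ℝ) ^ 2 := by
  have h0 : (0 : ℝ) ∈ interior (integrableExpSet id (gaussianReal 0 w)) := by
    rw [integrableExpSet_id_gaussianReal]; simp
  have hmgf : mgf id (gaussianReal 0 w) = fun t => Real.exp (w * t ^ 2 / 2) := by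
    rw [mgf_id_gaussianReal]; simp
  have he : ∀ t : ℝ, HasDerivAt (fun t : ℝ => Real.exp (w * t ^ 2 / 2))
      (Real.exp (w * t ^ 2 / 2) * (w * t)) t := by
    intro t
    refine (((hasDerivAt_pow 2 t).const_mul (w : ℝ)).div_const 2).exp.congr_deriv ?_
    simp only [Nat.cast_ofNat, Nat.add_one_sub_one, pow_one]; ring
  have d1 : deriv (fun t : ℝ => Real.exp (w * t ^ 2 / 2)) =
      fun t => Real.exp (w * t ^ 2 / 2) * (w * t) := funext fun t => (he t).deriv
  have d2 : deriv (fun t : ℝ => Real.exp (w * t ^ 2 / 2) * (w * t)) =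
      fun t => Real.exp (w * t ^ 2 / 2) * (w + w ^ 2 * t ^ 2) := funext fun t => by
    refine (((he t).mul ((hasDerivAt_id t).const_mul (w : ℝ))).congr_deriv ?_).deriv
    simp only [id]; ring
  have d3 : deriv (fun t : ℝ => Real.exp (w * t ^ 2 / 2) * (w + w ^ 2 * t ^ 2)) =
      fun t => Real.exp (w * t ^ 2 / 2) * (3 * w ^ 2 * t + w ^ 3 * t ^ 3) := funext fun t => by
    refine (((he t).mul (((hasDerivAt_pow 2 t).const_mul ((w : ℝ) ^ 2)).const_add (w : ℝ))).congr_deriv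
      ?_).deriv
    simp only [Nat.cast_ofNat, Nat.add_one_sub_one, pow_one]; ring
  have d4 : deriv (fun t : ℝ => Real.exp (w * t ^ 2 / 2) * (3 * w ^ 2 * t + w ^ 3 * t ^ 3)) =
      fun t => Real.exp (w * t ^ 2 / 2) * (3 * w ^ 2 + 6 * w ^ 3 * t ^ 2 + w ^ 4 * t ^ 4) :=
    funext fun t => by
    refine (((he t).mul (((hasDerivAt_id t).const_mul (3 * (w : ℝ) ^ 2)).add
      ((hasDerivAt_pow 3 t).const_mul ((w : ℝ) ^ 3)))).congr_deriv ?_).deriv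
    simp only [Nat.cast_ofNat, Nat.add_one_sub_one, id, Pi.add_apply]; ring
  have m2 := iteratedDeriv_mgf_zero h0 2
  have m3 := iteratedDeriv_mgf_zero h0 3
  have m4 := iteratedDeriv_mgf_zero h0 4
  simp only [hmgf, iteratedDeriv_succ, iteratedDeriv_zero, d1, d2, d3, d4] at m2 m3 m4
  norm_num at m2 m3 m4
  exact ⟨m2.symm, m3.symm, m4.symm⟩

theorem map_inner_stdGaussian (z : EuclideanSpace ℝ ι) :
    (stdGaussian (EuclideanSpace ℝ ι)).map (fun x => inner ℝ x z) =
      gaussianReal 0 (‖z‖ ^ 2).toNNReal := by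
  have h := IsGaussian.map_eq_gaussianReal (μ := stdGaussian (EuclideanSpace ℝ ι)) (innerSL ℝ z)
  rw [variance_dual_stdGaussian, integral_strongDual_stdGaussian, innerSL_apply_norm] at h
  rw [← h]
  congr 1
  ext x
  rw [innerSL_apply_apply, real_inner_comm]

variable (v z : EuclideanSpace ℝ ι)

theorem integrable_inner_pow_stdGaussian (k : ℕ) :
    Integrable (fun x => inner ℝ x z ^ k) (stdGaussian (EuclideanSpace ℝ ι)) := by
  have h := (memLp_id_gaussianReal (μ := 0) (v := (‖z‖ ^ 2).toNNReal) k).integrable_norm_pow'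
  rw [← map_inner_stdGaussian] at h
  have h2 : Integrable (fun y : ℝ => y ^ k)
      ((stdGaussian (EuclideanSpace ℝ ι)).map (fun x => inner ℝ x z)) := by
    refine h.mono (by fun_prop) (Eventually.of_forall fun y => ?_)
    simp
  exact h2.comp_measurable (by fun_prop)

theorem integral_inner_pow_stdGaussian (k : ℕ) :
    ∫ x, inner ℝ x z ^ k ∂(stdGaussian (EuclideanSpace ℝ ι)) =
      ∫ y, y ^ k ∂(gaussianReal 0 (‖z‖ ^ 2).toNNReal) := by
  rw [← map_inner_stdGaussian, integral_map (by fun_prop) (by fun_prop)]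

theorem integrable_inner_shift_pow (k : ℕ) :
    Integrable (fun x => inner ℝ (x + v) z ^ k) (stdGaussian (EuclideanSpace ℝ ι)) := by
  simp only [inner_add_left, add_pow]
  refine integrable_finsetSum _ fun j _ => ?_
  exact ((integrable_inner_pow_stdGaussian z j).mul_const _).mul_const _

theorem integral_inner_shift :
    ∫ x, inner ℝ (x + v) z ∂(stdGaussian (EuclideanSpace ℝ ι)) = inner ℝ v z := by
  have i1 := integrable_inner_pow_stdGaussian z 1
  have m1 := integral_inner_pow_stdGaussian z 1
  simp only [pow_one, integral_id_gaussianReal] at i1 m1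
  simp only [inner_add_left]
  rw [integral_add i1 (integrable_const _), m1]
  simp

theorem integral_inner_shift_sq :
    ∫ x, inner ℝ (x + v) z ^ 2 ∂(stdGaussian (EuclideanSpace ℝ ι)) =
      inner ℝ v z ^ 2 + ‖z‖ ^ 2 := by
  have i1 := integrable_inner_pow_stdGaussian z 1
  have m1 := integral_inner_pow_stdGaussian z 1
  have i2 := integrable_inner_pow_stdGaussian z 2
  have m2 := integral_inner_pow_stdGaussian z 2
  obtain ⟨g2, -, -⟩ := gaussianReal_moments (‖z‖ ^ 2).toNNReal
  rw [Real.coe_toNNReal _ (by positivity)] at g2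
  rw [g2] at m2
  simp only [pow_one, integral_id_gaussianReal] at i1 m1
  have e : ∀ x, inner ℝ (x + v) z ^ 2 = inner ℝ x z ^ 2 + 2 * inner ℝ v z * inner ℝ x z +
      inner ℝ v z ^ 2 := by
    intro x; rw [inner_add_left]; ring
  simp only [e]
  have j1 : Integrable (fun x => inner ℝ x z ^ 2 + 2 * inner ℝ v z * inner ℝ x z)
    (stdGaussian (EuclideanSpace ℝ ι)) := i2.add (i1.const_mul _)
  rw [integral_add j1 (integrable_const _), integral_add i2 (i1.const_mul _), integral_const_mul,
    m1, m2]
  simp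
  ring

theorem integral_inner_shift_pow_four :
    ∫ x, inner ℝ (x + v) z ^ 4 ∂(stdGaussian (EuclideanSpace ℝ ι)) =
      inner ℝ v z ^ 4 + 6 * inner ℝ v z ^ 2 * ‖z‖ ^ 2 + 3 * (‖z‖ ^ 2) ^ 2 := by
  have i1 := integrable_inner_pow_stdGaussian z 1
  have m1 := integral_inner_pow_stdGaussian z 1
  have i2 := integrable_inner_pow_stdGaussian z 2
  have m2 := integral_inner_pow_stdGaussian z 2
  have i3 := integrable_inner_pow_stdGaussian z 3
  have m3 := integral_inner_pow_stdGaussian z 3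
  have i4 := integrable_inner_pow_stdGaussian z 4
  have m4 := integral_inner_pow_stdGaussian z 4
  obtain ⟨g2, g3, g4⟩ := gaussianReal_moments (‖z‖ ^ 2).toNNReal
  rw [Real.coe_toNNReal _ (by positivity)] at g2 g4
  rw [g2] at m2
  rw [g3] at m3
  rw [g4] at m4
  simp only [pow_one, integral_id_gaussianReal] at i1 m1
  set c := inner ℝ v z with hc
  have e : ∀ x, inner ℝ (x + v) z ^ 4 = inner ℝ x z ^ 4 + 4 * c * inner ℝ x z ^ 3 +
      6 * c ^ 2 * inner ℝ x z ^ 2 + 4 * c ^ 3 * inner ℝ x z + c ^ 4 := by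
    intro x; rw [inner_add_left]; ring
  simp only [e]
  have j1 : Integrable (fun x => inner ℝ x z ^ 4 + 4 * c * inner ℝ x z ^ 3)
    (stdGaussian (EuclideanSpace ℝ ι)) := i4.add (i3.const_mul _)
  have j2 : Integrable (fun x => inner ℝ x z ^ 4 + 4 * c * inner ℝ x z ^ 3 +
      6 * c ^ 2 * inner ℝ x z ^ 2) (stdGaussian (EuclideanSpace ℝ ι)) := j1.add (i2.const_mul _)
  have j3 : Integrable (fun x => inner ℝ x z ^ 4 + 4 * c * inner ℝ x z ^ 3 +
      6 * c ^ 2 * inner ℝ x z ^ 2 + 4 * c ^ 3 * inner ℝ x z) (stdGaussian (EuclideanSpace ℝ ι)) :=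
    j2.add (i1.const_mul _)
  rw [integral_add j3 (integrable_const _), integral_add j2 (i1.const_mul _),
    integral_add j1 (i2.const_mul _), integral_add i4 (i3.const_mul _), integral_const_mul,
    integral_const_mul, integral_const_mul, m1, m2, m3, m4]
  simp
  ring

end gaussian

/-! ### The PAC-Bayesian inequality -/

section pacBayes

variable {ι : Type*} [Fintype ι] {S : Type*} [MeasurableSpace S] {ν : Measure S}
  [IsProbabilityMeasure ν]

/-- PAC-Bayesian deviation inequality for Gaussian perturbations of the parameter. -/
theorem pacBayes_gaussian {n : ℕ} {f : EuclideanSpace ℝ ι → S → ℝ} {Φ : EuclideanSpace ℝ ι → ℝ}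
    (hf : Measurable (Function.uncurry f)) (hΦ : Measurable Φ)
    (hexp : ∀ ζ, ∫⁻ z, ENNReal.ofReal (Real.exp (f ζ z)) ∂ν ≤ ENNReal.ofReal (Real.exp (Φ ζ)))
    (hfi : ∀ v z, Integrable (fun ζ => f (ζ + v) z) (stdGaussian (EuclideanSpace ℝ ι)))
    (hΦi : ∀ v, Integrable (fun ζ => Φ (ζ + v)) (stdGaussian (EuclideanSpace ℝ ι)))
    {ε : ℝ} (hε : 0 < ε) :
    (Measure.pi fun _ : Fin n => ν) {z | ¬ ∀ v : EuclideanSpace ℝ ι,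
      ∑ i, ∫ ζ, f (ζ + v) (z i) ∂(stdGaussian (EuclideanSpace ℝ ι)) ≤
        n * ∫ ζ, Φ (ζ + v) ∂(stdGaussian (EuclideanSpace ℝ ι)) + ‖v‖ ^ 2 / 2 + Real.log ε⁻¹} ≤
      ENNReal.ofReal ε := by
  set γ := stdGaussian (EuclideanSpace ℝ ι) with hγ
  set G : EuclideanSpace ℝ ι → (Fin n → S) → ℝ := fun ζ z => ∑ i, f ζ (z i) - n * Φ ζ with hG
  have hGm : Measurable (Function.uncurry G) := by
    simp only [hG, Function.uncurry_def]
    refine Measurable.sub (Finset.measurable_sum _ fun i _ => ?_) (by fun_prop)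
    exact hf.comp (measurable_fst.prodMk ((measurable_pi_apply i).comp measurable_snd))
  -- The exponential integral over the prior. By independence and `hexp` its mean is at most 1, so
  -- Markov gives A < ε⁻¹ outside an event of probability ε. This single event does not depend on v.
  set A : (Fin n → S) → ENNReal := fun z => ∫⁻ ζ, ENNReal.ofReal (Real.exp (G ζ z)) ∂γ with hA
  have hAm : Measurable A := by
    refine Measurable.lintegral_prod_right' (f := fun p : (Fin n → S) × EuclideanSpace ℝ ι =>
      ENNReal.ofReal (Real.exp (G p.2 p.1))) ?_
    exact (Real.measurable_exp.comp (hGm.comp measurable_swap)).ennreal_ofReal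
  have hA1 : ∫⁻ z, A z ∂(Measure.pi fun _ : Fin n => ν) ≤ 1 := by
    simp only [hA]
    rw [lintegral_lintegral_swap (by
      exact ((Real.measurable_exp.comp (hGm.comp measurable_swap)).ennreal_ofReal).aemeasurable)]
    calc _ ≤ ∫⁻ _, 1 ∂γ := lintegral_mono fun ζ => ?_
      _ = 1 := by simp
    have e : ∀ z : Fin n → S, ENNReal.ofReal (Real.exp (G ζ z)) =
        ∏ i, ENNReal.ofReal (Real.exp (f ζ (z i) - Φ ζ)) := by
      intro z
      rw [← ENNReal.ofReal_prod_of_nonneg (fun i _ => (Real.exp_pos _).le), ← Real.exp_sum,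
        Finset.sum_sub_distrib]
      simp [hG]
    have hfm : Measurable (f ζ) := hf.comp measurable_prodMk_left
    simp only [e]
    rw [lintegral_pi_prod (fun _ : Fin n => ν)
      (g := fun _ y => ENNReal.ofReal (Real.exp (f ζ y - Φ ζ))) (fun i => by fun_prop)]
    refine Finset.prod_le_one' fun i _ => ?_
    have e2 : ∀ y, ENNReal.ofReal (Real.exp (f ζ y - Φ ζ)) =
        ENNReal.ofReal (Real.exp (-Φ ζ)) * ENNReal.ofReal (Real.exp (f ζ y)) := by
      intro y
      rw [← ENNReal.ofReal_mul (Real.exp_pos _).le, ← Real.exp_add]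
      congr 2; ring
    simp only [e2]
    rw [lintegral_const_mul _ (by fun_prop)]
    calc _ ≤ ENNReal.ofReal (Real.exp (-Φ ζ)) * ENNReal.ofReal (Real.exp (Φ ζ)) := by
          gcongr; exact hexp ζ
      _ = 1 := by
          rw [← ENNReal.ofReal_mul (Real.exp_pos _).le, ← Real.exp_add]; simp
  have hmarkov := meas_ge_le_lintegral_div hAm.aemeasurable (μ := Measure.pi fun _ : Fin n => ν)
    (ε := ENNReal.ofReal ε⁻¹) (by simpa using hε) ENNReal.ofReal_ne_top
  refine le_trans (measure_mono ?_) (hmarkov.trans ?_)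
  · intro z hz
    by_contra hcon
    simp only [Set.mem_ofPred_eq, not_le] at hcon
    refine hz fun v => ?_
    -- Recentring the Gaussian at v rewrites A as the integral of exp H; Jensen then bounds the mean
    -- of H by log A. The linear term has mean zero, and ‖v‖²/2 is the relative entropy between the
    -- shifted and the centred Gaussians.
    set H : EuclideanSpace ℝ ι → ℝ := fun ζ => G (ζ + v) z - inner ℝ ζ v - ‖v‖ ^ 2 / 2 with hH
    have hsi : Integrable (fun ζ => ∑ i, f (ζ + v) (z i)) γ :=
      integrable_finsetSum _ fun i _ => hfi v (z i)
    have hGi : Integrable (fun ζ => G (ζ + v) z) γ := hsi.sub ((hΦi v).const_mul _)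
    have hin : Integrable (fun ζ : EuclideanSpace ℝ ι => inner ℝ ζ v) γ := by
      simpa using integrable_inner_pow_stdGaussian v 1
    have hGH : Integrable (fun ζ => G (ζ + v) z - inner ℝ ζ v) γ := hGi.sub hin
    have hHi : Integrable H γ := hGH.sub (integrable_const _)
    have hAH : ∫⁻ ζ, ENNReal.ofReal (Real.exp (H ζ)) ∂γ = A z := by
      have hGz : Measurable fun ζ => G ζ z := hGm.comp measurable_prodMk_right
      have := lintegral_stdGaussian_shift v (H := fun ζ =>
        ENNReal.ofReal (Real.exp (G ζ z - inner ℝ v ζ + ‖v‖ ^ 2 / 2))) (by fun_prop)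
      simp only [← ENNReal.ofReal_mul (Real.exp_pos _).le, ← Real.exp_add] at this
      calc _ = _ := lintegral_congr fun ζ => ?_
        _ = _ := this
        _ = _ := lintegral_congr fun ζ => ?_
      · simp only [hH]
        rw [inner_add_right, real_inner_self_eq_norm_sq, real_inner_comm ζ v]
        congr 2; ring
      · congr 2; ring
    have hlt : ∫⁻ ζ, ENNReal.ofReal (Real.exp (H ζ)) ∂γ < ⊤ := by
      rw [hAH]; exact hcon.trans ENNReal.ofReal_lt_top
    have hei : Integrable (fun ζ => Real.exp (H ζ)) γ := by
      refine ⟨Real.continuous_exp.comp_aestronglyMeasurable hHi.aestronglyMeasurable, ?_⟩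
      rw [hasFiniteIntegral_iff_ofReal (Eventually.of_forall fun _ => (Real.exp_pos _).le)]
      exact hlt
    have hJ := convexOn_exp.map_integral_le Real.continuous_exp.continuousOn isClosed_univ
      (Eventually.of_forall fun _ => Set.mem_univ _) hHi hei
    have hle : ∫ ζ, Real.exp (H ζ) ∂γ ≤ ε⁻¹ := by
      rw [integral_eq_lintegral_of_nonneg_ae (Eventually.of_forall fun _ => (Real.exp_pos _).le)
        hei.aestronglyMeasurable, hAH]
      exact ENNReal.toReal_le_of_le_ofReal (by positivity) hcon.le
    have hl := (Real.le_log_iff_exp_le (by positivity)).2 (hJ.trans hle)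
    have hcalc : ∫ ζ, H ζ ∂γ = ∑ i, ∫ ζ, f (ζ + v) (z i) ∂γ - n * ∫ ζ, Φ (ζ + v) ∂γ -
        ‖v‖ ^ 2 / 2 := by
      have m1 : ∫ ζ : EuclideanSpace ℝ ι, inner ℝ ζ v ∂γ = 0 := by
        simpa using integral_inner_shift (0 : EuclideanSpace ℝ ι) v
      simp only [hH]
      rw [integral_sub hGH (integrable_const _), integral_sub hGi hin, m1]
      simp only [hG]
      rw [integral_sub hsi ((hΦi v).const_mul _), integral_const_mul,
        integral_finsetSum _ fun i _ => hfi v (z i)]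
      simp
    rw [hcalc] at hl
    linarith
  · rw [ENNReal.ofReal_inv_of_pos hε, ENNReal.div_eq_inv_mul, inv_inv]
    exact mul_le_of_le_one_right' hA1

end pacBayes

/-! ### Uniform deviations of the clipped quadratic form -/

section clippedDeviation

variable {ι : Type*} [Fintype ι] {S : Type*} [MeasurableSpace S] {ν : Measure S}
  [IsProbabilityMeasure ν] {T : S → EuclideanSpace ℝ ι}

theorem integrable_norm_shift_pow (v : EuclideanSpace ℝ ι) (k : ℕ) :
    Integrable (fun ζ => ‖ζ + v‖ ^ k) (stdGaussian (EuclideanSpace ℝ ι)) := by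
  have h1 : MemLp id (k : NNReal) (stdGaussian (EuclideanSpace ℝ ι)) :=
    IsGaussian.memLp_id _ _ (by simp)
  have h2 : MemLp (fun ζ : EuclideanSpace ℝ ι => ζ + v) (k : NNReal)
    (stdGaussian (EuclideanSpace ℝ ι)) := h1.add (memLp_const v)
  exact h2.integrable_norm_pow'

theorem integrable_norm_pow_of_le (hT : Measurable T) (h4 : Integrable (fun z => ‖T z‖ ^ 4) ν)
    {k : ℕ} (hk : k ≤ 4) : Integrable (fun z => ‖T z‖ ^ k) ν := by
  refine ((integrable_const 1).add h4).mono (by fun_prop) (Eventually.of_forall fun z => ?_)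
  have h0 := norm_nonneg (T z)
  have h5 : 0 ≤ ‖T z‖ ^ 4 := by positivity
  rw [Real.norm_eq_abs, abs_of_nonneg (by positivity), Pi.add_apply, Real.norm_eq_abs,
    abs_of_nonneg (by linarith)]
  rcases le_total ‖T z‖ 1 with h | h
  · linarith [pow_le_one₀ (n := k) h0 h]
  · linarith [pow_le_pow_right₀ h hk]

theorem abs_inner_pow_mul_le (ζ t : EuclideanSpace ℝ ι) (k j : ℕ) :
    ‖inner ℝ ζ t ^ k * (‖t‖ ^ 2) ^ j‖ ≤ ‖ζ‖ ^ k * ‖t‖ ^ (k + 2 * j) := by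
  rw [norm_mul, norm_pow, norm_pow, norm_pow, norm_norm, ← pow_mul, pow_add, ← mul_assoc, ← mul_pow]
  gcongr
  exact norm_inner_le_norm ζ t

theorem integrable_inner_pow_mul (hT : Measurable T) (h4 : Integrable (fun z => ‖T z‖ ^ 4) ν)
    (ζ : EuclideanSpace ℝ ι) {k j : ℕ} (hk : k + 2 * j ≤ 4) :
    Integrable (fun z => inner ℝ ζ (T z) ^ k * (‖T z‖ ^ 2) ^ j) ν := by
  refine ((integrable_norm_pow_of_le hT h4 hk).const_mul (‖ζ‖ ^ k)).mono (by fun_prop)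
    (Eventually.of_forall fun z => ?_)
  refine (abs_inner_pow_mul_le ζ (T z) k j).trans (le_of_eq ?_)
  rw [Real.norm_eq_abs, abs_of_nonneg (by positivity)]

theorem integrable_prod_inner_pow_mul (hT : Measurable T) (h4 : Integrable (fun z => ‖T z‖ ^ 4) ν)
    (v : EuclideanSpace ℝ ι) {k j : ℕ} (hk : k + 2 * j ≤ 4) :
    Integrable (fun p : EuclideanSpace ℝ ι × S =>
      inner ℝ (p.1 + v) (T p.2) ^ k * (‖T p.2‖ ^ 2) ^ j)
      ((stdGaussian (EuclideanSpace ℝ ι)).prod ν) := by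
  refine ((integrable_norm_shift_pow v k).mul_prod (integrable_norm_pow_of_le hT h4 hk)).mono
    (by fun_prop) (Eventually.of_forall fun p => ?_)
  refine (abs_inner_pow_mul_le (p.1 + v) (T p.2) k j).trans (le_of_eq ?_)
  rw [Real.norm_eq_abs, abs_of_nonneg (by positivity)]

/-- With s = ⟨ζ, T⟩ and v = ‖T‖², every monomial sᵏvʲ here has k + 2j ≤ 4, so the fourth moment of
‖T‖ makes each term integrable. -/
theorem perturbedQuad_eq (τ l v s : ℝ) : perturbedQuad τ l v s =
    1 / 2 * (s ^ 4 * v ^ 0) + (τ - l) * (s ^ 2 * v ^ 0) + 27.6 * (s ^ 2 * v ^ 1) +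
      29.1 * (s ^ 0 * v ^ 2) + (l - τ) * (s ^ 0 * v ^ 1) + (l ^ 2 / 2 - τ * l) := by
  rw [perturbedQuad]; ring

theorem integrable_perturbedQuad (hT : Measurable T) (h4 : Integrable (fun z => ‖T z‖ ^ 4) ν)
    (τ l : ℝ) (ζ : EuclideanSpace ℝ ι) :
    Integrable (fun z => perturbedQuad τ l (‖T z‖ ^ 2) (inner ℝ ζ (T z))) ν := by
  simp only [perturbedQuad_eq]
  exact ((((((integrable_inner_pow_mul hT h4 ζ (by norm_num)).const_mul _).add
    ((integrable_inner_pow_mul hT h4 ζ (by norm_num)).const_mul _)).add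
    ((integrable_inner_pow_mul hT h4 ζ (by norm_num)).const_mul _)).add
    ((integrable_inner_pow_mul hT h4 ζ (by norm_num)).const_mul _)).add
    ((integrable_inner_pow_mul hT h4 ζ (by norm_num)).const_mul _)).add (integrable_const _)

theorem integrable_prod_perturbedQuad (hT : Measurable T)
    (h4 : Integrable (fun z => ‖T z‖ ^ 4) ν) (τ l : ℝ) (v : EuclideanSpace ℝ ι) :
    Integrable (fun p : EuclideanSpace ℝ ι × S =>
      perturbedQuad τ l (‖T p.2‖ ^ 2) (inner ℝ (p.1 + v) (T p.2)))
      ((stdGaussian (EuclideanSpace ℝ ι)).prod ν) := by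
  simp only [perturbedQuad_eq]
  exact ((((((integrable_prod_inner_pow_mul hT h4 v (by norm_num)).const_mul _).add
    ((integrable_prod_inner_pow_mul hT h4 v (by norm_num)).const_mul _)).add
    ((integrable_prod_inner_pow_mul hT h4 v (by norm_num)).const_mul _)).add
    ((integrable_prod_inner_pow_mul hT h4 v (by norm_num)).const_mul _)).add
    ((integrable_prod_inner_pow_mul hT h4 v (by norm_num)).const_mul _)).add (integrable_const _)

theorem measurable_perturbedClip {α : Type*} [MeasurableSpace α] {f g : α → ℝ} (hf : Measurable f)
    (hg : Measurable g) (τ l : ℝ) : Measurable fun x => perturbedClip τ l (f x) (g x) := by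
  unfold perturbedClip
  refine (continuous_softClip.measurable.comp ?_).add (Real.measurable_log.comp ?_) <;> fun_prop

/-- Uniform upper deviation bound for the clipped empirical quadratic form. -/
theorem sum_softClip_le_integral (hT : Measurable T) (h4 : Integrable (fun z => ‖T z‖ ^ 4) ν)
    {n : ℕ} {τ l ε : ℝ} (hτ : τ ^ 2 = 1) (hε : 0 < ε) :
    (Measure.pi fun _ : Fin n => ν) {z | ¬ ∀ v : EuclideanSpace ℝ ι,
      ∑ i, softClip (τ * (inner ℝ v (T (z i)) ^ 2 - l)) ≤
        n * ∫ y, (τ * (inner ℝ v (T y) ^ 2 - l) + (inner ℝ v (T y) ^ 2 - l) ^ 2 / 2 +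
          30.6 * (inner ℝ v (T y) ^ 2 * ‖T y‖ ^ 2) + 58.2 * (‖T y‖ ^ 2) ^ 2) ∂ν +
        ‖v‖ ^ 2 / 2 + Real.log ε⁻¹} ≤ ENNReal.ofReal ε := by
  set γ := stdGaussian (EuclideanSpace ℝ ι) with hγ
  set f : EuclideanSpace ℝ ι → S → ℝ := fun ζ z =>
    perturbedClip τ l (‖T z‖ ^ 2) (inner ℝ ζ (T z)) with hf
  set Φ : EuclideanSpace ℝ ι → ℝ := fun ζ =>
    ∫ z, perturbedQuad τ l (‖T z‖ ^ 2) (inner ℝ ζ (T z)) ∂ν with hΦ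
  have hfm : Measurable (Function.uncurry f) := by
    simp only [hf, Function.uncurry_def]
    exact measurable_perturbedClip (by fun_prop) (by fun_prop) _ _
  have hQm : Measurable fun p : EuclideanSpace ℝ ι × S =>
      perturbedQuad τ l (‖T p.2‖ ^ 2) (inner ℝ p.1 (T p.2)) := by
    unfold perturbedQuad; fun_prop
  have hΦm : Measurable Φ := (hQm.stronglyMeasurable.integral_prod_right').measurable
  have hexp : ∀ ζ, ∫⁻ z, ENNReal.ofReal (Real.exp (f ζ z)) ∂ν ≤
      ENNReal.ofReal (Real.exp (Φ ζ)) := by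
    intro ζ
    have hle : ∀ z, Real.exp (f ζ z) ≤
        1 + perturbedQuad τ l (‖T z‖ ^ 2) (inner ℝ ζ (T z)) := fun z =>
      exp_perturbedClip_le hτ (by positivity)
    have hi := integrable_perturbedQuad hT h4 τ l ζ
    calc _ ≤ ∫⁻ z, ENNReal.ofReal (1 + perturbedQuad τ l (‖T z‖ ^ 2) (inner ℝ ζ (T z))) ∂ν :=
          lintegral_mono fun z => ENNReal.ofReal_le_ofReal (hle z)
      _ = ENNReal.ofReal (∫ z, (1 + perturbedQuad τ l (‖T z‖ ^ 2) (inner ℝ ζ (T z))) ∂ν) :=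
          (ofReal_integral_eq_lintegral_ofReal ((integrable_const 1).add hi)
            (Eventually.of_forall fun z => (Real.exp_pos _).le.trans (hle z))).symm
      _ ≤ _ := by
          apply ENNReal.ofReal_le_ofReal
          rw [integral_add (integrable_const 1) hi]
          simp only [integral_const, probReal_univ, smul_eq_mul, one_mul]
          linarith [Real.add_one_le_exp (Φ ζ)]
  have i1 : ∀ v z, Integrable (fun ζ : EuclideanSpace ℝ ι => inner ℝ (ζ + v) (T z)) γ := by
    intro v z
    simpa using integrable_inner_shift_pow v (T z) 1
  have i2 := fun v z => integrable_inner_shift_pow v (T z) 2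
  have i4 := fun v z => integrable_inner_shift_pow v (T z) 4
  have hfi : ∀ v z, Integrable (fun ζ => f (ζ + v) z) γ := fun v z =>
    (integrable_softClip_comp (by fun_prop)).add
      (integrable_log_one_add (by fun_prop) (i2 v z) (by positivity) (by positivity))
  have hprod := integrable_prod_perturbedQuad hT h4 τ l
  have hΦi : ∀ v, Integrable (fun ζ => Φ (ζ + v)) γ := fun v => (hprod v).integral_prod_left
  refine le_trans (measure_mono ?_) (pacBayes_gaussian (n := n) hfm hΦm hexp hfi hΦi hε)
  rintro z hz hcon
  refine hz fun v => ?_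
  -- Under the shifted Gaussian, ⟨ζ + v, T⟩ is Gaussian with mean ⟨v, T⟩ and variance ‖T‖², which
  -- are the moments required by the smoothing inequality.
  have h1 : ∑ i, softClip (τ * (inner ℝ v (T (z i)) ^ 2 - l)) ≤ ∑ i, ∫ ζ, f (ζ + v) (z i) ∂γ :=
    Finset.sum_le_sum fun i _ => softClip_le_integral_perturbedClip hτ (by positivity)
      (i1 v _) (i2 v _) (i4 v _) (integral_inner_shift v _) (integral_inner_shift_sq v _)
      (integral_inner_shift_pow_four v _)
  have h2 : ∫ ζ, Φ (ζ + v) ∂γ = ∫ y, (τ * (inner ℝ v (T y) ^ 2 - l) +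
      (inner ℝ v (T y) ^ 2 - l) ^ 2 / 2 + 30.6 * (inner ℝ v (T y) ^ 2 * ‖T y‖ ^ 2) +
      58.2 * (‖T y‖ ^ 2) ^ 2) ∂ν := by
    simp only [hΦ]
    rw [integral_integral_swap (hprod v)]
    refine integral_congr_ae (Eventually.of_forall fun y => ?_)
    exact integral_perturbedQuad (i2 v y) (i4 v y) (integral_inner_shift_sq v _)
      (integral_inner_shift_pow_four v _)
  have h3 := hcon v
  rw [h2] at h3
  exact h1.trans h3

end clippedDeviation

/-! ### Isotropic vectors with bounded directional kurtosis -/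

section isotropic

variable {ι : Type*} [Fintype ι] {S : Type*} [MeasurableSpace S] {ν : Measure S}
  {Z : S → EuclideanSpace ℝ ι}

/-- An isotropic random vector with finite fourth moments, whose directional kurtosis is bounded
by `K`. -/
structure IsIsotropic (ν : Measure S) (Z : S → EuclideanSpace ℝ ι) (K : ℝ) : Prop where
  measurable : Measurable Z
  integrable_norm_pow_four : Integrable (fun z => ‖Z z‖ ^ 4) ν
  integral_inner_sq : ∀ u, ∫ z, inner ℝ u (Z z) ^ 2 ∂ν = ‖u‖ ^ 2
  integral_inner_pow_four_le : ∀ u, ∫ z, inner ℝ u (Z z) ^ 4 ∂ν ≤ K * (‖u‖ ^ 2) ^ 2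

variable [IsProbabilityMeasure ν] {K : ℝ}

namespace IsIsotropic

theorem integrable_inner_pow (h : IsIsotropic ν Z K) (u : EuclideanSpace ℝ ι) {k : ℕ}
    (hk : k ≤ 4) : Integrable (fun z => inner ℝ u (Z z) ^ k) ν := by
  simpa using integrable_inner_pow_mul h.measurable h.integrable_norm_pow_four u (k := k) (j := 0)
    (by omega)

theorem integrable_inner_sq_mul (h : IsIsotropic ν Z K) (u w : EuclideanSpace ℝ ι) :
    Integrable (fun z => inner ℝ u (Z z) ^ 2 * inner ℝ w (Z z) ^ 2) ν := by
  have hZ := h.measurable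
  refine ((h.integrable_inner_pow u (k := 4) le_rfl).add
    (h.integrable_inner_pow w (k := 4) le_rfl)).mono (by fun_prop) (Eventually.of_forall fun z => ?_)
  rw [Pi.add_apply, Real.norm_eq_abs, Real.norm_eq_abs, abs_of_nonneg (by positivity),
    abs_of_nonneg (by positivity)]
  nlinarith [sq_nonneg (inner ℝ u (Z z) ^ 2 - inner ℝ w (Z z) ^ 2),
    sq_nonneg (inner ℝ u (Z z) ^ 2), sq_nonneg (inner ℝ w (Z z) ^ 2)]

/-- Cauchy–Schwarz in the form xy ≤ x²/(2c) + cy²/2; the weight c = ‖u‖² balances the two fourth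
moments. -/
theorem integral_inner_sq_mul_le (h : IsIsotropic ν Z K)
    (u w : EuclideanSpace ℝ ι) (hw : ‖w‖ = 1) :
    ∫ z, inner ℝ u (Z z) ^ 2 * inner ℝ w (Z z) ^ 2 ∂ν ≤ K * ‖u‖ ^ 2 := by
  rcases eq_or_ne u 0 with rfl | hu
  · simp
  have hu0 : 0 < ‖u‖ ^ 2 := by positivity
  set c := ‖u‖ ^ 2 with hc
  have iu := h.integrable_inner_pow u (k := 4) le_rfl
  have iw := h.integrable_inner_pow w (k := 4) le_rfl
  calc _ ≤ ∫ z, (1 / (2 * c) * inner ℝ u (Z z) ^ 4 + c / 2 * inner ℝ w (Z z) ^ 4) ∂ν := by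
        refine integral_mono (h.integrable_inner_sq_mul u w)
          ((iu.const_mul _).add (iw.const_mul _)) fun z => ?_
        have e : 1 / (2 * c) * inner ℝ u (Z z) ^ 4 + c / 2 * inner ℝ w (Z z) ^ 4 -
            inner ℝ u (Z z) ^ 2 * inner ℝ w (Z z) ^ 2 =
            (inner ℝ u (Z z) ^ 2 - c * inner ℝ w (Z z) ^ 2) ^ 2 / (2 * c) := by
          field_simp; ring
        have : 0 ≤ (inner ℝ u (Z z) ^ 2 - c * inner ℝ w (Z z) ^ 2) ^ 2 / (2 * c) := by positivity
        simp only
        linarith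
    _ = 1 / (2 * c) * ∫ z, inner ℝ u (Z z) ^ 4 ∂ν + c / 2 * ∫ z, inner ℝ w (Z z) ^ 4 ∂ν := by
        rw [integral_add (iu.const_mul _) (iw.const_mul _), integral_const_mul, integral_const_mul]
    _ ≤ 1 / (2 * c) * (K * c ^ 2) + c / 2 * (K * (‖w‖ ^ 2) ^ 2) := by
        gcongr
        · exact h.integral_inner_pow_four_le u
        · exact h.integral_inner_pow_four_le w
    _ = K * c := by rw [hw]; field_simp; ring

theorem norm_sq_eq_sum_inner [DecidableEq ι] (x : EuclideanSpace ℝ ι) :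
    ‖x‖ ^ 2 = ∑ j, inner ℝ (EuclideanSpace.single j (1 : ℝ)) x ^ 2 := by
  rw [EuclideanSpace.real_norm_sq_eq]
  simp [EuclideanSpace.inner_single_left]

/-- Expanding ‖Z‖² in an orthonormal basis and using the kurtosis in each direction makes the cost
linear in the dimension. -/
theorem integral_inner_sq_mul_norm_sq_le (h : IsIsotropic ν Z K)
    (u : EuclideanSpace ℝ ι) :
    ∫ z, inner ℝ u (Z z) ^ 2 * ‖Z z‖ ^ 2 ∂ν ≤ K * Fintype.card ι * ‖u‖ ^ 2 := by
  classical
  simp only [norm_sq_eq_sum_inner (Z _), Finset.mul_sum]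
  rw [integral_finsetSum _ fun j _ => h.integrable_inner_sq_mul u _]
  calc _ ≤ ∑ _j : ι, K * ‖u‖ ^ 2 :=
        Finset.sum_le_sum fun j _ => h.integral_inner_sq_mul_le u _ (by simp)
    _ = _ := by simp; ring

theorem integral_norm_pow_four_le (h : IsIsotropic ν Z K) :
    ∫ z, (‖Z z‖ ^ 2) ^ 2 ∂ν ≤ K * (Fintype.card ι : ℝ) ^ 2 := by
  classical
  have e : ∀ z, (‖Z z‖ ^ 2) ^ 2 =
      ∑ j, inner ℝ (EuclideanSpace.single j (1 : ℝ)) (Z z) ^ 2 * ‖Z z‖ ^ 2 := by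
    intro z
    rw [← Finset.sum_mul, ← norm_sq_eq_sum_inner, sq]
  simp only [e]
  have hi : ∀ u, Integrable (fun z => inner ℝ u (Z z) ^ 2 * ‖Z z‖ ^ 2) ν := fun u => by
    simpa using integrable_inner_pow_mul h.measurable h.integrable_norm_pow_four u (k := 2) (j := 1)
      (by norm_num)
  rw [integral_finsetSum _ fun j _ => hi _]
  calc _ ≤ ∑ _j : ι, K * Fintype.card ι * 1 :=
        Finset.sum_le_sum fun j _ => by
          simpa using h.integral_inner_sq_mul_norm_sq_le (EuclideanSpace.single j (1 : ℝ))
    _ = _ := by simp; ring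

theorem integral_norm_sq (h : IsIsotropic ν Z K) :
    ∫ z, ‖Z z‖ ^ 2 ∂ν = Fintype.card ι := by
  classical
  simp only [norm_sq_eq_sum_inner (Z _)]
  rw [integral_finsetSum _ fun j _ => h.integrable_inner_pow _ (by norm_num)]
  simp [h.integral_inner_sq]

/-- Uniform deviation bound for the clipped empirical quadratic form of an isotropic vector. -/
theorem sum_softClip_le (h : IsIsotropic ν Z K) (hK : 0 ≤ K) {D : ℝ}
    (hD : (Fintype.card ι : ℝ) ≤ D) {n : ℕ} {τ l a b ε : ℝ} (hτ : τ ^ 2 = 1) (hε : 0 < ε)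
    (hb : 0 < b) (hal : 0 ≤ a * l) :
    (Measure.pi fun _ : Fin n => ν) {z | ¬ ∀ u : EuclideanSpace ℝ ι, ‖u‖ ^ 2 = a * l →
      ∑ i, softClip (τ * (inner ℝ u (Z (z i)) ^ 2 - l)) ≤
        n * (τ * ((a - 1) * l) + l ^ 2 / 2 * (K * a ^ 2 - 2 * a + 1) +
          30.6 * (b * (K * D * (a * l))) + 58.2 * (b ^ 2 * (K * D ^ 2))) +
        a * l / (2 * b) + Real.log ε⁻¹} ≤ ENNReal.ofReal ε := by
  -- A standard perturbation tested against √b Z has variance b‖Z‖². The centre is then u/√b, and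
  -- its entropy cost is ‖u‖²/(2b) = al/(2b).
  set T : S → EuclideanSpace ℝ ι := fun z => √b • Z z with hTdef
  have hZ := h.measurable
  have hTm : Measurable T := by fun_prop
  have hsb : √b ^ 2 = b := Real.sq_sqrt hb.le
  have hsb0 : 0 < √b := Real.sqrt_pos.2 hb
  have hTn : ∀ z, ‖T z‖ ^ 2 = b * ‖Z z‖ ^ 2 := by
    intro z
    rw [hTdef]
    simp only [norm_smul, mul_pow, Real.norm_eq_abs, sq_abs, hsb]
  have hT4 : Integrable (fun z => ‖T z‖ ^ 4) ν := by
    have e : ∀ z, ‖T z‖ ^ 4 = b ^ 2 * ‖Z z‖ ^ 4 := by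
      intro z
      rw [show ‖T z‖ ^ 4 = (‖T z‖ ^ 2) ^ 2 by ring, hTn]; ring
    simp only [e]
    exact h.integrable_norm_pow_four.const_mul _
  refine le_trans (measure_mono ?_) (sum_softClip_le_integral (n := n) (l := l) hTm hT4 hτ hε)
  rintro z hz hcon
  refine hz fun u hu => ?_
  have hin : ∀ y, inner ℝ ((√b)⁻¹ • u) (T y) = inner ℝ u (Z y) := by
    intro y
    simp only [hTdef]
    rw [real_inner_smul_left, real_inner_smul_right, ← mul_assoc, inv_mul_cancel₀ hsb0.ne', one_mul]
  have hv := hcon ((√b)⁻¹ • u)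
  simp only [hin, hTn] at hv
  have hnv : ‖(√b)⁻¹ • u‖ ^ 2 / 2 = a * l / (2 * b) := by
    rw [norm_smul, mul_pow, hu, Real.norm_eq_abs, sq_abs, inv_pow, hsb]
    field_simp
  rw [hnv] at hv
  refine hv.trans ?_
  have j4 := h.integrable_inner_pow u (k := 4) le_rfl
  have j2 := h.integrable_inner_pow u (k := 2) (by norm_num)
  have jm : Integrable (fun z => inner ℝ u (Z z) ^ 2 * ‖Z z‖ ^ 2) ν := by
    simpa using integrable_inner_pow_mul h.measurable h.integrable_norm_pow_four u (k := 2) (j := 1)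
      (by norm_num)
  have jn : Integrable (fun z => (‖Z z‖ ^ 2) ^ 2) ν := by
    have := h.integrable_norm_pow_four
    simpa only [← pow_mul] using this
  have e : ∀ y, τ * (inner ℝ u (Z y) ^ 2 - l) + (inner ℝ u (Z y) ^ 2 - l) ^ 2 / 2 +
      30.6 * (inner ℝ u (Z y) ^ 2 * (b * ‖Z y‖ ^ 2)) + 58.2 * (b * ‖Z y‖ ^ 2) ^ 2 =
      1 / 2 * inner ℝ u (Z y) ^ 4 + (τ - l) * inner ℝ u (Z y) ^ 2 +
      30.6 * b * (inner ℝ u (Z y) ^ 2 * ‖Z y‖ ^ 2) + 58.2 * b ^ 2 * (‖Z y‖ ^ 2) ^ 2 +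
      (l ^ 2 / 2 - τ * l) := by intro y; ring
  simp only [e]
  have k1 : Integrable (fun y => 1 / 2 * inner ℝ u (Z y) ^ 4 + (τ - l) * inner ℝ u (Z y) ^ 2) ν :=
    (j4.const_mul _).add (j2.const_mul _)
  have k2 : Integrable (fun y => 1 / 2 * inner ℝ u (Z y) ^ 4 + (τ - l) * inner ℝ u (Z y) ^ 2 +
      30.6 * b * (inner ℝ u (Z y) ^ 2 * ‖Z y‖ ^ 2)) ν := k1.add (jm.const_mul _)
  have k3 : Integrable (fun y => 1 / 2 * inner ℝ u (Z y) ^ 4 + (τ - l) * inner ℝ u (Z y) ^ 2 +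
      30.6 * b * (inner ℝ u (Z y) ^ 2 * ‖Z y‖ ^ 2) + 58.2 * b ^ 2 * (‖Z y‖ ^ 2) ^ 2) ν :=
    k2.add (jn.const_mul _)
  rw [integral_add k3 (integrable_const _), integral_add k2 (jn.const_mul _),
    integral_add k1 (jm.const_mul _), integral_add (j4.const_mul _) (j2.const_mul _),
    integral_const_mul, integral_const_mul, integral_const_mul, integral_const_mul,
    h.integral_inner_sq, hu]
  simp only [integral_const, probReal_univ, smul_eq_mul, one_mul]
  have b4 := h.integral_inner_pow_four_le u
  rw [hu] at b4
  have bm : ∫ z, inner ℝ u (Z z) ^ 2 * ‖Z z‖ ^ 2 ∂ν ≤ K * D * (a * l) := by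
    refine (h.integral_inner_sq_mul_norm_sq_le u).trans ?_
    rw [hu]; gcongr
  have bn : ∫ z, (‖Z z‖ ^ 2) ^ 2 ∂ν ≤ K * D ^ 2 := by
    refine (h.integral_norm_pow_four_le).trans ?_
    gcongr
  have : 1 / 2 * ∫ z, inner ℝ u (Z z) ^ 4 ∂ν + (τ - l) * (a * l) +
      30.6 * b * ∫ z, inner ℝ u (Z z) ^ 2 * ‖Z z‖ ^ 2 ∂ν +
      58.2 * b ^ 2 * ∫ z, (‖Z z‖ ^ 2) ^ 2 ∂ν + (l ^ 2 / 2 - τ * l) ≤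
      τ * ((a - 1) * l) + l ^ 2 / 2 * (K * a ^ 2 - 2 * a + 1) +
          30.6 * (b * (K * D * (a * l))) + 58.2 * (b ^ 2 * (K * D ^ 2)) := by
    calc _ ≤ 1 / 2 * (K * (a * l) ^ 2) + (τ - l) * (a * l) +
      30.6 * b * (K * D * (a * l)) + 58.2 * b ^ 2 * (K * D ^ 2) + (l ^ 2 / 2 - τ * l) := by gcongr
      _ = _ := by ring
  gcongr

end IsIsotropic

end isotropic

/-! ### Choice of the truncation level and of the perturbation variance -/

section numeric

/-- The truncation level `√(2 L / ((K - 1) n))`. -/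
noncomputable def clipLevel (d : ℕ) (K ε : ℝ) (n : ℕ) : ℝ :=
  √(2 * logTerm d ε / ((K - 1) * n))

variable {d n : ℕ} {K ε : ℝ}

theorem logTerm_pos (hε : 0 < ε) (hε1 : ε < 1) : 0 < logTerm d ε := by
  have := Real.log_pos ((one_lt_inv₀ hε).2 hε1)
  unfold logTerm
  positivity

theorem SampleSizeCond.pos (h : SampleSizeCond d K ε n) : 0 < n := by
  unfold SampleSizeCond at h
  have : (0 : ℝ) < n := lt_of_le_of_lt (sq_nonneg _) h
  exact_mod_cast this

theorem clipLevel_pos (hK : 1 < K) (hL : 0 < logTerm d ε) (hn : 0 < n) :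
    0 < clipLevel d K ε n := by
  have hn' : (0 : ℝ) < n := by exact_mod_cast hn
  have : 0 < K - 1 := by linarith
  exact Real.sqrt_pos.2 (by positivity)

theorem sqrt_eq_mul_clipLevel (hK : 1 < K) (hn : 0 < n) :
    √(2 * (K - 1) / n * logTerm d ε) = (K - 1) * clipLevel d K ε n := by
  have hn' : (0 : ℝ) < n := by exact_mod_cast hn
  have hK' : 0 < K - 1 := by linarith
  calc _ = √((K - 1) ^ 2 * (2 * logTerm d ε / ((K - 1) * n))) := by
        congr 1
        field_simp
    _ = √((K - 1) ^ 2) * clipLevel d K ε n := Real.sqrt_mul (by positivity) _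
    _ = _ := by rw [Real.sqrt_sq hK'.le]

theorem clipLevel_sq (hK : 1 < K) (hL : 0 < logTerm d ε) (hn : 0 < n) :
    (K - 1) * clipLevel d K ε n ^ 2 = 2 * logTerm d ε / n := by
  have hn' : (0 : ℝ) < n := by exact_mod_cast hn
  have hK' : 0 < K - 1 := by linarith
  rw [clipLevel, Real.sq_sqrt (by positivity)]
  field_simp

/-- The dimension term `√K √(2 (d + 1) / n)`. -/
noncomputable def dimTerm (d : ℕ) (K : ℝ) (n : ℕ) : ℝ := √K * √(2 * ((d : ℝ) + 1) / n)

theorem dimTerm_pos (hK : 1 < K) (hn : 0 < n) : 0 < dimTerm d K n := by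
  have hn' : (0 : ℝ) < n := by exact_mod_cast hn
  have : 0 < K := by linarith
  exact mul_pos (Real.sqrt_pos.2 this) (Real.sqrt_pos.2 (by positivity))

theorem dimTerm_sq (hK : 1 < K) : dimTerm d K n ^ 2 = K * (2 * ((d : ℝ) + 1) / n) := by
  rw [dimTerm, mul_pow, Real.sq_sqrt (by linarith), Real.sq_sqrt (by positivity)]

theorem muBound_eq (hK : 1 < K) (hn : 0 < n) :
    muBound d K ε n = (K - 1) * clipLevel d K ε n + 6.81 * dimTerm d K n := by
  rw [muBound, sqrt_eq_mul_clipLevel hK hn, dimTerm, mul_assoc]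

/-- With l = `clipLevel` and m = `dimTerm`, dividing the sample size condition by √n gives 14m +
(5/2)(K - 1)l + l/2 < 1, as 20/√2 ≥ 14. Twice this inequality is stronger than the claim, because μ
= (K - 1)l + 6.81m and 4 · 6.81 ≤ 28. -/
theorem SampleSizeCond.le (h : SampleSizeCond d K ε n) (hK : 1 < K) (hL : 0 < logTerm d ε) :
    K * clipLevel d K ε n < 2 * (1 - 2 * muBound d K ε n) := by
  have hn := h.pos
  have hn' : (0 : ℝ) < n := by exact_mod_cast hn
  have hK' : 0 < K - 1 := by linarith
  have hsn : 0 < √(n : ℝ) := Real.sqrt_pos.2 hn'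
  unfold SampleSizeCond at h
  have h1 := Real.lt_sqrt_of_sq_lt h
  have e1 : √(2 * (K - 1) * logTerm d ε) = (K - 1) * clipLevel d K ε n * √n := by
    rw [← sqrt_eq_mul_clipLevel hK hn, ← Real.sqrt_mul (by positivity)]
    congr 1
    field_simp
  have e2 : √2 * (√K * √((d : ℝ) + 1)) = dimTerm d K n * √n := by
    have e3 : √2 * √((d : ℝ) + 1) = √(2 * ((d : ℝ) + 1) / n) * √n := by
      rw [← Real.sqrt_mul (by positivity), ← Real.sqrt_mul (by positivity)]
      congr 1
      field_simp
    rw [dimTerm]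
    linear_combination √K * e3
  obtain ⟨-, b2⟩ := sqrt_two_bounds
  have e4 : dimTerm d K n * √n ≤ 1.4143 * (√K * √((d : ℝ) + 1)) := by
    rw [← e2]; gcongr
  rw [e1] at h1
  set l := clipLevel d K ε n with hl
  have e5 : (5 / 2 + 1 / (2 * (K - 1))) * ((K - 1) * l * √n) =
      (5 / 2 * (K - 1) * l + l / 2) * √n := by field_simp
  rw [e5] at h1
  have h2 : (14 * dimTerm d K n + (5 / 2 * (K - 1) * l + l / 2)) * √n < 1 * √n := by
    have : 0 ≤ √K * √((d : ℝ) + 1) := by positivity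
    nlinarith
  have h3 := lt_of_mul_lt_mul_right h2 hsn.le
  have h4 := dimTerm_pos (d := d) hK hn
  rw [muBound_eq hK hn]
  linarith

theorem SampleSizeCond.muBound_lt (h : SampleSizeCond d K ε n) (hK : 1 < K)
    (hL : 0 < logTerm d ε) : 0 < muBound d K ε n ∧ 0 < 1 - 2 * muBound d K ε n := by
  have h1 := h.le hK hL
  have h2 := clipLevel_pos hK hL h.pos
  have h3 := dimTerm_pos (d := d) hK h.pos
  have h4 : 0 < K * clipLevel d K ε n := by positivity
  refine ⟨?_, by linarith⟩
  rw [muBound_eq hK h.pos]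
  have : 0 < (K - 1) * clipLevel d K ε n := mul_pos (by linarith) h2
  linarith

theorem deltaHat_mul (h : SampleSizeCond d K ε n) (hK : 1 < K) (hL : 0 < logTerm d ε) :
    0 < deltaHat d K ε n ∧ deltaHat d K ε n * (1 - 2 * muBound d K ε n) = muBound d K ε n := by
  obtain ⟨h1, h2⟩ := h.muBound_lt hK hL
  exact ⟨div_pos h1 h2, div_mul_cancel₀ _ h2.ne'⟩

/-- With the perturbation variance `1 / (7 n m)`, where `m` is the dimension term, the
deviation bound for the clipped form is nonpositive at the radii `1 ± δ̂`. -/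
theorem deviation_bound_nonpos (h : SampleSizeCond d K ε n) (hK : 1 < K) (hL : 0 < logTerm d ε)
    (hδ : deltaHat d K ε n < 1) {τ a l b : ℝ} (hτ : τ = 1 ∨ τ = -1)
    (ha : a = 1 - τ * deltaHat d K ε n) (hl : l = clipLevel d K ε n)
    (hb : b = (7 * n * dimTerm d K n)⁻¹) :
    n * (τ * ((a - 1) * l) + l ^ 2 / 2 * (K * a ^ 2 - 2 * a + 1) +
          30.6 * (b * (K * ((d : ℝ) + 1) * (a * l))) + 58.2 * (b ^ 2 * (K * ((d : ℝ) + 1) ^ 2))) +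
        a * l / (2 * b) + Real.log ε⁻¹ ≤ 0 := by
  have hn := h.pos
  have hn' : (0 : ℝ) < n := by exact_mod_cast hn
  have hKp : 0 < K := by linarith
  have hl0 : 0 < l := hl ▸ clipLevel_pos hK hL hn
  have hm0 := dimTerm_pos (d := d) hK hn
  have hm2 := dimTerm_sq (d := d) (n := n) hK
  have hl2 := clipLevel_sq hK hL hn
  have hmu := muBound_eq (d := d) (ε := ε) hK hn
  have hle := h.le hK hL
  obtain ⟨hx0, hx⟩ := deltaHat_mul h hK hL
  obtain ⟨hmu0, hmu1⟩ := h.muBound_lt hK hL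
  rw [← hl] at hl2 hmu hle
  set m := dimTerm d K n with hm
  set x := deltaHat d K ε n with hxdef
  set μ := muBound d K ε n with hμ
  set D := (d : ℝ) + 1 with hD
  have hD0 : 0 < D := by positivity
  have hKD : K * D = m ^ 2 * n / 2 := by rw [hm2]; field_simp
  have hL' : logTerm d ε = n * ((K - 1) * l ^ 2) / 2 := by rw [hl2]; field_simp
  have ha0 : 0 ≤ a := by
    rcases hτ with rfl | rfl <;> rw [ha] <;> linarith
  -- Since KD = m²n/2, the choice b = 1/(7nm) makes this term and the entropy term multiples of alm:
  -- after division by n they are 30.6/14 and 3.5, with sum below 6.81. The remaining term becomes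
  -- (58.2/98)D ≤ 0.73D, which enters `logTerm`.
  have t1 : 30.6 * (b * (K * D * (a * l))) = 30.6 / 14 * (a * l * m) := by
    rw [hKD, hb]; field_simp; ring
  have t2 : n * (58.2 * (b ^ 2 * (K * D ^ 2))) = 58.2 / 98 * D := by
    rw [show K * D ^ 2 = K * D * D by ring, hKD, hb]; field_simp; norm_num
  have t3 : a * l / (2 * b) = n * (3.5 * (a * l * m)) := by
    rw [hb]; field_simp; ring
  have t4 : Real.log ε⁻¹ + 58.2 / 98 * D ≤ n * ((K - 1) * l ^ 2) / 2 := by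
    rw [← hL', logTerm]
    have : 58.2 / 98 * D ≤ 0.73 * D := by gcongr; norm_num
    linarith
  have t5 : 0 ≤ a * l * m := by positivity
  -- With a = 1 - τx the left side is -x + μ(1 - τx) + Klx²/2. Substituting x = μ + 2μx, the
  -- definition of δ̂, leaves at most -μx + Klx²/2, and Klx/2 ≤ (1 - 2μ)x = μ.
  have key : τ * (a - 1) + l / 2 * (K * a ^ 2 - 2 * a + 1) + a * (6.81 * m) +
      (K - 1) * l / 2 ≤ 0 := by
    have q : K * l / 2 * x ^ 2 ≤ μ * x := by
      calc K * l / 2 * x ^ 2 ≤ (1 - 2 * μ) * x ^ 2 := by gcongr; linarith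
        _ = x * (1 - 2 * μ) * x := by ring
        _ = μ * x := by rw [hx]
    have hmx : 0 ≤ μ * x := by positivity
    have hmm : 6.81 * m = μ - (K - 1) * l := by linarith
    rw [hmm]
    rcases hτ with rfl | rfl
    · rw [ha]
      linarith
    · rw [ha]
      linarith
  have key2 : n * (l * (τ * (a - 1) + l / 2 * (K * a ^ 2 - 2 * a + 1) + a * (6.81 * m) +
      (K - 1) * l / 2)) ≤ 0 :=
    mul_nonpos_of_nonneg_of_nonpos hn'.le (mul_nonpos_of_nonneg_of_nonpos hl0.le key)
  have t6 : n * (5.69 * (a * l * m)) ≤ n * (6.81 * (a * l * m)) := by gcongr; norm_num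
  have t7 : n * (30.6 / 14 * (a * l * m)) ≤ n * (2.19 * (a * l * m)) := by gcongr; norm_num
  rw [mul_add, t2, mul_add, t1, t3]
  linarith

end numeric

/-! ### Empirical means under polynomial moments -/

section moments

variable {S : Type*} [MeasurableSpace S] {ν : Measure S} [IsProbabilityMeasure ν]

/-- One-sided Chebyshev inequality for an empirical mean. -/
theorem measure_lt_average_le {g : S → ℝ} (hg : MemLp g 2 ν) {n : ℕ} (hn : 0 < n) {c V ε : ℝ}
    (hc : 0 < c) (hV : ∫ z, g z ^ 2 ∂ν ≤ V) (hVε : V ≤ ε * (n * c ^ 2)) :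
    (Measure.pi fun _ : Fin n => ν) {z | ∫ y, g y ∂ν + c < (1 / (n : ℝ)) * ∑ i, g (z i)} ≤
      ENNReal.ofReal ε := by
  have hn' : (0 : ℝ) < n := by exact_mod_cast hn
  have hX : ∀ i, MemLp (fun z : Fin n → S => g (z i)) 2 (Measure.pi fun _ : Fin n => ν) :=
    fun i => hg.comp_measurePreserving (measurePreserving_eval (fun _ : Fin n => ν) i)
  have hsum : MemLp (fun z : Fin n → S => ∑ i, g (z i)) 2 (Measure.pi fun _ : Fin n => ν) :=
    memLp_finsetSum _ fun i _ => hX i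
  have hmean : ∫ z : Fin n → S, ∑ i, g (z i) ∂(Measure.pi fun _ : Fin n => ν) =
      n * ∫ y, g y ∂ν := by
    rw [integral_finsetSum _ fun i _ => (hX i).integrable (by norm_num)]
    have : ∀ i : Fin n, ∫ z : Fin n → S, g (z i) ∂(Measure.pi fun _ : Fin n => ν) =
        ∫ y, g y ∂ν := by
      intro i
      have hp := measurePreserving_eval (fun _ : Fin n => ν) i
      conv_rhs => rw [← hp.map_eq]
      rw [integral_map hp.measurable.aemeasurable
        (by rw [hp.map_eq]; exact hg.aestronglyMeasurable)]
    simp [this]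
  have hvar : Var[fun z : Fin n → S => ∑ i, g (z i); Measure.pi fun _ : Fin n => ν] ≤ n * V := by
    have h1 := variance_sum_pi (μ := fun _ : Fin n => ν) (X := fun _ => g) (fun _ => hg)
    have h2 : (∑ i, fun z : Fin n → S => g (z i)) = fun z => ∑ i, g (z i) := by
      ext z; simp
    rw [h2] at h1
    rw [h1]
    calc ∑ _i : Fin n, Var[g; ν] ≤ ∑ _i : Fin n, V := Finset.sum_le_sum fun i _ => ?_
      _ = n * V := by simp
    exact (variance_le_expectation_sq hg.aestronglyMeasurable).trans hV
  have hcheb := meas_ge_le_variance_div_sq hsum (c := n * c) (by positivity)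
  refine le_trans (measure_mono ?_) (hcheb.trans (ENNReal.ofReal_le_ofReal ?_))
  · intro z hz
    simp only [Set.mem_ofPred_eq] at hz ⊢
    rw [hmean]
    refine le_trans ?_ (le_abs_self _)
    have := mul_lt_mul_of_pos_left hz hn'
    rw [← mul_assoc, mul_one_div_cancel hn'.ne', one_mul] at this
    linarith
  · rw [div_le_iff₀ (by positivity)]
    calc _ ≤ n * V := hvar
      _ ≤ n * (ε * (n * c ^ 2)) := by gcongr
      _ = _ := by ring

/-- Upper deviations of the empirical mean of a nonnegative random variable with a finite moment
of order `q ∈ (1, 2]`. -/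
theorem measure_lt_average_le_of_rpow {g : S → ℝ} (hgm : Measurable g) (hg0 : ∀ z, 0 ≤ g z)
    {q k : ℝ} (hqk : (1 < q ∧ q < 2 ∧ k = 4) ∨ (q = 2 ∧ k = 3))
    (hgq : Integrable (fun z => g z ^ q) ν) {R : ℝ} (hR : 0 < R) (hgR : ∫ z, g z ^ q ∂ν ≤ R)
    {n : ℕ} (hn : 0 < n) {ε : ℝ} (hε : 0 < ε) :
    (Measure.pi fun _ : Fin n => ν) {z | ∫ y, g y ∂ν +
      R ^ (1 / q) / (ε ^ (1 / q) * (n : ℝ) ^ (1 - 1 / q)) < (1 / (n : ℝ)) * ∑ i, g (z i)} ≤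
      ENNReal.ofReal ((k - 2) * ε) := by
  have hn' : (0 : ℝ) < n := by exact_mod_cast hn
  have hq0 : 0 < q := by rcases hqk with h | h <;> linarith [h.1]
  -- The level t is such that nR/t^q = ε, and the claimed deviation is t/n.
  set t := (n * R / ε) ^ (1 / q) with ht
  have ht0 : 0 < t := by positivity
  have htq : t ^ q = n * R / ε := by
    rw [ht, ← Real.rpow_mul (by positivity), one_div_mul_cancel hq0.ne', Real.rpow_one]
  have hct : R ^ (1 / q) / (ε ^ (1 / q) * (n : ℝ) ^ (1 - 1 / q)) = t / n := by
    rw [ht, Real.div_rpow (by positivity) hε.le, Real.mul_rpow hn'.le hR.le,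
      Real.rpow_sub hn', Real.rpow_one]
    have h1 : 0 < ε ^ (1 / q) := by positivity
    have h2 : 0 < (n : ℝ) ^ (1 / q) := by positivity
    field_simp
  rw [hct]
  have hV : t ^ 2 * ε / n = ε * (n * (t / n) ^ 2) := by field_simp
  rcases hqk with ⟨hq1, hq2, rfl⟩ | ⟨rfl, rfl⟩
  -- For q < 2, truncate at t. Some g(zᵢ) exceeds t with probability at most nR/t^q = ε, and the
  -- truncated variable has second moment at most t^{2-q}R, so Chebyshev at distance t/n costs ε
  -- again. For q = 2 Chebyshev alone suffices, hence the factor k - 2.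
  · set h : S → ℝ := fun z => min (g z) t with hh
    have hhm : Measurable h := hgm.min measurable_const
    have hh0 : ∀ z, 0 ≤ h z := fun z => le_min (hg0 z) ht0.le
    have hht : ∀ z, h z ≤ t := fun z => min_le_right _ _
    have hh2 : MemLp h 2 ν := MemLp.of_bound hhm.aestronglyMeasurable t
      (Eventually.of_forall fun z => by rw [Real.norm_eq_abs, abs_of_nonneg (hh0 z)]; exact hht z)
    have hgi : Integrable g ν := by
      refine ((integrable_const 1).add hgq).mono hgm.aestronglyMeasurable
        (Eventually.of_forall fun z => ?_)
      have h5 : 0 ≤ g z ^ q := Real.rpow_nonneg (hg0 z) q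
      rw [Pi.add_apply, Real.norm_eq_abs, abs_of_nonneg (hg0 z), Real.norm_eq_abs,
        abs_of_nonneg (by linarith)]
      rcases le_total (g z) 1 with h1 | h1
      · linarith
      · have := Real.rpow_le_rpow_of_exponent_le h1 hq1.le
        rw [Real.rpow_one] at this
        linarith
    have hsq : ∫ z, h z ^ 2 ∂ν ≤ t ^ (2 - q) * R := by
      calc _ ≤ ∫ z, t ^ (2 - q) * g z ^ q ∂ν := by
            refine integral_mono hh2.integrable_sq (hgq.const_mul _) fun z => ?_
            have e : h z ^ 2 = h z ^ (2 - q) * h z ^ q := by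
              rw [← Real.rpow_add' (hh0 z) (by norm_num), sub_add_cancel, Real.rpow_two]
            simp only [e]
            have h1 : h z ^ (2 - q) ≤ t ^ (2 - q) :=
              Real.rpow_le_rpow (hh0 z) (hht z) (by linarith)
            have h2 : h z ^ q ≤ g z ^ q := Real.rpow_le_rpow (hh0 z) (min_le_left _ _) hq0.le
            have h3 : 0 ≤ h z ^ q := Real.rpow_nonneg (hh0 z) _
            gcongr
        _ = t ^ (2 - q) * ∫ z, g z ^ q ∂ν := integral_const_mul _ _
        _ ≤ _ := by gcongr
    have hVR : t ^ (2 - q) * R ≤ ε * (n * (t / n) ^ 2) := by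
      rw [← hV, Real.rpow_sub ht0, htq, Real.rpow_two]
      apply le_of_eq
      field_simp
    have hB := measure_lt_average_le hh2 hn (c := t / n) (by positivity) hsq hVR
    have hA : (Measure.pi fun _ : Fin n => ν) (⋃ i ∈ Finset.univ, {z : Fin n → S | t ≤ g (z i)}) ≤
        ENNReal.ofReal ε := by
      refine (measure_biUnion_finset_le _ _).trans ?_
      have h1 : ∀ i : Fin n, (Measure.pi fun _ : Fin n => ν) {z : Fin n → S | t ≤ g (z i)} ≤
          ENNReal.ofReal (ε / n) := by
        intro i
        have hp := measurePreserving_eval (fun _ : Fin n => ν) i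
        have hset : MeasurableSet {y : S | t ≤ g y} := measurableSet_le measurable_const hgm
        have e : {z : Fin n → S | t ≤ g (z i)} = Function.eval i ⁻¹' {y : S | t ≤ g y} := rfl
        rw [e, hp.measure_preimage hset.nullMeasurableSet]
        have h2 := meas_ge_le_lintegral_div (μ := ν) (f := fun y => ENNReal.ofReal (g y ^ q))
          (by fun_prop) (ε := ENNReal.ofReal (t ^ q)) (by simp; positivity) ENNReal.ofReal_ne_top
        refine (measure_mono ?_).trans (h2.trans ?_)
        · intro y hy
          exact ENNReal.ofReal_le_ofReal (Real.rpow_le_rpow ht0.le hy hq0.le)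
        · rw [← ofReal_integral_eq_lintegral_ofReal hgq
            (Eventually.of_forall fun z => Real.rpow_nonneg (hg0 z) q),
            ← ENNReal.ofReal_div_of_pos (by positivity)]
          apply ENNReal.ofReal_le_ofReal
          rw [htq, div_le_div_iff₀ (by positivity) hn']
          calc (∫ z, g z ^ q ∂ν) * n ≤ R * n := by gcongr
            _ = ε * (n * R / ε) := by field_simp
      calc _ ≤ ∑ _i : Fin n, ENNReal.ofReal (ε / n) := Finset.sum_le_sum fun i _ => h1 i
        _ = ENNReal.ofReal ε := by
          rw [Finset.sum_const, Finset.card_univ, Fintype.card_fin, nsmul_eq_mul,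
            ← ENNReal.ofReal_natCast, ← ENNReal.ofReal_mul hn'.le]
          congr 1
          field_simp
    rw [show ((4 : ℝ) - 2) * ε = ε + ε by ring, ENNReal.ofReal_add hε.le hε.le]
    refine (measure_mono ?_).trans ((measure_union_le _ _).trans (add_le_add hA hB))
    intro z hz
    by_cases hz1 : ∃ i, t ≤ g (z i)
    · left; simpa using hz1
    · right
      push Not at hz1
      have e : ∀ i, h (z i) = g (z i) := fun i => min_eq_left (hz1 i).le
      simp only [Set.mem_ofPred_eq, e] at hz ⊢
      have hm : ∫ y, h y ∂ν ≤ ∫ y, g y ∂ν :=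
        integral_mono (hh2.integrable (by norm_num)) hgi fun y => min_le_left _ _
      linarith
  · have hg2 : MemLp g 2 ν := by
      rw [memLp_two_iff_integrable_sq hgm.aestronglyMeasurable]
      simpa using hgq
    rw [show ((3 : ℝ) - 2) * ε = ε by ring]
    refine measure_lt_average_le hg2 hn (c := t / n) (by positivity) (V := R) (by simpa using hgR) ?_
    rw [← hV]
    rw [Real.rpow_two] at htq
    rw [htq]
    apply le_of_eq
    field_simp

/-- The moment argument above gives the deviation with constant 1, so the stated constant is only
needed to be at least 1. In logarithms, with r = q - 1 and c = (1 - r)/(1 + r), the bound log x ≤ x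
- 1 at 2r/(1 + r) and at 1 - r leaves the surplus rc(2 - log 2) ≥ 0. -/
theorem one_le_Cq {q : ℝ} (h1 : 1 < q) (h2 : q ≤ 2) : 1 ≤ Cq q := by
  unfold Cq
  rcases h2.eq_or_lt with rfl | h2
  · norm_num
  set r := q - 1 with hr
  have hq : q = 1 + r := by rw [hr]; ring
  have hr0 : 0 < r := by linarith
  have hr1 : r < 1 := by linarith
  have hx : 0 < (1 - r) / 2 := by linarith
  have e1 : 1 - q / 2 = (1 - r) / 2 := by rw [hq]; ring
  have e2 : (2 - q) / q = (1 - r) / (1 + r) := by rw [hq]; congr 1; ring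
  rw [e1, e2, hq]
  have hden : 0 < 2 * r ^ r * ((1 - r) / 2) ^ ((1 - r) / (1 + r)) := by positivity
  rw [one_le_div hden, ← Real.log_le_log_iff hden (by positivity),
    Real.log_mul (by positivity) (by positivity), Real.log_mul (by norm_num) (by positivity),
    Real.log_rpow hr0, Real.log_rpow hx, Real.log_rpow (by linarith)]
  have l1 : Real.log 2 + (1 - r) / (1 + r) ≤ Real.log (1 + r) - Real.log r := by
    have := Real.log_le_sub_one_of_pos (show 0 < 2 * r / (1 + r) by positivity)
    rw [Real.log_div (by positivity) (by positivity), Real.log_mul (by norm_num) hr0.ne'] at this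
    have e : 2 * r / (1 + r) - 1 = -((1 - r) / (1 + r)) := by field_simp; ring
    linarith
  have l2 : Real.log ((1 - r) / 2) ≤ -r - Real.log 2 := by
    rw [Real.log_div (by linarith) (by norm_num)]
    have := Real.log_le_sub_one_of_pos (show 0 < 1 - r by linarith)
    linarith
  have l3 := Real.log_two_lt_d9
  have hc : 0 ≤ (1 - r) / (1 + r) := div_nonneg (by linarith) (by linarith)
  have m1 := mul_le_mul_of_nonneg_left l1 hr0.le
  have m2 := mul_le_mul_of_nonneg_left l2 hc
  have m3 : (1 - r) / (1 + r) * Real.log 2 - (1 - r) * Real.log 2 =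
      -(r * ((1 - r) / (1 + r)) * Real.log 2) := by field_simp; ring
  have m4 : 0 ≤ r * ((1 - r) / (1 + r)) * (2 - Real.log 2) :=
    mul_nonneg (by positivity) (by linarith)
  linarith

end moments

/-! ### From the clipped form to the empirical quadratic form -/

section core

/-- If the clipped sum is nonpositive at radius `a l ≤ l`, then the quadratic form is bounded. -/
theorem sum_sq_le_of_softClip {n : ℕ} {s V : Fin n → ℝ} {l p M : ℝ} (hl : 0 < l)
    (hp : 1 < p) (hp2 : p ≤ 2) (hV : ∀ i, 0 ≤ V i) (hsV : ∀ i, s i ≤ l * V i)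
    (hM : ∑ i, V i ^ (p + 1) ≤ n * M) (h : ∑ i, softClip (s i - l) ≤ 0) :
    ∑ i, s i ≤ n * (l * (1 + 1 / (p + 1) * l ^ p * M)) := by
  have h1 : ∀ i, s i ≤ l + softClip (s i - l) + l ^ (p + 1) / (p + 1) * V i ^ (p + 1) := by
    intro i
    have h2 := le_softClip_add (t := s i - l) hp hp2
    -- Only the positive part of s - l is undervalued by ψ, and it is at most s ≤ lV; this is where
    -- the moments of the norm enter.
    have h3 : max (s i - l) 0 ^ (p + 1) ≤ (l * V i) ^ (p + 1) := by
      apply Real.rpow_le_rpow (le_max_right _ _) _ (by linarith)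
      exact max_le (by linarith [hsV i]) (mul_nonneg hl.le (hV i))
    rw [Real.mul_rpow hl.le (hV i)] at h3
    have h4 : max (s i - l) 0 ^ (p + 1) / (p + 1) ≤ l ^ (p + 1) / (p + 1) * V i ^ (p + 1) := by
      rw [div_mul_eq_mul_div]
      gcongr
    linarith
  have h2 := Finset.sum_le_sum fun i (_ : i ∈ Finset.univ) => h1 i
  rw [Finset.sum_add_distrib, Finset.sum_add_distrib, ← Finset.mul_sum] at h2
  simp only [Finset.sum_const, Finset.card_univ, Fintype.card_fin, nsmul_eq_mul] at h2
  have h3 : l ^ (p + 1) / (p + 1) * ∑ i, V i ^ (p + 1) ≤ l ^ (p + 1) / (p + 1) * (n * M) := by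
    gcongr
  have e : l ^ (p + 1) = l ^ p * l := by rw [Real.rpow_add hl, Real.rpow_one]
  rw [e] at h3 h2
  calc _ ≤ n * l + l ^ p * l / (p + 1) * (n * M) := by linarith
    _ = _ := by ring

/-- Nonnegativity of sᵢ gives sᵢ - l ≥ -l, so in this direction the clipping error is at most
l^{p+1}/(p+1) without any moment assumption. -/
theorem le_sum_sq_of_softClip {n : ℕ} {s : Fin n → ℝ} {l p : ℝ} (hl : 0 < l)
    (hp : 1 < p) (hp2 : p ≤ 2) (hs : ∀ i, 0 ≤ s i) (h : ∑ i, softClip (-1 * (s i - l)) ≤ 0) :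
    n * (l * (1 - 1 / (p + 1) * l ^ p)) ≤ ∑ i, s i := by
  have h1 : ∀ i, l - softClip (-1 * (s i - l)) - l ^ (p + 1) / (p + 1) ≤ s i := by
    intro i
    have h2 := softClip_le_add hp hp2 hl.le (t := s i - l) (by linarith [hs i])
    rw [neg_one_mul, softClip_neg]
    linarith
  have h2 := Finset.sum_le_sum fun i (_ : i ∈ Finset.univ) => h1 i
  rw [Finset.sum_sub_distrib, Finset.sum_sub_distrib] at h2
  simp only [Finset.sum_const, Finset.card_univ, Fintype.card_fin, nsmul_eq_mul] at h2
  have e : l ^ (p + 1) = l ^ p * l := by rw [Real.rpow_add hl, Real.rpow_one]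
  rw [e] at h2
  calc _ = n * l - n * (l ^ p * l / (p + 1)) := by ring
    _ ≤ _ := by linarith

variable {ι : Type*} [Fintype ι] {S : Type*} [MeasurableSpace S] {ν : Measure S}
  [IsProbabilityMeasure ν] {Z : S → EuclideanSpace ℝ ι} {K : ℝ}

theorem clipLevel_rpow {d n : ℕ} {ε : ℝ} (hK : 1 < K) (hL : 0 < logTerm d ε) {p : ℝ} :
    (2 * logTerm d ε / ((K - 1) * n)) ^ (p / 2) = clipLevel d K ε n ^ p := by
  have hK' : 0 < K - 1 := by linarith
  rw [clipLevel, Real.sqrt_eq_rpow, ← Real.rpow_mul (by positivity)]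
  congr 1
  ring

/-- Uniform relative deviation bound for the empirical quadratic form of an isotropic vector. -/
theorem IsIsotropic.measure_deviation_le (h : IsIsotropic ν Z K) (hK : 1 < K) {d n : ℕ}
    (hd : Fintype.card ι ≤ d + 1) {ε : ℝ} (hε : 0 < ε) (hε1 : ε < 1)
    (hn : SampleSizeCond d K ε n) (hδ : deltaHat d K ε n < 1) {p q k M₁ M₂ : ℝ}
    (hp : 1 < p) (hp2 : p ≤ 2) (hqk : (1 < q ∧ q < 2 ∧ k = 4) ∨ (q = 2 ∧ k = 3))
    (hi : Integrable (fun z => (‖Z z‖ ^ 2) ^ (q * (p + 1))) ν)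
    (hM₁ : ∫ z, (‖Z z‖ ^ 2) ^ (p + 1) ∂ν ≤ M₁ ^ (p + 1))
    (hM₂ : ∫ z, (‖Z z‖ ^ 2) ^ (q * (p + 1)) ∂ν ≤ M₂ ^ (q * (p + 1)))
    (h1M₁ : 1 ≤ M₁) (h1M₂ : 1 ≤ M₂) :
    (Measure.pi fun _ : Fin n => ν) {z | ¬ ∀ u : EuclideanSpace ℝ ι,
      (1 - gammaTilde d K M₁ M₂ p q ε n) / (1 + deltaHat d K ε n) * ‖u‖ ^ 2 ≤
        (1 / (n : ℝ)) * ∑ i, inner ℝ u (Z (z i)) ^ 2 ∧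
      (1 / (n : ℝ)) * ∑ i, inner ℝ u (Z (z i)) ^ 2 ≤
        (1 + gammaTilde d K M₁ M₂ p q ε n) / (1 - deltaHat d K ε n) * ‖u‖ ^ 2} ≤
      ENNReal.ofReal (k * ε) := by
  have hL := logTerm_pos (d := d) hε hε1
  have hn0 := hn.pos
  have hn' : (0 : ℝ) < n := by exact_mod_cast hn0
  have hl := clipLevel_pos (d := d) (ε := ε) hK hL hn0
  have hm := dimTerm_pos (d := d) hK hn0
  obtain ⟨hx, -⟩ := deltaHat_mul hn hK hL
  have hb : 0 < (7 * n * dimTerm d K n)⁻¹ := by positivity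
  have hD : (Fintype.card ι : ℝ) ≤ (d : ℝ) + 1 := by exact_mod_cast hd
  have hq1 : 1 < q := by rcases hqk with h | h <;> linarith [h.1]
  have hq2 : q ≤ 2 := by rcases hqk with h | h <;> linarith [h.1, h.2]
  have hk : 2 < k := by
    rcases hqk with h | h
    · linarith [h.2.2]
    · linarith [h.2]
  have hp0 : 0 < p + 1 := by linarith
  set x := deltaHat d K ε n with hxdef
  set l := clipLevel d K ε n with hldef
  set b := (7 * n * dimTerm d K n)⁻¹ with hbdef
  have hup := h.sum_softClip_le (by linarith) hD (n := n) (τ := 1) (l := l) (a := 1 - x) (b := b)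
    (ε := ε) (by norm_num) hε hb (mul_nonneg (by linarith) hl.le)
  have hlo := h.sum_softClip_le (by linarith) hD (n := n) (τ := -1) (l := l) (a := 1 + x) (b := b)
    (ε := ε) (by norm_num) hε hb (mul_nonneg (by linarith) hl.le)
  have nup := deviation_bound_nonpos hn hK hL hδ (τ := 1) (a := 1 - x) (Or.inl rfl)
    (by rw [one_mul]) hldef hbdef
  have nlo := deviation_bound_nonpos hn hK hL hδ (τ := -1) (a := 1 + x) (Or.inr rfl)
    (by ring) hldef hbdef
  have hZ := h.measurable
  have hpow : ∀ z, ((‖Z z‖ ^ 2) ^ (p + 1)) ^ q = (‖Z z‖ ^ 2) ^ (q * (p + 1)) := by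
    intro z
    rw [← Real.rpow_mul (by positivity), mul_comm]
  have hmo := measure_lt_average_le_of_rpow (ν := ν) (g := fun z => (‖Z z‖ ^ 2) ^ (p + 1))
    (by fun_prop) (fun z => by positivity) hqk (by simpa only [hpow] using hi)
    (R := M₂ ^ (q * (p + 1))) (by positivity) (by simpa only [hpow] using hM₂) hn0 hε
  set B := M₁ ^ (p + 1) + Cq q / (ε ^ (1 / q) * (n : ℝ) ^ (1 - 1 / q)) * M₂ ^ (p + 1) with hB
  -- B ≥ 1 lets the single quantity γ dominate the lower correction too, where no moment factor
  -- appears.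
  have hB1 : 1 ≤ B := by
    have h1 : 1 ≤ M₁ ^ (p + 1) := Real.one_le_rpow h1M₁ hp0.le
    have h2 : 0 ≤ Cq q := zero_le_one.trans (one_le_Cq hq1 hq2)
    have h3 : 0 ≤ Cq q / (ε ^ (1 / q) * (n : ℝ) ^ (1 - 1 / q)) * M₂ ^ (p + 1) := by positivity
    linarith
  have hBle : ∫ y, (‖Z y‖ ^ 2) ^ (p + 1) ∂ν + (M₂ ^ (q * (p + 1))) ^ (1 / q) /
      (ε ^ (1 / q) * (n : ℝ) ^ (1 - 1 / q)) ≤ B := by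
    have e : (M₂ ^ (q * (p + 1))) ^ (1 / q) = M₂ ^ (p + 1) := by
      rw [← Real.rpow_mul (by positivity)]
      congr 1
      field_simp
    rw [e, hB]
    have h2 := one_le_Cq hq1 hq2
    refine add_le_add hM₁ ?_
    rw [div_mul_eq_mul_div]
    gcongr
    exact le_mul_of_one_le_left (by positivity) h2
  have hγ : gammaTilde d K M₁ M₂ p q ε n = 1 / (p + 1) * l ^ p * (1 + x) ^ (p + 1) * B := by
    rw [gammaTilde, clipLevel_rpow hK hL]
  have hx1 : 1 ≤ (1 + x) ^ (p + 1) := Real.one_le_rpow (by linarith) hp0.le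
  have hlp : 0 ≤ 1 / (p + 1) * l ^ p := by positivity
  set γ := gammaTilde d K M₁ M₂ p q ε n with hγdef
  have hγB : 1 / (p + 1) * l ^ p * B ≤ γ := by
    rw [hγ]
    have : 1 / (p + 1) * l ^ p * 1 ≤ 1 / (p + 1) * l ^ p * (1 + x) ^ (p + 1) := by gcongr
    rw [mul_one] at this
    gcongr
  have hγ1 : 1 / (p + 1) * l ^ p ≤ γ := (le_mul_of_one_le_right hlp hB1).trans hγB
  -- Two ε for the upper and lower clipped deviations, (k - 2)ε for the empirical moment of the
  -- norm.
  have htot : ENNReal.ofReal (k * ε) =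
      ENNReal.ofReal ε + ENNReal.ofReal ε + ENNReal.ofReal ((k - 2) * ε) := by
    rw [← ENNReal.ofReal_add hε.le hε.le, ← ENNReal.ofReal_add (by positivity)
      (mul_nonneg (by linarith) hε.le)]
    congr 1; ring
  rw [htot]
  refine le_trans (measure_mono ?_) ((measure_union_le _ _).trans
    (add_le_add ((measure_union_le _ _).trans (add_le_add hup hlo)) hmo))
  intro z hz
  by_contra hcon
  simp only [Set.mem_union, Set.mem_ofPred_eq, not_or, not_not, not_lt] at hcon
  obtain ⟨⟨gup, glo⟩, gmo⟩ := hcon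
  refine hz fun u => ?_
  rcases eq_or_ne u 0 with rfl | hu
  · simp
  have hu0 : 0 < ‖u‖ ^ 2 := by positivity
  have hVsum : ∑ i, (‖Z (z i)‖ ^ 2) ^ (p + 1) ≤ n * B := by
    have := gmo.trans hBle
    rw [one_div, inv_mul_le_iff₀ hn'] at this
    exact this
  -- Both sides are homogeneous in u, so it is enough to rescale u to the radius √(al) at which the
  -- clipped bound holds.
  have hscale : ∀ a : ℝ, 0 < a → ‖(√(a * l) / ‖u‖) • u‖ ^ 2 = a * l ∧
      ∀ i, inner ℝ ((√(a * l) / ‖u‖) • u) (Z (z i)) ^ 2 =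
        a * l / ‖u‖ ^ 2 * inner ℝ u (Z (z i)) ^ 2 := by
    intro a ha
    have hs : √(a * l) ^ 2 = a * l := Real.sq_sqrt (by positivity)
    constructor
    · rw [norm_smul, mul_pow, Real.norm_eq_abs, sq_abs, div_pow, hs]
      field_simp
    · intro i
      rw [real_inner_smul_left, mul_pow, div_pow, hs]
  constructor
  · obtain ⟨e1, e2⟩ := hscale (1 + x) (by linarith)
    have g := (glo _ e1).trans nlo
    have g2 := le_sum_sq_of_softClip hl hp hp2 (fun i => sq_nonneg _) g
    simp only [e2] at g2
    rw [← Finset.mul_sum] at g2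
    have g3 : n * (l * (1 - γ)) ≤ (1 + x) * l / ‖u‖ ^ 2 * ∑ i, inner ℝ u (Z (z i)) ^ 2 := by
      refine le_trans ?_ g2
      gcongr
    rw [div_mul_eq_mul_div, le_div_iff₀ hu0] at g3
    rw [div_mul_eq_mul_div, one_div, inv_mul_eq_div, div_le_div_iff₀ (by linarith) hn']
    refine le_of_mul_le_mul_left ?_ hl
    linarith
  · obtain ⟨e1, e2⟩ := hscale (1 - x) (by linarith)
    have g := (gup _ e1).trans nup
    simp only [one_mul] at g
    have g2 := sum_sq_le_of_softClip hl hp hp2 (V := fun i => ‖Z (z i)‖ ^ 2)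
      (fun i => by positivity) (fun i => by
        have h1 := abs_real_inner_le_norm ((√((1 - x) * l) / ‖u‖) • u) (Z (z i))
        have h2 := pow_le_pow_left₀ (abs_nonneg _) h1 2
        rw [sq_abs, mul_pow, e1] at h2
        refine h2.trans ?_
        gcongr
        exact mul_le_of_le_one_left hl.le (by linarith)) hVsum g
    simp only [e2] at g2
    rw [← Finset.mul_sum] at g2
    have g3 : (1 - x) * l / ‖u‖ ^ 2 * ∑ i, inner ℝ u (Z (z i)) ^ 2 ≤ n * (l * (1 + γ)) := by
      refine g2.trans ?_
      gcongr
    rw [div_mul_eq_mul_div, div_le_iff₀ hu0] at g3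
    rw [div_mul_eq_mul_div, one_mul, div_mul_eq_mul_div, div_le_div_iff₀ hn' (by linarith)]
    refine le_of_mul_le_mul_left ?_ hl
    linarith

end core

/-! ### Minkowski inequalities -/

section minkowski

variable {Ω : Type*} [MeasurableSpace Ω] {P : Measure Ω}

/-- Minkowski's inequality for nonnegative real functions. -/
theorem integral_add_rpow_le {f g : Ω → ℝ} {s : ℝ} (hs : 1 ≤ s)
    (hf0 : ∀ ω, 0 ≤ f ω) (hg0 : ∀ ω, 0 ≤ g ω) (hfm : AEMeasurable f P) (hgm : AEMeasurable g P)
    (hf : Integrable (fun ω => f ω ^ s) P) (hg : Integrable (fun ω => g ω ^ s) P) :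
    Integrable (fun ω => (f ω + g ω) ^ s) P ∧
    (∫ ω, (f ω + g ω) ^ s ∂P) ^ (1 / s) ≤
      (∫ ω, f ω ^ s ∂P) ^ (1 / s) + (∫ ω, g ω ^ s ∂P) ^ (1 / s) := by
  have hs0 : 0 < s := by linarith
  have key : ∀ h : Ω → ℝ, (∀ ω, 0 ≤ h ω) → Integrable (fun ω => h ω ^ s) P →
      ∫⁻ ω, ENNReal.ofReal (h ω) ^ s ∂P = ENNReal.ofReal (∫ ω, h ω ^ s ∂P) := by
    intro h h0 hi
    rw [ofReal_integral_eq_lintegral_ofReal hi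
      (Eventually.of_forall fun ω => Real.rpow_nonneg (h0 ω) s)]
    exact lintegral_congr fun ω => ENNReal.ofReal_rpow_of_nonneg (h0 ω) hs0.le
  have hint : Integrable (fun ω => (f ω + g ω) ^ s) P := by
    refine ((hf.add hg).const_mul (2 ^ (s - 1))).mono
      ((hfm.add hgm).pow_const s).aestronglyMeasurable (Eventually.of_forall fun ω => ?_)
    have h1 : (f ω + g ω) ^ s ≤ 2 ^ (s - 1) * (f ω ^ s + g ω ^ s) := by
      exact_mod_cast NNReal.rpow_add_le_mul_rpow_add_rpow ⟨f ω, hf0 ω⟩ ⟨g ω, hg0 ω⟩ hs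
    have h2 : 0 ≤ (f ω + g ω) ^ s := Real.rpow_nonneg (add_nonneg (hf0 ω) (hg0 ω)) s
    rw [Real.norm_eq_abs, Real.norm_eq_abs, abs_of_nonneg h2, Pi.add_apply,
      abs_of_nonneg (h2.trans h1)]
    exact h1
  refine ⟨hint, ?_⟩
  have hM := ENNReal.lintegral_Lp_add_le (μ := P) hfm.ennreal_ofReal hgm.ennreal_ofReal hs
  have e : ∀ ω, ((fun ω => ENNReal.ofReal (f ω)) + fun ω => ENNReal.ofReal (g ω)) ω =
      ENNReal.ofReal (f ω + g ω) := fun ω => (ENNReal.ofReal_add (hf0 ω) (hg0 ω)).symm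
  simp only [e] at hM
  rw [key f hf0 hf, key g hg0 hg, key _ (fun ω => add_nonneg (hf0 ω) (hg0 ω)) hint] at hM
  have hnn : ∀ h : Ω → ℝ, (∀ ω, 0 ≤ h ω) → 0 ≤ ∫ ω, h ω ^ s ∂P := fun h h0 =>
    integral_nonneg fun ω => Real.rpow_nonneg (h0 ω) s
  have hs1 : 0 ≤ 1 / s := by positivity
  rw [ENNReal.ofReal_rpow_of_nonneg (hnn _ fun ω => add_nonneg (hf0 ω) (hg0 ω)) hs1,
    ENNReal.ofReal_rpow_of_nonneg (hnn _ hf0) hs1, ENNReal.ofReal_rpow_of_nonneg (hnn _ hg0) hs1,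
    ← ENNReal.ofReal_add (Real.rpow_nonneg (hnn _ hf0) _) (Real.rpow_nonneg (hnn _ hg0) _)] at hM
  exact (ENNReal.ofReal_le_ofReal_iff
    (add_nonneg (Real.rpow_nonneg (hnn _ hf0) _) (Real.rpow_nonneg (hnn _ hg0) _))).1 hM

/-- Minkowski's inequality in `L⁴`, in terms of squared `L⁴` norms. -/
theorem integral_add_pow_four_le {f g : Ω → ℝ} (hfm : AEMeasurable f P) (hgm : AEMeasurable g P)
    (hf : Integrable (fun ω => f ω ^ 4) P) (hg : Integrable (fun ω => g ω ^ 4) P)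
    {a b c e : ℝ} (ha : 0 ≤ a) (hb : 0 ≤ b) (hc : 0 ≤ c) (he : 0 ≤ e)
    (hfa : ∫ ω, f ω ^ 4 ∂P ≤ a * c ^ 2) (hgb : ∫ ω, g ω ^ 4 ∂P ≤ b * e ^ 2) :
    ∫ ω, (f ω + g ω) ^ 4 ∂P ≤ (√a + √b) ^ 2 * (c + e) ^ 2 := by
  have e4 : ∀ x : ℝ, |x| ^ (4 : ℝ) = x ^ 4 := fun x => by
    rw [show (4 : ℝ) = ((4 : ℕ) : ℝ) by norm_num, Real.rpow_natCast]
    exact (show Even 4 by decide).pow_abs x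
  obtain ⟨hi, hM⟩ := integral_add_rpow_le (P := P) (f := fun ω => |f ω|) (g := fun ω => |g ω|)
    (s := 4) (by norm_num) (fun ω => abs_nonneg _) (fun ω => abs_nonneg _) hfm.abs hgm.abs
    (by simpa only [e4] using hf) (by simpa only [e4] using hg)
  simp only [e4] at hM
  have hroot : ∀ x y : ℝ, 0 ≤ x → 0 ≤ y → (x * y ^ 2) ^ (1 / 4 : ℝ) = √(√x * y) := by
    intro x y hx hy
    rw [Real.sqrt_eq_rpow, Real.sqrt_eq_rpow, Real.mul_rpow hx (by positivity),
      Real.mul_rpow (by positivity) hy, ← Real.rpow_mul hx, ← Real.rpow_natCast y 2,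
      ← Real.rpow_mul hy]
    norm_num
  have h1 : (∫ ω, f ω ^ 4 ∂P) ^ (1 / 4 : ℝ) ≤ √(√a * c) := by
    rw [← hroot a c ha hc]
    exact Real.rpow_le_rpow (integral_nonneg fun ω => by positivity) hfa (by norm_num)
  have h2 : (∫ ω, g ω ^ 4 ∂P) ^ (1 / 4 : ℝ) ≤ √(√b * e) := by
    rw [← hroot b e hb he]
    exact Real.rpow_le_rpow (integral_nonneg fun ω => by positivity) hgb (by norm_num)
  set J := ∫ ω, (|f ω| + |g ω|) ^ (4 : ℝ) ∂P with hJ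
  have hJ0 : 0 ≤ J := integral_nonneg fun ω => by positivity
  have h3 : J ≤ (√(√a * c) + √(√b * e)) ^ 4 := by
    have h5 := pow_le_pow_left₀ (Real.rpow_nonneg hJ0 _) (hM.trans (add_le_add h1 h2)) 4
    rw [← Real.rpow_natCast (J ^ _) 4, ← Real.rpow_mul hJ0] at h5
    rwa [show (1 / 4 : ℝ) * ((4 : ℕ) : ℝ) = 1 by norm_num, Real.rpow_one] at h5
  -- Cauchy–Schwarz for the pairs (a^{1/4}, b^{1/4}) and (√c, √e).
  have h4 : (√(√a * c) + √(√b * e)) ^ 2 ≤ (√a + √b) * (c + e) := by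
    have s1 := Real.sq_sqrt (show 0 ≤ √a * c by positivity)
    have s2 := Real.sq_sqrt (show 0 ≤ √b * e by positivity)
    have s3 : 2 * (√(√a * c) * √(√b * e)) ≤ √a * e + √b * c := by
      rw [← Real.sqrt_mul (by positivity)]
      have : √(√a * c * (√b * e)) = √(√a * e) * √(√b * c) := by
        rw [← Real.sqrt_mul (by positivity)]; congr 1; ring
      rw [this]
      have q1 := Real.sq_sqrt (show 0 ≤ √a * e by positivity)
      have q2 := Real.sq_sqrt (show 0 ≤ √b * c by positivity)
      nlinarith [sq_nonneg (√(√a * e) - √(√b * c))]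
    nlinarith
  calc ∫ ω, (f ω + g ω) ^ 4 ∂P ≤ J := by
        refine integral_mono_of_nonneg (Eventually.of_forall fun ω => by positivity) hi
          (Eventually.of_forall fun ω => ?_)
        have h6 : |f ω + g ω| ^ (4 : ℝ) ≤ (|f ω| + |g ω|) ^ (4 : ℝ) := by
          gcongr; exact abs_add_le _ _
        rw [e4] at h6
        exact h6
    _ ≤ (√(√a * c) + √(√b * e)) ^ 4 := h3
    _ = ((√(√a * c) + √(√b * e)) ^ 2) ^ 2 := by ring
    _ ≤ ((√a + √b) * (c + e)) ^ 2 := by gcongr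
    _ = _ := by ring

end minkowski

/-! ### Normal equations and the spectral form of the whitened norm -/

section whitening

variable {Ω : Type*} [MeasurableSpace Ω] {P : Measure Ω} {d : ℕ}
  {X : Ω → EuclideanSpace ℝ (Fin d)} {Y : Ω → ℝ} {θstar : EuclideanSpace ℝ (Fin d)}

theorem memLp_inner {E : Type*} [NormedAddCommGroup E] [InnerProductSpace ℝ E] {X : Ω → E}
    {p : ENNReal} (hX : MemLp X p P) (u : E) :
    MemLp (fun ω => inner ℝ u (X ω)) p P := hX.const_inner u

theorem integral_inner_mul_inner (hX : MemLp X 2 P) (u v : EuclideanSpace ℝ (Fin d)) :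
    ∫ ω, inner ℝ u (X ω) * inner ℝ v (X ω) ∂P = u.ofLp ⬝ᵥ (gram P X).mulVec v.ofLp := by
  have hXi : ∀ i, MemLp (fun ω => X ω i) 2 P := fun i => by
    simpa [EuclideanSpace.inner_single_left] using
      memLp_inner hX (EuclideanSpace.single i (1 : ℝ))
  have hint : ∀ i j, Integrable (fun ω => X ω i * X ω j) P := fun i j => (hXi i).integrable_mul (hXi j)
  have e : ∀ ω, inner ℝ u (X ω) * inner ℝ v (X ω) =
      ∑ i, ∑ j, u i * v j * (X ω i * X ω j) := by
    intro ω
    simp only [PiLp.inner_apply, RCLike.inner_apply, conj_trivial, Finset.sum_mul_sum]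
    refine Finset.sum_congr rfl fun i _ => Finset.sum_congr rfl fun j _ => ?_
    ring
  simp only [e]
  rw [integral_finsetSum _ fun i _ => integrable_finsetSum _ fun j _ => (hint i j).const_mul _]
  simp only [dotProduct, Matrix.mulVec, gram, Matrix.of_apply]
  refine Finset.sum_congr rfl fun i _ => ?_
  rw [integral_finsetSum _ fun j _ => (hint i j).const_mul _, Finset.mul_sum]
  refine Finset.sum_congr rfl fun j _ => ?_
  rw [integral_const_mul]
  ring

theorem eq_zero_of_forall_two_mul_le {A C : ℝ} (hC0 : 0 ≤ C)
    (h : ∀ t : ℝ, 2 * t * A ≤ t ^ 2 * C) : A = 0 := by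
  -- The divisor is C + 1 instead of C so that C = 0 needs no separate case.
  have h1 := h (A / (C + 1))
  have hC1 : 0 < C + 1 := by linarith
  have h2 : 2 * (A / (C + 1)) * A = 2 * A ^ 2 / (C + 1) := by ring
  have h3 : (A / (C + 1)) ^ 2 * C ≤ A ^ 2 / (C + 1) := by
    rw [div_pow, div_mul_eq_mul_div, div_le_div_iff₀ (by positivity) hC1]
    nlinarith [mul_nonneg (sq_nonneg A) hC1.le]
  have h4 : A ^ 2 / (C + 1) ≤ 0 := by
    rw [h2] at h1
    have : 2 * A ^ 2 / (C + 1) = A ^ 2 / (C + 1) + A ^ 2 / (C + 1) := by ring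
    linarith
  have h5 : 0 ≤ A ^ 2 / (C + 1) := by positivity
  have h6 : A ^ 2 / (C + 1) = 0 := le_antisymm h4 h5
  rw [div_eq_zero_iff] at h6
  rcases h6 with h6 | h6
  · exact pow_eq_zero_iff two_ne_zero |>.1 h6
  · linarith

/-- At a minimizer of the risk, the noise is uncorrelated with the design. -/
theorem integral_noise_mul_inner (hX : MemLp X 2 P) (hY : MemLp Y 2 P)
    (hmin : ∀ θ, risk P X Y θstar ≤ risk P X Y θ) (u : EuclideanSpace ℝ (Fin d)) :
    ∫ ω, (Y ω - inner ℝ θstar (X ω)) * inner ℝ u (X ω) ∂P = 0 := by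
  have hW : MemLp (fun ω => Y ω - inner ℝ θstar (X ω)) 2 P := hY.sub (memLp_inner hX θstar)
  have hU := memLp_inner hX u
  set A := ∫ ω, (Y ω - inner ℝ θstar (X ω)) * inner ℝ u (X ω) ∂P with hA
  set C := ∫ ω, inner ℝ u (X ω) ^ 2 ∂P with hC
  have hexp : ∀ t : ℝ, risk P X Y (θstar + t • u) = risk P X Y θstar - 2 * t * A + t ^ 2 * C := by
    intro t
    have e : ∀ ω, (Y ω - inner ℝ (θstar + t • u) (X ω)) ^ 2 =
        (Y ω - inner ℝ θstar (X ω)) ^ 2 -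
          2 * t * ((Y ω - inner ℝ θstar (X ω)) * inner ℝ u (X ω)) +
          t ^ 2 * inner ℝ u (X ω) ^ 2 := by
      intro ω; rw [inner_add_left, real_inner_smul_left]; ring
    have i1 := hW.integrable_sq
    have i2 : Integrable (fun ω => (Y ω - inner ℝ θstar (X ω)) * inner ℝ u (X ω)) P :=
      hW.integrable_mul hU
    have i3 := hU.integrable_sq
    have i4 : Integrable (fun ω => (Y ω - inner ℝ θstar (X ω)) ^ 2 -
        2 * t * ((Y ω - inner ℝ θstar (X ω)) * inner ℝ u (X ω))) P := i1.sub (i2.const_mul _)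
    simp only [risk, e]
    rw [integral_add i4 (i3.const_mul _), integral_sub i1 (i2.const_mul _), integral_const_mul,
      integral_const_mul]
  have hC0 : 0 ≤ C := integral_nonneg fun ω => sq_nonneg _
  have hq : ∀ t : ℝ, 2 * t * A ≤ t ^ 2 * C := by
    intro t
    have := hmin (θstar + t • u)
    rw [hexp] at this
    linarith
  exact eq_zero_of_forall_two_mul_le hC0 hq

variable (P X)

/-- The eigenvectors of the Gram matrix. -/
noncomputable def gramBasis : OrthonormalBasis (Fin d) ℝ (EuclideanSpace ℝ (Fin d)) :=
  (gram_isHermitian P X).eigenvectorBasis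

/-- The eigenvalues of the Gram matrix. -/
noncomputable def gramEigenvalues : Fin d → ℝ := (gram_isHermitian P X).eigenvalues

variable {P X}

theorem integral_gramBasis_mul (hX : MemLp X 2 P) (i j : Fin d) :
    ∫ ω, inner ℝ (gramBasis P X i) (X ω) * inner ℝ (gramBasis P X j) (X ω) ∂P =
      if i = j then gramEigenvalues P X i else 0 := by
  rw [integral_inner_mul_inner hX]
  have h := (gram_isHermitian P X).mulVec_eigenvectorBasis j
  have h2 : (gramBasis P X i).ofLp ⬝ᵥ (gramBasis P X j).ofLp = if i = j then 1 else 0 := by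
    have := orthonormal_iff_ite.1 (gramBasis P X).orthonormal i j
    rw [← this, PiLp.inner_apply, dotProduct]
    refine Finset.sum_congr rfl fun k _ => ?_
    simp [mul_comm]
  rw [show (gram P X).mulVec (gramBasis P X j).ofLp =
    gramEigenvalues P X j • (gramBasis P X j).ofLp from h, dotProduct_smul, h2]
  split_ifs with hij
  · rw [hij]; simp
  · simp

/-- In the eigenbasis, G^{-1/2} divides each coordinate by the root of its eigenvalue and kills the
null directions, which matches the nondegenerate design coordinates of the whitened vector. -/
theorem norm_sq_gramInvSqrt (x : EuclideanSpace ℝ (Fin d)) :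
    ‖Matrix.toEuclideanLin (gramInvSqrt P X) x‖ ^ 2 =
      ∑ j, if 0 < gramEigenvalues P X j then
        inner ℝ (gramBasis P X j) x ^ 2 / gramEigenvalues P X j else 0 := by
  set D : Fin d → ℝ := fun i => if 0 < gramEigenvalues P X i
      then (√(gramEigenvalues P X i))⁻¹ else 0 with hD
  have h1 : Matrix.toEuclideanLin (gramInvSqrt P X) x =
      ∑ j, (D j * inner ℝ (gramBasis P X j) x) • gramBasis P X j := by
    ext k
    have h2 : ∀ j, ((gram_isHermitian P X).eigenvectorUnitary :
        Matrix (Fin d) (Fin d) ℝ).transpose.mulVec x.ofLp j = inner ℝ (gramBasis P X j) x := by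
      intro j
      rw [Matrix.mulVec, dotProduct, PiLp.inner_apply]
      refine Finset.sum_congr rfl fun i _ => ?_
      simp only [Matrix.transpose_apply, Matrix.IsHermitian.eigenvectorUnitary_apply,
        RCLike.inner_apply, conj_trivial]
      exact mul_comm _ _
    rw [Matrix.toLpLin_apply]
    simp only [gramInvSqrt, ← Matrix.mulVec_mulVec]
    simp only [Matrix.mulVec, dotProduct] at h2 ⊢
    simp only [Matrix.diagonal_apply, ite_mul, zero_mul, Finset.sum_ite_eq, Finset.mem_univ, if_true]
    simp only [h2]
    simp only [Matrix.IsHermitian.eigenvectorUnitary_apply]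
    simp only [WithLp.ofLp_sum, WithLp.ofLp_smul, Finset.sum_apply, Pi.smul_apply, smul_eq_mul]
    refine Finset.sum_congr rfl fun j _ => ?_
    by_cases hj : 0 < gramEigenvalues P X j
    · have hj' : 0 < (gram_isHermitian P X).eigenvalues j := hj
      rw [if_pos hj']
      simp only [hD, if_pos hj]
      change (gramBasis P X j) k * ((√(gramEigenvalues P X j))⁻¹ * _) = _
      ring
    · have hj' : ¬ 0 < (gram_isHermitian P X).eigenvalues j := hj
      rw [if_neg hj']
      simp only [hD, if_neg hj]
      ring
  rw [h1, ← (gramBasis P X).sum_sq_inner_right]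
  refine Finset.sum_congr rfl fun j _ => ?_
  have h3 := (gramBasis P X).orthonormal.inner_right_sum
    (fun j => D j * inner ℝ (gramBasis P X j) x) (Finset.mem_univ j)
  rw [h3]
  simp only [hD]
  split_ifs with hj
  · rw [mul_pow, inv_pow, Real.sq_sqrt hj.le]; ring
  · ring

end whitening

/-! ### The whitened vector made of noise and principal components -/

section coordinates

variable {Ω : Type*} [MeasurableSpace Ω] (P : Measure Ω) {d : ℕ}
  (X : Ω → EuclideanSpace ℝ (Fin d)) (Y : Ω → ℝ) (θstar : EuclideanSpace ℝ (Fin d))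

/-- The noise, followed by the principal components of the design. -/
noncomputable def rawCoord : Option (Fin d) → Ω → ℝ
  | none, ω => Y ω - inner ℝ θstar (X ω)
  | some j, ω => inner ℝ (gramBasis P X j) (X ω)

/-- The second moments of the coordinates `rawCoord`. -/
noncomputable def rawVar : Option (Fin d) → ℝ
  | none => ∫ ω, (Y ω - inner ℝ θstar (X ω)) ^ 2 ∂P
  | some j => gramEigenvalues P X j

/-- The indices of the coordinates that do not vanish almost surely. -/
abbrev ActiveIndex : Type := {i : Option (Fin d) // 0 < rawVar P X Y θstar i}

/-- The nondegenerate coordinates, scaled to unit second moment. -/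
noncomputable def whitened (ω : Ω) : EuclideanSpace ℝ (ActiveIndex P X Y θstar) :=
  WithLp.toLp 2 fun i => rawCoord P X Y θstar i ω / √(rawVar P X Y θstar i)

/-- The coefficients of `ξ Y - ⟨θ, X⟩` in the coordinates `rawCoord`. -/
noncomputable def rawCoeff (θ : EuclideanSpace ℝ (Fin d)) (ξ : ℝ) : Option (Fin d) → ℝ
  | none => ξ
  | some j => inner ℝ (gramBasis P X j) (ξ • θstar - θ)

/-- The coefficients of `ξ Y - ⟨θ, X⟩` in the coordinates `whitened`. -/
noncomputable def whitenedCoeff (θ : EuclideanSpace ℝ (Fin d)) (ξ : ℝ) :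
    EuclideanSpace ℝ (ActiveIndex P X Y θstar) :=
  WithLp.toLp 2 fun i => rawCoeff P X θstar θ ξ i * √(rawVar P X Y θstar i)

theorem card_activeIndex_le : Fintype.card (ActiveIndex P X Y θstar) ≤ d + 1 := by
  refine (Fintype.card_subtype_le _).trans ?_
  simp

variable {P X Y θstar}

theorem sum_activeIndex (f : Option (Fin d) → ℝ) :
    ∑ i : ActiveIndex P X Y θstar, f i =
      ∑ i, if 0 < rawVar P X Y θstar i then f i else 0 := by
  rw [← Finset.sum_filter]
  exact (Finset.sum_subtype _ (fun i => by simp) f).symm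

theorem inner_eq_sum_gramBasis (u x : EuclideanSpace ℝ (Fin d)) :
    inner ℝ u x = ∑ j, inner ℝ (gramBasis P X j) u * inner ℝ (gramBasis P X j) x := by
  rw [← (gramBasis P X).sum_inner_mul_inner u x]
  refine Finset.sum_congr rfl fun j _ => ?_
  rw [real_inner_comm u]

theorem sum_rawCoeff_mul_rawCoord (θ : EuclideanSpace ℝ (Fin d)) (ξ : ℝ) (ω : Ω) :
    ∑ i, rawCoeff P X θstar θ ξ i * rawCoord P X Y θstar i ω = ξ * Y ω - inner ℝ θ (X ω) := by
  rw [Fintype.sum_option]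
  simp only [rawCoeff, rawCoord]
  rw [← inner_eq_sum_gramBasis, inner_sub_left, real_inner_smul_left]
  ring

/-- The linear form `ξ Y - ⟨θ, X⟩` in the whitened coordinates. -/
theorem inner_whitenedCoeff {ω : Ω}
    (h : ∀ i, ¬ 0 < rawVar P X Y θstar i → rawCoord P X Y θstar i ω = 0)
    (θ : EuclideanSpace ℝ (Fin d)) (ξ : ℝ) :
    inner ℝ (whitenedCoeff P X Y θstar θ ξ) (whitened P X Y θstar ω) =
      ξ * Y ω - inner ℝ θ (X ω) := by
  rw [← sum_rawCoeff_mul_rawCoord (P := P) (θstar := θstar), PiLp.inner_apply]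
  have e : ∀ i : ActiveIndex P X Y θstar,
      inner ℝ (whitenedCoeff P X Y θstar θ ξ i) (whitened P X Y θstar ω i) =
      rawCoeff P X θstar θ ξ i * rawCoord P X Y θstar i ω := by
    intro i
    have hi := Real.sqrt_pos.2 i.2
    simp only [whitenedCoeff, whitened, RCLike.inner_apply, conj_trivial]
    field_simp
  simp only [e]
  rw [sum_activeIndex fun i => rawCoeff P X θstar θ ξ i * rawCoord P X Y θstar i ω]
  refine Finset.sum_congr rfl fun i _ => ?_
  split_ifs with hi
  · rfl
  · rw [h i hi, mul_zero]

/-- Every linear form in the whitened coordinates comes from a linear form in the noise and the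
design. -/
theorem exists_inner_whitened (u : EuclideanSpace ℝ (ActiveIndex P X Y θstar)) :
    ∃ (a : ℝ) (θ : EuclideanSpace ℝ (Fin d)), ∀ ω, inner ℝ u (whitened P X Y θstar ω) =
      a * (Y ω - inner ℝ θstar (X ω)) + inner ℝ θ (X ω) := by
  set c : Option (Fin d) → ℝ := fun i =>
    if h : 0 < rawVar P X Y θstar i then u ⟨i, h⟩ / √(rawVar P X Y θstar i) else 0 with hc
  refine ⟨c none, ∑ j, c (some j) • gramBasis P X j, fun ω => ?_⟩
  have e : ∀ i : ActiveIndex P X Y θstar, inner ℝ (u i) (whitened P X Y θstar ω i) =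
      c i * rawCoord P X Y θstar i ω := by
    intro i
    simp only [whitened, RCLike.inner_apply, conj_trivial, hc, dif_pos i.2]
    ring
  rw [PiLp.inner_apply]
  simp only [e]
  rw [sum_activeIndex fun i => c i * rawCoord P X Y θstar i ω]
  have e2 : ∀ i, (if 0 < rawVar P X Y θstar i then c i * rawCoord P X Y θstar i ω else 0) =
      c i * rawCoord P X Y θstar i ω := by
    intro i
    split_ifs with hi
    · rfl
    · simp only [hc, dif_neg hi, zero_mul]
  simp only [e2]
  rw [Fintype.sum_option, sum_inner]
  simp only [rawCoord, real_inner_smul_left]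

theorem memLp_rawCoord (hX : MemLp X 2 P) (hY : MemLp Y 2 P) (i : Option (Fin d)) :
    MemLp (rawCoord P X Y θstar i) 2 P := by
  cases i with
  | none => exact hY.sub (memLp_inner hX θstar)
  | some j => exact memLp_inner hX _

theorem measurable_rawCoord (hX : Measurable X) (hY : Measurable Y) (i : Option (Fin d)) :
    Measurable (rawCoord P X Y θstar i) := by
  cases i with
  | none =>
    change Measurable fun ω => Y ω - inner ℝ θstar (X ω)
    fun_prop
  | some j =>
    change Measurable fun ω => inner ℝ (gramBasis P X j) (X ω)
    fun_prop

theorem measurable_whitened (hX : Measurable X) (hY : Measurable Y) :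
    Measurable (whitened P X Y θstar) := by
  have := fun i => measurable_rawCoord (P := P) (θstar := θstar) hX hY i
  unfold whitened
  fun_prop

theorem integral_rawCoord_mul (hX : MemLp X 2 P) (hY : MemLp Y 2 P)
    (hmin : ∀ θ, risk P X Y θstar ≤ risk P X Y θ) (i j : Option (Fin d)) :
    ∫ ω, rawCoord P X Y θstar i ω * rawCoord P X Y θstar j ω ∂P =
      if i = j then rawVar P X Y θstar i else 0 := by
  cases i with
  | none =>
    cases j with
    | none => simp only [rawCoord, rawVar, if_true, ← sq]
    | some j => simpa [rawCoord] using integral_noise_mul_inner hX hY hmin _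
  | some i =>
    cases j with
    | none =>
      simp only [rawCoord, reduceCtorEq, if_false]
      simp only [mul_comm (inner ℝ _ _)]
      exact integral_noise_mul_inner hX hY hmin _
    | some j => simpa [rawCoord, rawVar] using integral_gramBasis_mul hX i j

/-- A coordinate without positive second moment vanishes almost surely. Hence dropping it loses
nothing outside one null set, common to all (θ, ξ). -/
theorem ae_rawCoord_eq_zero (hX : MemLp X 2 P) (hY : MemLp Y 2 P)
    (hmin : ∀ θ, risk P X Y θstar ≤ risk P X Y θ) :
    ∀ᵐ ω ∂P, ∀ i, ¬ 0 < rawVar P X Y θstar i → rawCoord P X Y θstar i ω = 0 := by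
  rw [ae_all_iff]
  intro i
  by_cases hi : 0 < rawVar P X Y θstar i
  · exact Eventually.of_forall fun ω h => absurd hi h
  · have h1 := integral_rawCoord_mul hX hY hmin i i
    rw [if_pos rfl] at h1
    have h0 : 0 ≤ ∫ ω, rawCoord P X Y θstar i ω * rawCoord P X Y θstar i ω ∂P :=
      integral_nonneg fun ω => mul_self_nonneg _
    have h2 : ∫ ω, rawCoord P X Y θstar i ω * rawCoord P X Y θstar i ω ∂P = 0 :=
      le_antisymm (by linarith) h0
    rw [integral_eq_zero_iff_of_nonneg (fun ω => mul_self_nonneg _)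
      ((memLp_rawCoord hX hY i).integrable_mul (memLp_rawCoord hX hY i))] at h2
    filter_upwards [h2] with ω hω _
    exact mul_self_eq_zero.1 hω

theorem integral_inner_whitened_sq (hX : MemLp X 2 P) (hY : MemLp Y 2 P)
    (hmin : ∀ θ, risk P X Y θstar ≤ risk P X Y θ)
    (u : EuclideanSpace ℝ (ActiveIndex P X Y θstar)) :
    ∫ ω, inner ℝ u (whitened P X Y θstar ω) ^ 2 ∂P = ‖u‖ ^ 2 := by
  have e : ∀ ω, inner ℝ u (whitened P X Y θstar ω) ^ 2 =
      ∑ i : ActiveIndex P X Y θstar, ∑ j : ActiveIndex P X Y θstar,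
        u i / √(rawVar P X Y θstar i) * (u j / √(rawVar P X Y θstar j)) *
        (rawCoord P X Y θstar i ω * rawCoord P X Y θstar j ω) := by
    intro ω
    rw [PiLp.inner_apply, sq, Finset.sum_mul_sum]
    refine Finset.sum_congr rfl fun i _ => Finset.sum_congr rfl fun j _ => ?_
    simp only [whitened, RCLike.inner_apply, conj_trivial]
    ring
  have hint : ∀ i j, Integrable (fun ω => rawCoord P X Y θstar i ω * rawCoord P X Y θstar j ω) P :=
    fun i j => (memLp_rawCoord hX hY i).integrable_mul (memLp_rawCoord hX hY j)
  simp only [e]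
  rw [integral_finsetSum _ fun i _ => integrable_finsetSum _ fun j _ => (hint _ _).const_mul _,
    EuclideanSpace.norm_sq_eq]
  refine Finset.sum_congr rfl fun i _ => ?_
  rw [integral_finsetSum _ fun j _ => (hint _ _).const_mul _]
  simp only [integral_const_mul, integral_rawCoord_mul hX hY hmin]
  rw [Finset.sum_eq_single i]
  · rw [if_pos rfl, Real.norm_eq_abs, sq_abs]
    have h1 := Real.sqrt_pos.2 i.2
    have h2 := Real.sq_sqrt i.2.le
    field_simp
    rw [h2]
  · intro j _ hj
    rw [if_neg (fun h => hj (Subtype.ext h.symm)), mul_zero]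
  · simp

theorem quadForm_eq_norm_sq (hX : MemLp X 2 P) (hY : MemLp Y 2 P)
    (hmin : ∀ θ, risk P X Y θstar ≤ risk P X Y θ) (θ : EuclideanSpace ℝ (Fin d)) (ξ : ℝ) :
    quadForm P X Y θ ξ = ‖whitenedCoeff P X Y θstar θ ξ‖ ^ 2 := by
  rw [← integral_inner_whitened_sq hX hY hmin, quadForm]
  refine integral_congr_ae ?_
  filter_upwards [ae_rawCoord_eq_zero hX hY hmin] with ω hω
  rw [inner_whitenedCoeff hω]

theorem norm_whitened_sq (ω : Ω) :
    ‖whitened P X Y θstar ω‖ ^ 2 =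
      (Y ω - inner ℝ θstar (X ω)) ^ 2 / (∫ ω, (Y ω - inner ℝ θstar (X ω)) ^ 2 ∂P) +
      whitenedNorm P X ω ^ 2 := by
  rw [whitenedNorm, norm_sq_gramInvSqrt, EuclideanSpace.norm_sq_eq]
  have e : ∀ i : ActiveIndex P X Y θstar, ‖whitened P X Y θstar ω i‖ ^ 2 =
      rawCoord P X Y θstar i ω ^ 2 / rawVar P X Y θstar i := by
    intro i
    simp only [whitened]
    rw [Real.norm_eq_abs, sq_abs, div_pow, Real.sq_sqrt i.2.le]
  simp only [e]
  rw [sum_activeIndex fun i => rawCoord P X Y θstar i ω ^ 2 / rawVar P X Y θstar i,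
    Fintype.sum_option]
  congr 1
  by_cases h : 0 < rawVar P X Y θstar none
  · rw [if_pos h]
    rfl
  · rw [if_neg h]
    have h0 : 0 ≤ ∫ ω, (Y ω - inner ℝ θstar (X ω)) ^ 2 ∂P :=
      integral_nonneg fun ω => sq_nonneg _
    have h1 : ∫ ω, (Y ω - inner ℝ θstar (X ω)) ^ 2 ∂P ≤ 0 := not_lt.1 h
    -- Without noise the quotient is a division by zero, equal to 0; this agrees with the absence of
    -- the noise coordinate and with the convention 0/0 = 0.
    rw [le_antisymm h1 h0, div_zero]

end coordinates

/-! ### Moments of the norm of the whitened vector -/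

section moments

variable {Ω : Type*} [MeasurableSpace Ω] {P : Measure Ω}

theorem integrable_rpow_of_le [IsFiniteMeasure P] {f : Ω → ℝ} {s t : ℝ} (hf0 : ∀ ω, 0 ≤ f ω)
    (hfm : AEMeasurable f P) (ht : 0 ≤ t) (hts : t ≤ s)
    (hf : Integrable (fun ω => f ω ^ s) P) : Integrable (fun ω => f ω ^ t) P := by
  refine ((integrable_const (1 : ℝ)).add hf).mono (hfm.pow_const t).aestronglyMeasurable
    (Eventually.of_forall fun ω => ?_)
  have h1 : 0 ≤ f ω ^ s := Real.rpow_nonneg (hf0 ω) s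
  have h2 : 0 ≤ f ω ^ t := Real.rpow_nonneg (hf0 ω) t
  rw [Real.norm_eq_abs, Real.norm_eq_abs, Pi.add_apply, abs_of_nonneg h2, abs_of_nonneg (by positivity)]
  rcases le_total (f ω) 1 with h | h
  · linarith [Real.rpow_le_one (hf0 ω) h ht]
  · linarith [Real.rpow_le_rpow_of_exponent_le h hts]

variable {d : ℕ} {X : Ω → EuclideanSpace ℝ (Fin d)} {Y : Ω → ℝ} {θstar : EuclideanSpace ℝ (Fin d)}

theorem whitenedNorm_nonneg (ω : Ω) : 0 ≤ whitenedNorm P X ω := norm_nonneg _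

theorem measurable_whitenedNorm (hX : Measurable X) : Measurable (whitenedNorm P X) := by
  unfold whitenedNorm
  have : Continuous (Matrix.toEuclideanLin (gramInvSqrt P X)) :=
    LinearMap.continuous_of_finiteDimensional _
  exact (this.measurable.comp hX).norm

theorem momentSum_nonneg (s : ℝ) : 0 ≤ momentSum P X Y θstar s := by
  unfold momentSum
  refine add_nonneg (div_nonneg (Real.rpow_nonneg (integral_nonneg fun ω => ?_) _)
    (integral_nonneg fun ω => sq_nonneg _)) (Real.rpow_nonneg (integral_nonneg fun ω => ?_) _)
  · positivity
  · exact Real.rpow_nonneg (whitenedNorm_nonneg ω) _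

/-- The moments of the squared norm of the whitened coordinates. -/
theorem integral_norm_whitened_rpow_le [IsFiniteMeasure P] (hX : Measurable X) (hY : Measurable Y)
    {s t : ℝ} (hs : 1 ≤ s) (hst : s ≤ t)
    (hW : Integrable (fun ω => |Y ω - inner ℝ θstar (X ω)| ^ (2 * t)) P)
    (hN : Integrable (fun ω => whitenedNorm P X ω ^ (2 * t)) P) :
    Integrable (fun ω => (‖whitened P X Y θstar ω‖ ^ 2) ^ s) P ∧
      ∫ ω, (‖whitened P X Y θstar ω‖ ^ 2) ^ s ∂P ≤ momentSum P X Y θstar s ^ s := by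
  have hWm : Measurable fun ω => Y ω - inner ℝ θstar (X ω) := by fun_prop
  have hNm := measurable_whitenedNorm (P := P) hX
  set v := ∫ ω, (Y ω - inner ℝ θstar (X ω)) ^ 2 ∂P with hv
  have hv0 : 0 ≤ v := integral_nonneg fun ω => sq_nonneg _
  have hW' := integrable_rpow_of_le (fun ω => abs_nonneg _) hWm.abs.aemeasurable
    (t := 2 * s) (by linarith) (by linarith) hW
  have hN' := integrable_rpow_of_le whitenedNorm_nonneg hNm.aemeasurable
    (t := 2 * s) (by linarith) (by linarith) hN
  have e1 : ∀ ω, ((Y ω - inner ℝ θstar (X ω)) ^ 2 / v) ^ s =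
      (v ^ s)⁻¹ * |Y ω - inner ℝ θstar (X ω)| ^ (2 * s) := by
    intro ω
    rw [Real.div_rpow (sq_nonneg _) hv0, ← sq_abs, ← Real.rpow_natCast,
      ← Real.rpow_mul (abs_nonneg _), div_eq_inv_mul]
    norm_num
  have e2 : ∀ ω, (whitenedNorm P X ω ^ 2) ^ s = whitenedNorm P X ω ^ (2 * s) := by
    intro ω
    rw [← Real.rpow_natCast, ← Real.rpow_mul (whitenedNorm_nonneg ω)]
    norm_num
  -- The squared norm is the sum of a noise part and a design part; the triangle inequality in L^s
  -- for this sum is what produces `momentSum`.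
  obtain ⟨h1, h2⟩ := integral_add_rpow_le (P := P)
    (f := fun ω => (Y ω - inner ℝ θstar (X ω)) ^ 2 / v) (g := fun ω => whitenedNorm P X ω ^ 2)
    hs (fun ω => by positivity) (fun ω => by positivity)
    (hWm.pow_const 2 |>.div_const v).aemeasurable (hNm.pow_const 2).aemeasurable
    (by simp only [e1]; exact hW'.const_mul _) (by simpa only [e2] using hN')
  have e3 : ∀ ω, ‖whitened P X Y θstar ω‖ ^ 2 =
    (Y ω - inner ℝ θstar (X ω)) ^ 2 / v + whitenedNorm P X ω ^ 2 := norm_whitened_sq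
  simp only [← e3] at h1 h2
  refine ⟨h1, ?_⟩
  have hW0 : 0 ≤ ∫ ω, |Y ω - inner ℝ θstar (X ω)| ^ (2 * s) ∂P :=
    integral_nonneg fun ω => by positivity
  have e4 : (∫ ω, ((Y ω - inner ℝ θstar (X ω)) ^ 2 / v) ^ s ∂P) ^ (1 / s) =
      (∫ ω, |Y ω - inner ℝ θstar (X ω)| ^ (2 * s) ∂P) ^ (1 / s) / v := by
    simp only [e1]
    rw [integral_const_mul, Real.mul_rpow (by positivity) hW0, Real.inv_rpow (by positivity),
      ← Real.rpow_mul hv0, mul_one_div_cancel (by linarith), Real.rpow_one, inv_mul_eq_div]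
  rw [e4] at h2
  simp only [e2] at h2
  change _ ≤ momentSum P X Y θstar s at h2
  have hI0 : 0 ≤ ∫ ω, (‖whitened P X Y θstar ω‖ ^ 2) ^ s ∂P :=
    integral_nonneg fun ω => by positivity
  have h3 := Real.rpow_le_rpow (Real.rpow_nonneg hI0 _) h2 (by linarith : 0 ≤ s)
  rwa [← Real.rpow_mul hI0, one_div_mul_cancel (by linarith), Real.rpow_one] at h3

end moments

/-! ### Kurtosis of the whitened vector and the deviation bound -/

section kurtosis

variable {Ω : Type*} [MeasurableSpace Ω] {P : Measure Ω} {d : ℕ}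
  {X : Ω → EuclideanSpace ℝ (Fin d)} {Y : Ω → ℝ} {θstar : EuclideanSpace ℝ (Fin d)}

/-- Fourth moments of linear forms, in terms of the fourth moment of the whitened coordinates. -/
theorem integral_pow_four_le_norm_whitened (hXm : Measurable X) (hYm : Measurable Y)
    (hX : MemLp X 2 P) (hY : MemLp Y 2 P) (hmin : ∀ θ, risk P X Y θstar ≤ risk P X Y θ)
    (hZ : Integrable (fun ω => ‖whitened P X Y θstar ω‖ ^ 4) P)
    (θ : EuclideanSpace ℝ (Fin d)) (ξ : ℝ) :
    Integrable (fun ω => (ξ * Y ω - inner ℝ θ (X ω)) ^ 4) P ∧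
      ∫ ω, (ξ * Y ω - inner ℝ θ (X ω)) ^ 4 ∂P ≤
        quadForm P X Y θ ξ ^ 2 * ∫ ω, ‖whitened P X Y θstar ω‖ ^ 4 ∂P := by
  have hle : ∀ᵐ ω ∂P, (ξ * Y ω - inner ℝ θ (X ω)) ^ 4 ≤
      quadForm P X Y θ ξ ^ 2 * ‖whitened P X Y θstar ω‖ ^ 4 := by
    filter_upwards [ae_rawCoord_eq_zero hX hY hmin] with ω hω
    rw [← inner_whitenedCoeff hω, quadForm_eq_norm_sq hX hY hmin]
    have h1 := pow_le_pow_left₀ (abs_nonneg _) (abs_real_inner_le_norm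
      (whitenedCoeff P X Y θstar θ ξ) (whitened P X Y θstar ω)) 4
    rw [(show Even 4 by decide).pow_abs, mul_pow] at h1
    refine h1.trans (le_of_eq ?_)
    ring
  have hi : Integrable (fun ω => (ξ * Y ω - inner ℝ θ (X ω)) ^ 4) P := by
    refine (hZ.const_mul (quadForm P X Y θ ξ ^ 2)).mono'
      (by fun_prop : Measurable fun ω => (ξ * Y ω - inner ℝ θ (X ω)) ^ 4).aestronglyMeasurable ?_
    filter_upwards [hle] with ω hω
    rwa [Real.norm_eq_abs, abs_of_nonneg (by positivity)]
  exact ⟨hi, (integral_mono_ae hi (hZ.const_mul _) hle).trans_eq (integral_const_mul _ _)⟩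

theorem kappaDesign_nonneg : 0 ≤ kappaDesign P X := by
  refine Real.sSup_nonneg ?_
  rintro t ⟨θ, -, rfl⟩
  exact integral_nonneg fun ω => by positivity

theorem kappaNoise_nonneg : 0 ≤ kappaNoise P X Y θstar := by
  unfold kappaNoise
  split_ifs
  · exact div_nonneg (integral_nonneg fun ω => by positivity) (sq_nonneg _)
  · exact le_rfl

theorem quadForm_zero (θ : EuclideanSpace ℝ (Fin d)) :
    quadForm P X Y θ 0 = ∫ ω, inner ℝ θ (X ω) ^ 2 ∂P := by
  simp [quadForm]

/-- By homogeneity, rescale θ to unit second moment and use the supremum. If the second moment is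
zero, the bound by E‖Z‖⁴ shows that the fourth moment vanishes too. -/
theorem integral_inner_design_pow_four_le (hXm : Measurable X) (hYm : Measurable Y)
    (hX : MemLp X 2 P) (hY : MemLp Y 2 P) (hmin : ∀ θ, risk P X Y θstar ≤ risk P X Y θ)
    (hZ : Integrable (fun ω => ‖whitened P X Y θstar ω‖ ^ 4) P)
    (θ : EuclideanSpace ℝ (Fin d)) :
    ∫ ω, inner ℝ θ (X ω) ^ 4 ∂P ≤ kappaDesign P X * (∫ ω, inner ℝ θ (X ω) ^ 2 ∂P) ^ 2 := by
  have e4 : ∀ x : ℝ, (0 - x) ^ 4 = x ^ 4 := fun x => by ring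
  have hb : ∀ θ : EuclideanSpace ℝ (Fin d), ∫ ω, inner ℝ θ (X ω) ^ 4 ∂P ≤
      (∫ ω, inner ℝ θ (X ω) ^ 2 ∂P) ^ 2 * ∫ ω, ‖whitened P X Y θstar ω‖ ^ 4 ∂P := by
    intro θ
    have h := (integral_pow_four_le_norm_whitened hXm hYm hX hY hmin hZ θ 0).2
    simpa only [quadForm_zero, zero_mul, e4] using h
  have hV0 : 0 ≤ ∫ ω, ‖whitened P X Y θstar ω‖ ^ 4 ∂P := integral_nonneg fun ω => by positivity
  -- Needed because the supremum of an unbounded set of reals is 0 by default.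
  have hbdd : BddAbove {t : ℝ | ∃ θ : EuclideanSpace ℝ (Fin d),
      ∫ ω, (inner ℝ θ (X ω)) ^ 2 ∂P ≤ 1 ∧ t = ∫ ω, (inner ℝ θ (X ω)) ^ 4 ∂P} := by
    refine ⟨∫ ω, ‖whitened P X Y θstar ω‖ ^ 4 ∂P, ?_⟩
    rintro t ⟨θ, h1, rfl⟩
    refine (hb θ).trans (mul_le_of_le_one_left hV0 ?_)
    exact pow_le_one₀ (integral_nonneg fun ω => sq_nonneg _) h1
  set b := ∫ ω, inner ℝ θ (X ω) ^ 2 ∂P with hbdef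
  have hb0 : 0 ≤ b := integral_nonneg fun ω => sq_nonneg _
  rcases hb0.eq_or_lt with h0 | hpos
  · have h1 := hb θ
    rw [← hbdef, ← h0] at h1
    rw [← h0]
    simpa using h1
  · have hs : √b ^ 2 = b := Real.sq_sqrt hb0
    have hs0 : 0 < √b := Real.sqrt_pos.2 hpos
    have h1 : ∫ ω, inner ℝ ((√b)⁻¹ • θ) (X ω) ^ 4 ∂P ≤ kappaDesign P X := by
      refine le_csSup hbdd ⟨_, ?_, rfl⟩
      simp only [real_inner_smul_left, mul_pow]
      rw [integral_const_mul, ← hbdef, inv_pow, hs, inv_mul_cancel₀ hpos.ne']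
    simp only [real_inner_smul_left, mul_pow] at h1
    rw [integral_const_mul, inv_pow, show √b ^ 4 = (√b ^ 2) ^ 2 by ring, hs,
      inv_mul_le_iff₀ (by positivity)] at h1
    linarith

theorem integral_noise_pow_four_le (hXm : Measurable X) (hYm : Measurable Y)
    (hX : MemLp X 2 P) (hY : MemLp Y 2 P) (hmin : ∀ θ, risk P X Y θstar ≤ risk P X Y θ)
    (hZ : Integrable (fun ω => ‖whitened P X Y θstar ω‖ ^ 4) P) :
    ∫ ω, (Y ω - inner ℝ θstar (X ω)) ^ 4 ∂P ≤
      kappaNoise P X Y θstar * (∫ ω, (Y ω - inner ℝ θstar (X ω)) ^ 2 ∂P) ^ 2 := by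
  have hv0 : 0 ≤ ∫ ω, (Y ω - inner ℝ θstar (X ω)) ^ 2 ∂P := integral_nonneg fun ω => sq_nonneg _
  rcases hv0.eq_or_lt with h0 | hpos
  · have h := (integral_pow_four_le_norm_whitened hXm hYm hX hY hmin hZ θstar 1).2
    simp only [quadForm, one_mul] at h
    rw [← h0] at h ⊢
    simpa using h
  · rw [kappaNoise, if_pos hpos, div_mul_cancel₀ _ (by positivity)]

/-- The whitened coordinates are isotropic. -/
theorem isIsotropic_whitened (hXm : Measurable X) (hYm : Measurable Y)
    (hX : MemLp X 2 P) (hY : MemLp Y 2 P) (hmin : ∀ θ, risk P X Y θstar ≤ risk P X Y θ)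
    (hZ : Integrable (fun ω => ‖whitened P X Y θstar ω‖ ^ 4) P) :
    IsIsotropic P (whitened P X Y θstar)
      ((√(kappaDesign P X) + √(kappaNoise P X Y θstar)) ^ 2) where
  measurable := measurable_whitened hXm hYm
  integrable_norm_pow_four := hZ
  integral_inner_sq := integral_inner_whitened_sq hX hY hmin
  integral_inner_pow_four_le := by
    intro u
    obtain ⟨a, θ, hu⟩ := exists_inner_whitened u
    rw [← integral_inner_whitened_sq hX hY hmin u]
    simp only [hu]
    have hW : MemLp (fun ω => Y ω - inner ℝ θstar (X ω)) 2 P := hY.sub (memLp_inner hX θstar)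
    have hT := memLp_inner hX θ
    have hW4 := (integral_pow_four_le_norm_whitened hXm hYm hX hY hmin hZ θstar 1).1
    simp only [one_mul] at hW4
    have hT4 := (integral_pow_four_le_norm_whitened hXm hYm hX hY hmin hZ θ 0).1
    simp only [zero_mul, zero_sub, (show Even 4 by decide).neg_pow] at hT4
    have hsq : ∫ ω, (a * (Y ω - inner ℝ θstar (X ω)) + inner ℝ θ (X ω)) ^ 2 ∂P =
        a ^ 2 * ∫ ω, (Y ω - inner ℝ θstar (X ω)) ^ 2 ∂P + ∫ ω, inner ℝ θ (X ω) ^ 2 ∂P := by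
      have e : ∀ ω, (a * (Y ω - inner ℝ θstar (X ω)) + inner ℝ θ (X ω)) ^ 2 =
          a ^ 2 * (Y ω - inner ℝ θstar (X ω)) ^ 2 +
          2 * a * ((Y ω - inner ℝ θstar (X ω)) * inner ℝ θ (X ω)) + inner ℝ θ (X ω) ^ 2 := by
        intro ω; ring
      have i1 := hW.integrable_sq.const_mul (a ^ 2)
      have i2 : Integrable (fun ω => 2 * a * ((Y ω - inner ℝ θstar (X ω)) * inner ℝ θ (X ω))) P :=
        (hW.integrable_mul hT).const_mul _
      have i3 : Integrable (fun ω => a ^ 2 * (Y ω - inner ℝ θstar (X ω)) ^ 2 +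
          2 * a * ((Y ω - inner ℝ θstar (X ω)) * inner ℝ θ (X ω))) P := i1.add i2
      simp only [e]
      rw [integral_add i3 hT.integrable_sq, integral_add i1 i2, integral_const_mul,
        integral_const_mul, integral_noise_mul_inner hX hY hmin, mul_zero, add_zero]
    rw [hsq, add_comm √(kappaDesign P X)]
    have hk₁ := kappaDesign_nonneg (P := P) (X := X)
    have hk₂ := kappaNoise_nonneg (P := P) (X := X) (Y := Y) (θstar := θstar)
    -- The two second moments add up by decorrelation, which is the (c + e)² of the Minkowski bound.
    refine integral_add_pow_four_le (by fun_prop) (by fun_prop) ?_ hT4 hk₂ hk₁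
      (mul_nonneg (sq_nonneg a) (integral_nonneg fun ω => sq_nonneg _))
      (integral_nonneg fun ω => sq_nonneg _) ?_
      (integral_inner_design_pow_four_le hXm hYm hX hY hmin hZ θ)
    · simp only [mul_pow]
      exact hW4.const_mul _
    · simp only [mul_pow]
      rw [integral_const_mul]
      have h := integral_noise_pow_four_le hXm hYm hX hY hmin hZ
      have ha : 0 ≤ a ^ 4 := by positivity
      calc _ ≤ a ^ 4 * (kappaNoise P X Y θstar *
            (∫ ω, (Y ω - inner ℝ θstar (X ω)) ^ 2 ∂P) ^ 2) := by gcongr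
        _ = _ := by ring

/-- If all coordinates were degenerate, both kurtosis coefficients would be 0. Having at least one
coordinate gives E‖Z‖² ≥ 1, so that the moment sums are at least 1. -/
theorem activeIndex_nonempty (hXm : Measurable X) (hYm : Measurable Y)
    (hX : MemLp X 2 P) (hY : MemLp Y 2 P) (hmin : ∀ θ, risk P X Y θstar ≤ risk P X Y θ)
    (hZ : Integrable (fun ω => ‖whitened P X Y θstar ω‖ ^ 4) P)
    (hK : 0 < (√(kappaDesign P X) + √(kappaNoise P X Y θstar)) ^ 2) :
    Nonempty (ActiveIndex P X Y θstar) := by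
  by_contra hne
  rw [not_nonempty_iff] at hne
  have hq : ∀ θ ξ, quadForm P X Y θ ξ = 0 := by
    intro θ ξ
    rw [quadForm_eq_norm_sq hX hY hmin, Subsingleton.elim (whitenedCoeff P X Y θstar θ ξ) 0]
    simp
  have h1 : kappaDesign P X ≤ 0 := by
    refine Real.sSup_le ?_ le_rfl
    rintro t ⟨θ, -, rfl⟩
    have h := integral_inner_design_pow_four_le hXm hYm hX hY hmin hZ θ
    rw [← quadForm_zero (Y := Y), hq] at h
    simpa using h
  have h2 : kappaNoise P X Y θstar = 0 := by
    have h := hq θstar 1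
    simp only [quadForm, one_mul] at h
    rw [kappaNoise, if_neg (by rw [h]; exact lt_irrefl 0)]
  rw [Real.sqrt_eq_zero_of_nonpos h1, h2] at hK
  simp at hK

/-- The moments of a random variable with mean at least one are at least one. -/
theorem one_le_integral_rpow [IsProbabilityMeasure P] {V : Ω → ℝ} {s : ℝ} (hs : 1 ≤ s)
    (hV0 : ∀ ω, 0 ≤ V ω) (hV : Integrable V P) (hVs : Integrable (fun ω => V ω ^ s) P)
    (h1 : 1 ≤ ∫ ω, V ω ∂P) : 1 ≤ ∫ ω, V ω ^ s ∂P := by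
  have hle : ∀ ω, 1 + s * (V ω - 1) ≤ V ω ^ s := by
    intro ω
    have := one_add_mul_self_le_rpow_one_add (s := V ω - 1) (by linarith [hV0 ω]) hs
    simpa using this
  have i1 : Integrable (fun ω => s * (V ω - 1)) P := (hV.sub (integrable_const 1)).const_mul s
  have h2 := integral_mono ((integrable_const (1 : ℝ)).add i1) hVs hle
  simp only [Pi.add_apply] at h2
  rw [integral_add (integrable_const _) i1, integral_const_mul,
    integral_sub hV (integrable_const _)] at h2
  simp only [integral_const, probReal_univ, smul_eq_mul, one_mul] at h2
  nlinarith

theorem IsIsotropic.one_le_integral_norm_sq_rpow [IsProbabilityMeasure P] {ι : Type*} [Fintype ι]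
    [Nonempty ι] {Z : Ω → EuclideanSpace ℝ ι} {K s : ℝ} (h : IsIsotropic P Z K) (hs : 1 ≤ s)
    (hi : Integrable (fun ω => (‖Z ω‖ ^ 2) ^ s) P) : 1 ≤ ∫ ω, (‖Z ω‖ ^ 2) ^ s ∂P := by
  have hZ := h.measurable
  refine one_le_integral_rpow hs (fun ω => by positivity) ?_ hi ?_
  · have := integrable_rpow_of_le (fun ω => sq_nonneg ‖Z ω‖)
      (by fun_prop : Measurable fun ω => ‖Z ω‖ ^ 2).aemeasurable zero_le_one hs hi
    simpa using this
  · rw [h.integral_norm_sq]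
    exact_mod_cast Fintype.card_pos

/-- With probability at least `1 - k ε`, the empirical quadratic form is close to its expectation. -/
theorem measure_quadForm_deviation_le [IsProbabilityMeasure P] (hXm : Measurable X)
    (hYm : Measurable Y) (hX : MemLp X 2 P) (hY : MemLp Y 2 P)
    (hmin : ∀ θ, risk P X Y θstar ≤ risk P X Y θ) {K M₁ M₂ p q k ε : ℝ} {n : ℕ}
    (hKdef : K = (√(kappaDesign P X) + √(kappaNoise P X Y θstar)) ^ 2)
    (hM₁ : M₁ = momentSum P X Y θstar (p + 1))
    (hM₂ : M₂ = momentSum P X Y θstar (q * (p + 1)))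
    (hK : 1 < K) (hε : 0 < ε) (hε1 : ε < 1) (hn : SampleSizeCond d K ε n)
    (hδ : deltaHat d K ε n < 1) (hp : 1 < p) (hp2 : p ≤ 2)
    (hqk : (1 < q ∧ q < 2 ∧ k = 4) ∨ (q = 2 ∧ k = 3))
    (hW : Integrable (fun ω => |Y ω - inner ℝ θstar (X ω)| ^ (2 * (q * (p + 1)))) P)
    (hN : Integrable (fun ω => whitenedNorm P X ω ^ (2 * (q * (p + 1)))) P) :
    (Measure.pi fun _ : Fin n => P) {z | ¬ ∀ θ ξ,
      (1 - gammaTilde d K M₁ M₂ p q ε n) / (1 + deltaHat d K ε n) * quadForm P X Y θ ξ ≤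
        empForm (fun i => X (z i)) (fun i => Y (z i)) θ ξ ∧
      empForm (fun i => X (z i)) (fun i => Y (z i)) θ ξ ≤
        (1 + gammaTilde d K M₁ M₂ p q ε n) / (1 - deltaHat d K ε n) * quadForm P X Y θ ξ} ≤
      ENNReal.ofReal (k * ε) := by
  have hq1 : 1 < q := by rcases hqk with h | h <;> linarith [h.1]
  have hs2 : p + 1 ≤ q * (p + 1) := le_mul_of_one_le_left (by linarith) hq1.le
  obtain ⟨i1, b1⟩ := integral_norm_whitened_rpow_le (θstar := θstar) hXm hYm (s := p + 1)
    (by linarith) hs2 hW hN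
  obtain ⟨i2, b2⟩ := integral_norm_whitened_rpow_le (θstar := θstar) hXm hYm
    (s := q * (p + 1)) (by linarith) le_rfl hW hN
  have hZm := measurable_whitened (P := P) (θstar := θstar) hXm hYm
  have hZ4 : Integrable (fun ω => ‖whitened P X Y θstar ω‖ ^ 4) P := by
    have := integrable_rpow_of_le (fun ω => sq_nonneg ‖whitened P X Y θstar ω‖)
      (by fun_prop : Measurable fun ω => ‖whitened P X Y θstar ω‖ ^ 2).aemeasurable
      (t := 2) (by norm_num) (by linarith) i1
    refine this.congr (Eventually.of_forall fun ω => ?_)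
    simp only
    rw [show (2 : ℝ) = ((2 : ℕ) : ℝ) by norm_num, Real.rpow_natCast, ← pow_mul]
  have hiso := isIsotropic_whitened hXm hYm hX hY hmin hZ4
  have hne := activeIndex_nonempty hXm hYm hX hY hmin hZ4 (by rw [← hKdef]; linarith)
  rw [← hKdef] at hiso
  have hroot : ∀ {s M : ℝ}, 1 ≤ s → 0 ≤ M → 1 ≤ M ^ s → 1 ≤ M := by
    intro s M hs hM h
    by_contra hlt
    exact absurd h (not_le.2 (Real.rpow_lt_one hM (not_le.1 hlt) (by linarith)))
  have o1 : 1 ≤ M₁ := hroot (s := p + 1) (by linarith) (hM₁ ▸ momentSum_nonneg _)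
    (hM₁ ▸ (hiso.one_le_integral_norm_sq_rpow (by linarith) i1).trans b1)
  have o2 : 1 ≤ M₂ := hroot (s := q * (p + 1)) (by linarith) (hM₂ ▸ momentSum_nonneg _)
    (hM₂ ▸ (hiso.one_le_integral_norm_sq_rpow (by linarith) i2).trans b2)
  have key := hiso.measure_deviation_le (d := d) (n := n) (M₁ := M₁) (M₂ := M₂) hK
    (card_activeIndex_le P X Y θstar) hε hε1 hn hδ hp hp2 hqk i2 (hM₁ ▸ b1) (hM₂ ▸ b2) o1 o2
  -- One null event for the whole sample, outside which the whitened identity holds for all θ and ξ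
  -- simultaneously.
  have hnull : ∀ᵐ z ∂(Measure.pi fun _ : Fin n => P), ∀ i j,
      ¬ 0 < rawVar P X Y θstar j → rawCoord P X Y θstar j (z i) = 0 := by
    rw [ae_all_iff]
    intro i
    exact (measurePreserving_eval (fun _ : Fin n => P) i).quasiMeasurePreserving.ae
      (ae_rawCoord_eq_zero hX hY hmin)
  refine le_trans (measure_mono_ae ?_) key
  filter_upwards [hnull] with z hz hbad hgood
  refine hbad fun θ ξ => ?_
  have h := hgood (whitenedCoeff P X Y θstar θ ξ)
  simp only [inner_whitenedCoeff (hz _)] at h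
  rw [← quadForm_eq_norm_sq hX hY hmin] at h
  exact h

end kurtosis

/-! ### Excess risk of ordinary least squares -/

section leastSquares

variable {Ω : Type*} [MeasurableSpace Ω] {P : Measure Ω} {d n : ℕ}
  {X : Ω → EuclideanSpace ℝ (Fin d)} {Y : Ω → ℝ} {θstar : EuclideanSpace ℝ (Fin d)}

theorem quadForm_one (θ : EuclideanSpace ℝ (Fin d)) : quadForm P X Y θ 1 = risk P X Y θ := by
  simp [quadForm, risk]

theorem risk_add_smul (hX : MemLp X 2 P) (hY : MemLp Y 2 P)
    (hmin : ∀ θ, risk P X Y θstar ≤ risk P X Y θ) (e : EuclideanSpace ℝ (Fin d)) (r : ℝ) :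
    risk P X Y (θstar + r • e) = risk P X Y θstar + r ^ 2 * quadForm P X Y e 0 := by
  have hW : MemLp (fun ω => Y ω - inner ℝ θstar (X ω)) 2 P := hY.sub (memLp_inner hX θstar)
  have hT := memLp_inner hX e
  have h : ∀ ω, (Y ω - inner ℝ (θstar + r • e) (X ω)) ^ 2 =
      (Y ω - inner ℝ θstar (X ω)) ^ 2 - 2 * r * ((Y ω - inner ℝ θstar (X ω)) * inner ℝ e (X ω)) +
        r ^ 2 * inner ℝ e (X ω) ^ 2 := by
    intro ω; rw [inner_add_left, real_inner_smul_left]; ring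
  have i2 : Integrable (fun ω => 2 * r * ((Y ω - inner ℝ θstar (X ω)) * inner ℝ e (X ω))) P :=
    (hW.integrable_mul hT).const_mul _
  have i3 : Integrable (fun ω => (Y ω - inner ℝ θstar (X ω)) ^ 2 -
      2 * r * ((Y ω - inner ℝ θstar (X ω)) * inner ℝ e (X ω))) P := hW.integrable_sq.sub i2
  rw [quadForm_zero]
  simp only [risk, h]
  rw [integral_add i3 (hT.integrable_sq.const_mul _), integral_sub hW.integrable_sq i2,
    integral_const_mul, integral_const_mul, integral_noise_mul_inner hX hY hmin, mul_zero, sub_zero]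

theorem IsOLS.empForm_add_smul {x : Fin n → EuclideanSpace ℝ (Fin d)} {y : Fin n → ℝ}
    {θhat : EuclideanSpace ℝ (Fin d)} (h : IsOLS x y θhat) (e : EuclideanSpace ℝ (Fin d)) (t : ℝ) :
    empForm x y (θhat + t • e) 1 = empForm x y θhat 1 + t ^ 2 * empForm x y e 0 := by
  have hexp : ∀ t : ℝ, ∑ i, (y i - inner ℝ (θhat + t • e) (x i)) ^ 2 =
      ∑ i, (y i - inner ℝ θhat (x i)) ^ 2 -
        2 * t * ∑ i, (y i - inner ℝ θhat (x i)) * inner ℝ e (x i) +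
        t ^ 2 * ∑ i, inner ℝ e (x i) ^ 2 := by
    intro t
    rw [Finset.mul_sum, Finset.mul_sum, ← Finset.sum_sub_distrib, ← Finset.sum_add_distrib]
    refine Finset.sum_congr rfl fun i _ => ?_
    rw [inner_add_left, real_inner_smul_left]
    ring
  have h0 : ∑ i, (y i - inner ℝ θhat (x i)) * inner ℝ e (x i) = 0 := by
    refine eq_zero_of_forall_two_mul_le (C := ∑ i, inner ℝ e (x i) ^ 2)
      (Finset.sum_nonneg fun i _ => sq_nonneg _) fun t => ?_
    have := h (θhat + t • e)
    rw [hexp] at this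
    linarith
  simp only [empForm, one_mul, zero_mul, zero_sub, even_two.neg_pow]
  rw [hexp, h0]
  ring

/-- A relative error bound for the quadratic form gives an excess risk bound for ordinary least
squares. -/
theorem IsOLS.excess_risk_le {x : Fin n → EuclideanSpace ℝ (Fin d)} {y : Fin n → ℝ}
    {θhat : EuclideanSpace ℝ (Fin d)} (h : IsOLS x y θhat) (hn : 0 < n)
    (hX : MemLp X 2 P) (hY : MemLp Y 2 P) (hmin : ∀ θ, risk P X Y θstar ≤ risk P X Y θ)
    {δ : ℝ} (hδ0 : 0 < δ) (hδ1 : δ < 1)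
    (hN : ∀ θ ξ, (1 - δ) * quadForm P X Y θ ξ ≤ empForm x y θ ξ ∧
      empForm x y θ ξ ≤ (1 + δ) * quadForm P X Y θ ξ) :
    risk P X Y θhat - risk P X Y θstar ≤
        δ ^ 2 / ((1 - δ) * (1 - δ ^ 2) * n) * ∑ i, (y i - inner ℝ θhat (x i)) ^ 2 ∧
      δ ^ 2 / ((1 - δ) * (1 - δ ^ 2) * n) * ∑ i, (y i - inner ℝ θhat (x i)) ^ 2 ≤
        δ ^ 2 / (1 - δ) ^ 2 * risk P X Y θstar := by
  have hn' : (0 : ℝ) < n := by exact_mod_cast hn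
  set e := θhat - θstar with he
  set b := quadForm P X Y e 0 with hb
  set a := risk P X Y θstar with ha
  have hpop : ∀ s : ℝ, quadForm P X Y (θhat + s • e) 1 = a + (1 + s) ^ 2 * b := by
    intro s
    rw [quadForm_one, ← risk_add_smul hX hY hmin]
    congr 1
    rw [add_smul, one_smul, ← add_assoc, he, add_sub_cancel]
  have hA : empForm x y θhat 1 = (∑ i, (y i - inner ℝ θhat (x i)) ^ 2) / n := by
    simp only [empForm, one_mul]
    ring
  set A := empForm x y θhat 1 with hAdef
  have ha0 : 0 ≤ a := integral_nonneg fun ω => sq_nonneg _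
  have hb0 : 0 ≤ b := integral_nonneg fun ω => sq_nonneg _
  have hrisk : risk P X Y θhat = a + b := by
    have := hpop 0
    rw [zero_smul, add_zero, quadForm_one] at this
    rw [this]
    ring
  -- The empirical risk is the same at θ̂ ± se, while the population risks are a + (1 ± s)²b. Their
  -- comparison yields b(4s - 2δ(1 + s²)) ≤ 2δa, and s = δ⁻¹ maximizes the left coefficient.
  have h1 := (hN (θhat + δ⁻¹ • e) 1).1
  have h2 := (hN (θhat + (-δ⁻¹) • e) 1).2
  have h3 := (hN θhat 1).1
  have h4 := (hN θstar 1).2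
  rw [h.empForm_add_smul, hpop] at h1 h2
  rw [quadForm_one, hrisk, ← hAdef] at h3
  rw [quadForm_one, ← ha] at h4
  have h5 : A ≤ (1 + δ) * a := by
    refine le_trans ?_ h4
    simp only [hAdef, empForm, one_mul]
    exact mul_le_mul_of_nonneg_left (h θstar) (by positivity)
  have h6 : (1 - δ) * (a + (1 + δ⁻¹) ^ 2 * b) ≤ (1 + δ) * (a + (1 + -δ⁻¹) ^ 2 * b) := by
    rw [neg_sq] at h2
    exact h1.trans h2
  have h7 : (1 - δ ^ 2) * b ≤ δ ^ 2 * a := by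
    have e1 : (1 + δ⁻¹) ^ 2 = (1 + δ) ^ 2 / δ ^ 2 := by field_simp; ring
    have e2 : (1 + -δ⁻¹) ^ 2 = (1 - δ) ^ 2 / δ ^ 2 := by field_simp; ring
    rw [e1, e2] at h6
    have h8 := mul_le_mul_of_nonneg_left h6 (sq_nonneg δ)
    have e3 : δ ^ 2 * ((1 - δ) * (a + (1 + δ) ^ 2 / δ ^ 2 * b)) =
        (1 - δ) * (δ ^ 2 * a + (1 + δ) ^ 2 * b) := by field_simp
    have e4 : δ ^ 2 * ((1 + δ) * (a + (1 - δ) ^ 2 / δ ^ 2 * b)) =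
        (1 + δ) * (δ ^ 2 * a + (1 - δ) ^ 2 * b) := by field_simp
    rw [e3, e4] at h8
    refine le_of_mul_le_mul_left (a := 2 * δ) ?_ (by linarith)
    linarith
  have hd1 : 0 < 1 - δ := by linarith
  have hd2 : 0 < 1 - δ ^ 2 := by nlinarith
  have hcoef : δ ^ 2 / ((1 - δ) * (1 - δ ^ 2) * n) * ∑ i, (y i - inner ℝ θhat (x i)) ^ 2 =
      δ ^ 2 * A / ((1 - δ) * (1 - δ ^ 2)) := by
    rw [hA]
    field_simp
  rw [hcoef, hrisk, add_sub_cancel_left]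
  constructor
  · rw [le_div_iff₀ (by positivity)]
    have hbl : b * (1 - δ ^ 2) ≤ b := mul_le_of_le_one_right hb0 (by nlinarith)
    calc b * ((1 - δ) * (1 - δ ^ 2)) = (1 - δ) * (b * (1 - δ ^ 2)) := by ring
      _ ≤ (1 - δ) * b := by gcongr
      _ ≤ (1 - δ) * (δ ^ 2 * (a + b)) := by gcongr; linarith
      _ = δ ^ 2 * ((1 - δ) * (a + b)) := by ring
      _ ≤ δ ^ 2 * A := by gcongr
  · rw [div_mul_eq_mul_div, div_le_div_iff₀ (by positivity) (by positivity)]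
    calc δ ^ 2 * A * (1 - δ) ^ 2 ≤ δ ^ 2 * ((1 + δ) * a) * (1 - δ) ^ 2 := by gcongr
      _ = δ ^ 2 * a * ((1 - δ) * (1 - δ ^ 2)) := by ring

end leastSquares

/-! ### Transport to the law of the couple and to the sample -/

section transport

variable {Ω : Type*} [MeasurableSpace Ω] {P : Measure Ω} {d : ℕ}
  {X : Ω → EuclideanSpace ℝ (Fin d)} {Y : Ω → ℝ}

theorem integral_map_prod {S T : Type*} [MeasurableSpace S] [MeasurableSpace T] {U : Ω → S}
    {V : Ω → T} (hU : AEMeasurable U P) (hV : AEMeasurable V P) {f : S × T → ℝ}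
    (hf : Measurable f) :
    ∫ z, f z ∂(P.map fun ω => (U ω, V ω)) = ∫ ω, f (U ω, V ω) ∂P :=
  integral_map (hU.prodMk hV) hf.aestronglyMeasurable

theorem quadForm_map (hX : AEMeasurable X P) (hY : AEMeasurable Y P) :
    quadForm (P.map fun ω => (X ω, Y ω)) Prod.fst Prod.snd = quadForm P X Y := by
  ext θ ξ
  exact integral_map_prod hX hY (f := fun z => (ξ * z.2 - inner ℝ θ z.1) ^ 2) (by fun_prop)

theorem risk_map (hX : AEMeasurable X P) (hY : AEMeasurable Y P) :
    risk (P.map fun ω => (X ω, Y ω)) Prod.fst Prod.snd = risk P X Y := by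
  ext θ
  rw [← quadForm_one, ← quadForm_one, quadForm_map hX hY]

theorem gram_map (hX : AEMeasurable X P) (hY : AEMeasurable Y P) :
    gram (P.map fun ω => (X ω, Y ω)) Prod.fst = gram P X := by
  ext i j
  exact integral_map_prod hX hY (f := fun z => z.1 i * z.1 j) (by fun_prop)

/-- The spectral decomposition is attached to a proof of symmetry, so the equality of matrices is
substituted in a statement about arbitrary symmetric matrices. -/
theorem gramInvSqrt_congr {Ω' : Type*} [MeasurableSpace Ω'] {P' : Measure Ω'}
    {X' : Ω' → EuclideanSpace ℝ (Fin d)} (h : gram P' X' = gram P X) :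
    gramInvSqrt P' X' = gramInvSqrt P X := by
  have key : ∀ (A B : Matrix (Fin d) (Fin d) ℝ) (hA : A.IsHermitian) (hB : B.IsHermitian), A = B →
      (hA.eigenvectorUnitary : Matrix (Fin d) (Fin d) ℝ) *
        Matrix.diagonal (fun i => if 0 < hA.eigenvalues i then (√(hA.eigenvalues i))⁻¹ else 0) *
        (hA.eigenvectorUnitary : Matrix (Fin d) (Fin d) ℝ).transpose =
      (hB.eigenvectorUnitary : Matrix (Fin d) (Fin d) ℝ) *
        Matrix.diagonal (fun i => if 0 < hB.eigenvalues i then (√(hB.eigenvalues i))⁻¹ else 0) *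
        (hB.eigenvectorUnitary : Matrix (Fin d) (Fin d) ℝ).transpose := by
    rintro A B hA hB rfl
    rfl
  exact key _ _ _ _ h

theorem whitenedNorm_map (hX : AEMeasurable X P) (hY : AEMeasurable Y P)
    (z : EuclideanSpace ℝ (Fin d) × ℝ) :
    whitenedNorm (P.map fun ω => (X ω, Y ω)) Prod.fst z =
      ‖Matrix.toEuclideanLin (gramInvSqrt P X) z.1‖ := by
  rw [whitenedNorm, gramInvSqrt_congr (gram_map hX hY)]

theorem kappaDesign_map (hX : AEMeasurable X P) (hY : AEMeasurable Y P) :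
    kappaDesign (P.map fun ω => (X ω, Y ω)) Prod.fst = kappaDesign P X := by
  have h : ∀ (θ : EuclideanSpace ℝ (Fin d)) (k : ℕ),
      ∫ z : EuclideanSpace ℝ (Fin d) × ℝ, inner ℝ θ z.1 ^ k ∂(P.map fun ω => (X ω, Y ω)) =
        ∫ ω, inner ℝ θ (X ω) ^ k ∂P :=
    fun θ k => integral_map_prod hX hY (f := fun z => inner ℝ θ z.1 ^ k) (by fun_prop)
  simp only [kappaDesign, h]

theorem kappaNoise_map (hX : AEMeasurable X P) (hY : AEMeasurable Y P)
    (θstar : EuclideanSpace ℝ (Fin d)) :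
    kappaNoise (P.map fun ω => (X ω, Y ω)) Prod.fst Prod.snd θstar = kappaNoise P X Y θstar := by
  have h : ∀ k : ℕ, ∫ z : EuclideanSpace ℝ (Fin d) × ℝ, (z.2 - inner ℝ θstar z.1) ^ k
      ∂(P.map fun ω => (X ω, Y ω)) = ∫ ω, (Y ω - inner ℝ θstar (X ω)) ^ k ∂P :=
    fun k => integral_map_prod hX hY (f := fun z => (z.2 - inner ℝ θstar z.1) ^ k) (by fun_prop)
  simp only [kappaNoise, h]

theorem momentSum_map (hX : AEMeasurable X P) (hY : AEMeasurable Y P)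
    (θstar : EuclideanSpace ℝ (Fin d)) :
    momentSum (P.map fun ω => (X ω, Y ω)) Prod.fst Prod.snd θstar = momentSum P X Y θstar := by
  ext s
  have hc : Continuous (Matrix.toEuclideanLin (gramInvSqrt P X)) :=
    LinearMap.continuous_of_finiteDimensional _
  have hcm := hc.measurable
  have h2 : ∫ z : EuclideanSpace ℝ (Fin d) × ℝ, (z.2 - inner ℝ θstar z.1) ^ 2
      ∂(P.map fun ω => (X ω, Y ω)) = ∫ ω, (Y ω - inner ℝ θstar (X ω)) ^ 2 ∂P :=
    integral_map_prod hX hY (f := fun z => (z.2 - inner ℝ θstar z.1) ^ 2) (by fun_prop)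
  have h3 : ∫ z : EuclideanSpace ℝ (Fin d) × ℝ, |z.2 - inner ℝ θstar z.1| ^ (2 * s)
      ∂(P.map fun ω => (X ω, Y ω)) = ∫ ω, |Y ω - inner ℝ θstar (X ω)| ^ (2 * s) ∂P :=
    integral_map_prod hX hY (f := fun z => |z.2 - inner ℝ θstar z.1| ^ (2 * s)) (by fun_prop)
  have h4 : ∫ z : EuclideanSpace ℝ (Fin d) × ℝ,
      whitenedNorm (P.map fun ω => (X ω, Y ω)) Prod.fst z ^ (2 * s)
      ∂(P.map fun ω => (X ω, Y ω)) = ∫ ω, whitenedNorm P X ω ^ (2 * s) ∂P := by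
    simp only [whitenedNorm_map hX hY]
    exact integral_map_prod hX hY
      (f := fun z => ‖Matrix.toEuclideanLin (gramInvSqrt P X) z.1‖ ^ (2 * s)) (by fun_prop)
  rw [momentSum, h2, h3, h4, momentSum]

/-- An event of large probability avoiding a set of small outer measure. -/
theorem exists_measurableSet_of_measure_compl_le {α : Type*} [MeasurableSpace α] {μ : Measure α}
    [IsProbabilityMeasure μ] {s : Set α} {η : ℝ} (hη : 0 ≤ η) (h : μ s ≤ ENNReal.ofReal η) :
    ∃ B : Set α, MeasurableSet B ∧ ENNReal.ofReal (1 - η) ≤ μ B ∧ ∀ ω ∈ B, ω ∉ s := by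
  refine ⟨(toMeasurable μ s)ᶜ, (measurableSet_toMeasurable μ s).compl, ?_, fun ω hω hs =>
    hω (subset_toMeasurable μ s hs)⟩
  rw [prob_compl_eq_one_sub (measurableSet_toMeasurable μ s), measure_toMeasurable,
    ENNReal.ofReal_sub _ hη, ENNReal.ofReal_one]
  exact tsub_le_tsub_left h 1

/-- The deviation bound for a sample, on an event of the probability space where it is defined. -/
theorem exists_event_quadForm_deviation [IsProbabilityMeasure P] (hX : MemLp X 2 P)
    (hY : MemLp Y 2 P) {θstar : EuclideanSpace ℝ (Fin d)}
    (hmin : ∀ θ, risk P X Y θstar ≤ risk P X Y θ) {K M₁ M₂ p q k ε : ℝ} {n : ℕ}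
    (hKdef : K = (√(kappaDesign P X) + √(kappaNoise P X Y θstar)) ^ 2)
    (hM₁ : M₁ = momentSum P X Y θstar (p + 1))
    (hM₂ : M₂ = momentSum P X Y θstar (q * (p + 1)))
    (hK : 1 < K) (hε : 0 < ε) (hε1 : ε < 1) (hn : SampleSizeCond d K ε n)
    (hδ : deltaHat d K ε n < 1) (hp : 1 < p) (hp2 : p ≤ 2)
    (hqk : (1 < q ∧ q < 2 ∧ k = 4) ∨ (q = 2 ∧ k = 3))
    (hW : Integrable (fun ω => |Y ω - inner ℝ θstar (X ω)| ^ (2 * (q * (p + 1)))) P)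
    (hN : Integrable (fun ω => whitenedNorm P X ω ^ (2 * (q * (p + 1)))) P)
    {Ω' : Type*} [MeasurableSpace Ω'] {P' : Measure Ω'} [IsProbabilityMeasure P']
    {Xs : Fin n → Ω' → EuclideanSpace ℝ (Fin d)} {Ys : Fin n → Ω' → ℝ}
    (hind : iIndepFun (fun i ω => (Xs i ω, Ys i ω)) P')
    (hid : ∀ i, IdentDistrib (fun ω => (Xs i ω, Ys i ω)) (fun ω => (X ω, Y ω)) P' P) :
    ∃ B : Set Ω', MeasurableSet B ∧ ENNReal.ofReal (1 - k * ε) ≤ P' B ∧ ∀ ω ∈ B, ∀ θ ξ,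
      (1 - gammaTilde d K M₁ M₂ p q ε n) / (1 + deltaHat d K ε n) * quadForm P X Y θ ξ ≤
        empForm (fun i => Xs i ω) (fun i => Ys i ω) θ ξ ∧
      empForm (fun i => Xs i ω) (fun i => Ys i ω) θ ξ ≤
        (1 + gammaTilde d K M₁ M₂ p q ε n) / (1 - deltaHat d K ε n) * quadForm P X Y θ ξ := by
  have hXa := hX.1.aemeasurable
  have hYa := hY.1.aemeasurable
  have hXY : AEMeasurable (fun ω => (X ω, Y ω)) P := hXa.prodMk hYa
  have hk : 0 < k := by rcases hqk with h | h <;> linarith [h.2]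
  -- On the space of values the design and the response are the coordinate projections, which are
  -- genuinely measurable, whereas X and Y are only almost everywhere measurable. All the constants
  -- depend on the law alone.
  set ν := P.map fun ω => (X ω, Y ω) with hν
  have hνp : IsProbabilityMeasure ν := Measure.isProbabilityMeasure_map hXY
  have hc : Continuous (Matrix.toEuclideanLin (gramInvSqrt P X)) :=
    LinearMap.continuous_of_finiteDimensional _
  have hcm := hc.measurable
  have key := measure_quadForm_deviation_le (P := ν) (X := Prod.fst) (Y := Prod.snd)
    (θstar := θstar) (K := K) (M₁ := M₁) (M₂ := M₂) (p := p) (q := q) (k := k) (ε := ε) (n := n)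
    measurable_fst measurable_snd
    ((memLp_map_measure_iff measurable_fst.aestronglyMeasurable hXY).2 hX)
    ((memLp_map_measure_iff measurable_snd.aestronglyMeasurable hXY).2 hY)
    (by rw [risk_map hXa hYa]; exact hmin)
    (by rw [kappaDesign_map hXa hYa, kappaNoise_map hXa hYa]; exact hKdef)
    (by rw [momentSum_map hXa hYa]; exact hM₁) (by rw [momentSum_map hXa hYa]; exact hM₂)
    hK hε hε1 hn hδ hp hp2 hqk
    ((integrable_map_measure (Measurable.aestronglyMeasurable (by fun_prop)) hXY).2 hW)
    (by
      simp only [hν, whitenedNorm_map hXa hYa]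
      exact (integrable_map_measure (Measurable.aestronglyMeasurable (by fun_prop)) hXY).2 hN)
  rw [quadForm_map hXa hYa] at key
  have hlaw : P'.map (fun ω i => (Xs i ω, Ys i ω)) = Measure.pi fun _ : Fin n => ν := by
    rw [(iIndepFun_iff_map_fun_eq_pi_map fun i => (hid i).aemeasurable_fst).1 hind]
    congr 1
    ext1 i
    exact (hid i).map_eq
  have hm : AEMeasurable (fun ω i => (Xs i ω, Ys i ω)) P' :=
    aemeasurable_pi_lambda _ fun i => (hid i).aemeasurable_fst
  rw [← hlaw] at key
  -- The bad set is an uncountable union over (θ, ξ) and is bounded in outer measure only; the event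
  -- is the complement of a measurable hull.
  obtain ⟨B, hB1, hB2, hB3⟩ := exists_measurableSet_of_measure_compl_le (mul_pos hk hε).le
    ((Measure.le_map_apply hm _).trans key)
  refine ⟨B, hB1, hB2, fun ω hω => ?_⟩
  have := hB3 ω hω
  simpa only [Set.mem_preimage, Set.mem_ofPred_eq, not_not] using this

end transport

/-! ### The relative error -/

section relativeError

/-- The one-sided relative errors are (x + γ)/(1 + x) from below and (x + γ)/(1 - x) from above. The
remaining factor 1 - γ in the denominator of δ is slack. -/
theorem relError_bounds {x γ : ℝ} (hx0 : 0 < x) (hx1 : x < 1) (hγ0 : 0 ≤ γ) (hγ1 : γ < 1) :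
    0 < relError x γ ∧ 1 - relError x γ ≤ (1 - γ) / (1 + x) ∧
      (1 + γ) / (1 - x) ≤ 1 + relError x γ := by
  have h1 : 0 < 1 - x := by linarith
  have h2 : 0 < 1 - γ := by linarith
  have h3 : relError x γ = (x + γ) / ((1 - x) * (1 - γ)) := by
    rw [relError, max_eq_left h1.le, max_eq_left h2.le]
  have h4 : (x + γ) / (1 - x) ≤ relError x γ := by
    rw [h3]
    gcongr
    exact mul_le_of_le_one_right h1.le (by linarith)
  have h5 : (1 + γ) / (1 - x) = 1 + (x + γ) / (1 - x) := by field_simp; ring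
  have h6 : (1 - γ) / (1 + x) = 1 - (x + γ) / (1 + x) := by field_simp; ring
  have h7 : (x + γ) / (1 + x) ≤ (x + γ) / (1 - x) := by gcongr; linarith
  refine ⟨?_, by linarith, by linarith⟩
  rw [h3]
  positivity

theorem gammaTilde_nonneg {d n : ℕ} {K M₁ M₂ p q ε : ℝ} (hK : 1 < K) (hL : 0 < logTerm d ε)
    (hε : 0 < ε) (hp : 1 < p) (hq : 1 < q) (hq2 : q ≤ 2) (hM₁ : 0 ≤ M₁) (hM₂ : 0 ≤ M₂)
    (hδ : 0 ≤ deltaHat d K ε n) : 0 ≤ gammaTilde d K M₁ M₂ p q ε n := by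
  have h1 : 0 ≤ Cq q := zero_le_one.trans (one_le_Cq hq hq2)
  have h2 : 0 < K - 1 := by linarith
  unfold gammaTilde
  positivity

end relativeError

/-! ### Order of magnitude for large samples -/

section asymptotics

variable {d n : ℕ} {K ε : ℝ}

theorem tendsto_muBound : Tendsto (muBound d K ε) atTop (nhds 0) := by
  have h1 := (tendsto_const_div_atTop_nhds_zero_nat (2 * (K - 1))).mul_const (logTerm d ε)
  have h2 := tendsto_const_div_atTop_nhds_zero_nat (2 * ((d : ℝ) + 1))
  have h3 := h1.sqrt.add (h2.sqrt.const_mul (6.81 * √K))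
  simp only [zero_mul, Real.sqrt_zero, mul_zero, add_zero] at h3
  exact h3

theorem tendsto_clipLevel : Tendsto (clipLevel d K ε) atTop (nhds 0) := by
  have h1 := (tendsto_const_div_atTop_nhds_zero_nat (2 * logTerm d ε / (K - 1))).sqrt
  simp only [Real.sqrt_zero, div_div] at h1
  exact h1

/-- The second order term is eventually smaller than the first order term. -/
theorem eventually_gammaTilde_le {M₁ M₂ p q : ℝ} (hK : 1 < K) (hL : 0 < logTerm d ε)
    (hε : 0 < ε) (hp : 1 < p) (hq : 1 < q) (hq2 : q ≤ 2) (hM₁ : 0 ≤ M₁) (hM₂ : 0 ≤ M₂) :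
    ∀ᶠ n : ℕ in atTop, 0 < deltaHat d K ε n → deltaHat d K ε n < 1 →
      gammaTilde d K M₁ M₂ p q ε n ≤ (K - 1) * clipLevel d K ε n := by
  have hC0 : 0 ≤ Cq q := zero_le_one.trans (one_le_Cq hq hq2)
  have hp1 : 0 < p - 1 := by linarith
  set C := 2 ^ (p + 1) * (M₁ ^ (p + 1) + Cq q / ε ^ (1 / q) * M₂ ^ (p + 1)) with hC
  -- This is where p > 1 is used: γ̃₊ ≤ C l^{p-1} · l, and C l^{p-1} eventually falls below K - 1.
  have ht : Tendsto (fun n => C * clipLevel d K ε n ^ (p - 1)) atTop (nhds 0) := by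
    have := (tendsto_clipLevel (d := d) (K := K) (ε := ε)).rpow_const (p := p - 1) (Or.inr hp1.le)
    rw [Real.zero_rpow hp1.ne'] at this
    simpa using this.const_mul C
  filter_upwards [ht.eventually (ge_mem_nhds (show (0 : ℝ) < K - 1 by linarith)),
    eventually_gt_atTop 0] with n hn hn0 hδ0 hδ1
  have hl := clipLevel_pos hK hL hn0
  have hn1 : (1 : ℝ) ≤ n := by exact_mod_cast hn0
  rw [gammaTilde, clipLevel_rpow hK hL]
  set l := clipLevel d K ε n with hldef
  have e1 : l ^ p = l ^ (p - 1) * l := by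
    rw [← Real.rpow_add_one hl.ne']; congr 1; ring
  have b1 : 1 / (p + 1) * l ^ p ≤ l ^ p :=
    mul_le_of_le_one_left (by positivity) (by rw [div_le_one (by linarith)]; linarith)
  have b2 : (1 + deltaHat d K ε n) ^ (p + 1) ≤ 2 ^ (p + 1) := by
    gcongr
    linarith
  have b3 : Cq q / (ε ^ (1 / q) * (n : ℝ) ^ (1 - 1 / q)) ≤ Cq q / ε ^ (1 / q) := by
    have h1 : 1 ≤ (n : ℝ) ^ (1 - 1 / q) := by
      refine Real.one_le_rpow hn1 ?_
      rw [sub_nonneg, div_le_one (by linarith)]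
      exact hq.le
    gcongr
    exact le_mul_of_one_le_right (by positivity) h1
  calc 1 / (p + 1) * l ^ p * (1 + deltaHat d K ε n) ^ (p + 1) *
        (M₁ ^ (p + 1) + Cq q / (ε ^ (1 / q) * (n : ℝ) ^ (1 - 1 / q)) * M₂ ^ (p + 1))
      ≤ l ^ p * 2 ^ (p + 1) * (M₁ ^ (p + 1) + Cq q / ε ^ (1 / q) * M₂ ^ (p + 1)) := by
        gcongr
    _ = C * l ^ (p - 1) * l := by rw [e1, hC]; ring
    _ ≤ (K - 1) * l := by gcongr

theorem muBound_sq_le (hK : 1 < K) (hd : 1 ≤ d) (hε : 0 < ε) (hε1 : ε < 1) (hn : 0 < n) :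
    muBound d K ε n ^ 2 ≤ 400 * (K * (d + Real.log ε⁻¹) / n) := by
  have hL : 0 < logTerm d ε := logTerm_pos hε hε1
  have hn' : (0 : ℝ) < n := by exact_mod_cast hn
  have hd' : (1 : ℝ) ≤ d := by exact_mod_cast hd
  have hlog := Real.log_pos ((one_lt_inv₀ hε).2 hε1)
  have h1 := clipLevel_sq hK hL hn
  have h2 := dimTerm_sq (d := d) (n := n) hK
  rw [muBound_eq hK hn]
  set l := clipLevel d K ε n
  set m := dimTerm d K n
  -- 93 rounds up 2 · 6.81².
  have h3 : ((K - 1) * l + 6.81 * m) ^ 2 ≤ 2 * ((K - 1) * ((K - 1) * l ^ 2)) + 93 * m ^ 2 := by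
    nlinarith [sq_nonneg ((K - 1) * l - 6.81 * m), sq_nonneg m]
  rw [h1, h2] at h3
  refine h3.trans ?_
  have h4 : logTerm d ε ≤ 1.46 * (d + Real.log ε⁻¹) := by
    unfold logTerm
    linarith
  have h5 : 2 * ((d : ℝ) + 1) ≤ 4 * (d + Real.log ε⁻¹) := by linarith
  have h6 : 0 < d + Real.log ε⁻¹ := by linarith
  calc 2 * ((K - 1) * (2 * logTerm d ε / n)) + 93 * (K * (2 * ((d : ℝ) + 1) / n))
      ≤ 2 * (K * (2 * (1.46 * (d + Real.log ε⁻¹)) / n)) +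
          93 * (K * (4 * (d + Real.log ε⁻¹) / n)) := by
        gcongr
        linarith
    _ = 377.84 * (K * (d + Real.log ε⁻¹) / n) := by ring
    _ ≤ _ := by gcongr; norm_num

theorem sq_sqrt_add_sqrt_le {a b : ℝ} (ha : 0 ≤ a) (hb : 0 ≤ b) :
    (√a + √b) ^ 2 ≤ 2 * (a + b) := by
  nlinarith [sq_nonneg (√a - √b), Real.sq_sqrt ha, Real.sq_sqrt hb]

theorem eventually_relError_bounds {κ₁ κ₂ M₁ M₂ p q : ℝ} (hd : 1 ≤ d) (hκ₁ : 0 ≤ κ₁)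
    (hκ₂ : 0 ≤ κ₂) (hKdef : K = (√κ₁ + √κ₂) ^ 2) (hK : 1 < K) (hε : 0 < ε) (hε1 : ε < 1)
    (hp : 1 < p) (hq : 1 < q) (hq2 : q ≤ 2) (hM₁ : 0 ≤ M₁) (hM₂ : 0 ≤ M₂) :
    ∀ᶠ n : ℕ in atTop, ∀ x γ δ : ℝ, x = deltaHat d K ε n → γ = gammaTilde d K M₁ M₂ p q ε n →
      δ = relError x γ → 0 < x ∧ x < 1 ∧ 0 ≤ γ ∧ γ < 1 ∧ δ < 1 ∧ δ ^ 2 ≤ 13000 * x ^ 2 ∧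
        x ^ 2 ≤ 13000 * ((κ₁ + κ₂) * (d + Real.log ε⁻¹) / n) ∧
        δ ^ 2 ≤ 13000 * ((κ₁ + κ₂) * (d + Real.log ε⁻¹) / n) := by
  have hL : 0 < logTerm d ε := logTerm_pos hε hε1
  have hd' : (1 : ℝ) ≤ d := by exact_mod_cast hd
  have hlog := Real.log_pos ((one_lt_inv₀ hε).2 hε1)
  filter_upwards [eventually_gammaTilde_le hK hL hε hp hq hq2 hM₁ hM₂, eventually_gt_atTop 0,
    (tendsto_muBound (d := d) (K := K) (ε := ε)).eventually
      (ge_mem_nhds (show (0 : ℝ) < 1 / 8 by norm_num))] with n hγle hn hμ8 x γ δ hx hγ hδ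
  have hn' : (0 : ℝ) < n := by exact_mod_cast hn
  have hl := clipLevel_pos hK hL hn
  have hm := dimTerm_pos (d := d) hK hn
  have hμeq := muBound_eq (d := d) (ε := ε) hK hn
  have hμsq := muBound_sq_le hK hd hε hε1 hn
  have hμl : (K - 1) * clipLevel d K ε n ≤ muBound d K ε n := by rw [hμeq]; linarith
  have hμ0 : 0 < muBound d K ε n := lt_of_lt_of_le (mul_pos (by linarith) hl) hμl
  set μ := muBound d K ε n with hμdef
  have hden : 0 < 1 - 2 * μ := by linarith
  have hxdef : x = μ / (1 - 2 * μ) := hx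
  have hx0 : 0 < x := by rw [hxdef]; positivity
  have hμx : μ ≤ x := by
    rw [hxdef, le_div_iff₀ hden]
    nlinarith
  have hxμ : x ≤ 4 / 3 * μ := by
    rw [hxdef, div_le_iff₀ hden]
    nlinarith
  rw [← hx, ← hγ] at hγle
  have hγx : γ ≤ x := (hγle hx0 (by linarith)).trans (hμl.trans hμx)
  have hγ0 : 0 ≤ γ := hγ ▸ gammaTilde_nonneg hK hL hε hp hq hq2 hM₁ hM₂ (hx ▸ hx0.le)
  have hδ0 : 0 ≤ δ := hδ ▸ (relError_bounds hx0 (by linarith) hγ0 (by linarith)).1.le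
  have hδx : δ ≤ 3 * x := by
    rw [hδ, relError, max_eq_left (by linarith), max_eq_left (by linarith),
      div_le_iff₀ (mul_pos (by linarith) (by linarith))]
    -- μ ≤ 1/8 gives γ ≤ x ≤ 1/6, so the denominator of δ is at least (5/6)² and δ ≤ (72/25)x ≤ 3x.
    have h1 : 25 / 36 ≤ (1 - x) * (1 - γ) := by nlinarith
    nlinarith
  have hδ2 : δ ^ 2 ≤ 9 * x ^ 2 := by
    calc δ ^ 2 ≤ (3 * x) ^ 2 := by gcongr
      _ = 9 * x ^ 2 := by ring
  have hK2 : K ≤ 2 * (κ₁ + κ₂) := hKdef ▸ sq_sqrt_add_sqrt_le hκ₁ hκ₂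
  have hT0 : 0 ≤ (κ₁ + κ₂) * (d + Real.log ε⁻¹) / n := by positivity
  have hKT : K * (d + Real.log ε⁻¹) / n ≤ 2 * ((κ₁ + κ₂) * (d + Real.log ε⁻¹) / n) := by
    rw [← mul_div_assoc, ← mul_assoc]
    gcongr
  have hx2 : x ^ 2 ≤ 16 / 9 * μ ^ 2 := by
    calc x ^ 2 ≤ (4 / 3 * μ) ^ 2 := by gcongr
      _ = 16 / 9 * μ ^ 2 := by ring
  have hxx := sq_nonneg x
  refine ⟨hx0, by linarith, hγ0, by linarith, by linarith, by linarith, by linarith, by linarith⟩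

end asymptotics

end GramOLS

/-! ### The main theorem -/

theorem proposition4p8 :
    -- `c` is a numerical constant: it does not depend on any parameter of the problem
    ∃ c : ℝ, 0 < c ∧
    ∀ (d : ℕ) (_ : 1 ≤ d)
      -- exponents; the confidence level is `1 - k ε`, where `k = 4` if `q < 2` and `k = 3` if `q = 2`
      (p q k : ℝ) (_ : 1 < p) (_ : p ≤ 2)
      (_ : (1 < q ∧ q < 2 ∧ k = 4) ∨ (q = 2 ∧ k = 3))
      -- the couple `(X, Y)`, and a minimizer of the risk
      (Ω : Type*) [MeasurableSpace Ω] (P : Measure Ω) [IsProbabilityMeasure P]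
      (X : Ω → EuclideanSpace ℝ (Fin d)) (Y : Ω → ℝ)
      (_ : MemLp X 2 P) (_ : MemLp Y 2 P)
      (θstar : EuclideanSpace ℝ (Fin d))
      (_ : ∀ θ, GramOLS.risk P X Y θstar ≤ GramOLS.risk P X Y θ)
      -- polynomial moments of the noise and of `‖G^{-1/2} X‖`
      (_ : Integrable (fun ω => |Y ω - inner ℝ θstar (X ω)| ^ (2 * (q * (p + 1)))) P)
      (_ : Integrable (fun ω => GramOLS.whitenedNorm P X ω ^ (2 * (q * (p + 1)))) P)
      (κ₁ κ₂ K M₁ M₂ : ℝ)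
      (_ : κ₁ = GramOLS.kappaDesign P X)
      (_ : κ₂ = GramOLS.kappaNoise P X Y θstar)
      (_ : K = (Real.sqrt κ₁ + Real.sqrt κ₂) ^ 2)
      (_ : M₁ = GramOLS.momentSum P X Y θstar (p + 1))
      (_ : M₂ = GramOLS.momentSum P X Y θstar (q * (p + 1)))
      -- the factor `K - 1`, by which one divides below, is positive
      (_ : 1 < K),
      -- non-asymptotic bounds
      (∀ (ε : ℝ) (n : ℕ) (δhat γ δ : ℝ), 0 < ε →
        GramOLS.SampleSizeCond d K ε n →
        δhat = GramOLS.deltaHat d K ε n →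
        γ = GramOLS.gammaTilde d K M₁ M₂ p q ε n →
        δ = GramOLS.relError δhat γ →
        -- otherwise the bound on the relative error is `+∞`
        δhat < 1 → γ < 1 →
        ∀ (Ω' : Type*) [MeasurableSpace Ω'] (P' : Measure Ω') [IsProbabilityMeasure P']
          (Xs : Fin n → Ω' → EuclideanSpace ℝ (Fin d)) (Ys : Fin n → Ω' → ℝ),
          iIndepFun (fun i ω => (Xs i ω, Ys i ω)) P' →
          (∀ i, IdentDistrib (fun ω => (Xs i ω, Ys i ω)) (fun ω => (X ω, Y ω)) P' P) →
          ∃ B : Set Ω', MeasurableSet B ∧ ENNReal.ofReal (1 - k * ε) ≤ P' B ∧ ∀ ω ∈ B,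
            -- relative error of the empirical form, with the convention `0 / 0 = 1`
            (∀ (θ : EuclideanSpace ℝ (Fin d)) (ξ : ℝ),
              (GramOLS.quadForm P X Y θ ξ = 0 →
                GramOLS.empForm (fun i => Xs i ω) (fun i => Ys i ω) θ ξ = 0) ∧
              (0 < GramOLS.quadForm P X Y θ ξ →
                |GramOLS.empForm (fun i => Xs i ω) (fun i => Ys i ω) θ ξ /
                  GramOLS.quadForm P X Y θ ξ - 1| ≤ δ)) ∧
            -- excess risk of ordinary least squares
            (δ < 1 → ∀ θhat : EuclideanSpace ℝ (Fin d),
              GramOLS.IsOLS (fun i => Xs i ω) (fun i => Ys i ω) θhat →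
              GramOLS.risk P X Y θhat - GramOLS.risk P X Y θstar ≤
                  δ ^ 2 / ((1 - δ) * (1 - δ ^ 2) * n) *
                    ∑ i, (Ys i ω - inner ℝ θhat (Xs i ω)) ^ 2 ∧
              δ ^ 2 / ((1 - δ) * (1 - δ ^ 2) * n) *
                    ∑ i, (Ys i ω - inner ℝ θhat (Xs i ω)) ^ 2 ≤
                δ ^ 2 / (1 - δ) ^ 2 * GramOLS.risk P X Y θstar)) ∧
      -- order of magnitude of `δ²` when the sample size goes to infinity
      (∀ ε : ℝ, 0 < ε → ε < 1 → ∀ᶠ n : ℕ in atTop, ∀ δhat γ δ : ℝ,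
        δhat = GramOLS.deltaHat d K ε n →
        γ = GramOLS.gammaTilde d K M₁ M₂ p q ε n →
        δ = GramOLS.relError δhat γ →
        0 < δhat ∧ δhat < 1 ∧ 0 ≤ γ ∧ γ < 1 ∧ δ < 1 ∧
        δ ^ 2 ≤ c * δhat ^ 2 ∧
        δhat ^ 2 ≤ c * ((κ₁ + κ₂) * (d + Real.log ε⁻¹) / n) ∧
        δ ^ 2 ≤ c * ((κ₁ + κ₂) * (d + Real.log ε⁻¹) / n)) := by
  -- 13000 rounds up 9 · (16/9) · 400 · 2: the factors come from δ ≤ 3δ̂, δ̂ ≤ (4/3)μ, the bound of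
  -- μ² and K ≤ 2(κ₁ + κ₂).
  refine ⟨13000, by norm_num, ?_⟩
  intro d hd p q k hp hp2 hqk Ω _ P _ X Y hX hY θstar hmin hW hN κ₁ κ₂ K M₁ M₂ hκ₁ hκ₂ hKdef
    hM₁ hM₂ hK
  have hq1 : 1 < q := by rcases hqk with h | h <;> linarith [h.1]
  have hq2 : q ≤ 2 := by rcases hqk with h | h <;> linarith [h.1, h.2]
  have hk : 1 < k := by rcases hqk with h | h <;> linarith [h.2]
  have hM₁0 : 0 ≤ M₁ := hM₁ ▸ GramOLS.momentSum_nonneg _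
  have hM₂0 : 0 ≤ M₂ := hM₂ ▸ GramOLS.momentSum_nonneg _
  refine ⟨?_, fun ε hε hε1 => GramOLS.eventually_relError_bounds hd
    (hκ₁ ▸ GramOLS.kappaDesign_nonneg) (hκ₂ ▸ GramOLS.kappaNoise_nonneg) hKdef hK hε hε1 hp hq1
    hq2 hM₁0 hM₂0⟩
  intro ε n δhat γ δ hε hn hδhat hγ hδ hδhat1 hγ1 Ω' _ P' _ Xs Ys hind hid
  by_cases hkε : 1 ≤ k * ε
  -- When kε ≥ 1 the required probability is not positive and the empty event will do. Otherwise ε <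
  -- 1, which makes `logTerm` positive.
  · refine ⟨∅, MeasurableSet.empty, ?_, fun ω hω => absurd hω (Set.notMem_empty ω)⟩
    rw [ENNReal.ofReal_of_nonpos (by linarith)]
    exact zero_le
  have hε1 : ε < 1 := by
    have : ε ≤ k * ε := le_mul_of_one_le_left hε.le hk.le
    linarith
  have hL : 0 < GramOLS.logTerm d ε := GramOLS.logTerm_pos hε hε1
  have hδhat0 : 0 < δhat := hδhat ▸ (GramOLS.deltaHat_mul hn hK hL).1
  have hγ0 : 0 ≤ γ :=
    hγ ▸ GramOLS.gammaTilde_nonneg hK hL hε hp hq1 hq2 hM₁0 hM₂0 (hδhat ▸ hδhat0.le)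
  obtain ⟨hδ0, hlo, hup⟩ := GramOLS.relError_bounds hδhat0 hδhat1 hγ0 hγ1
  rw [← hδ] at hδ0 hlo hup
  obtain ⟨B, hB, hPB, hdev⟩ := GramOLS.exists_event_quadForm_deviation (k := k) hX hY hmin
    (by rw [hKdef, hκ₁, hκ₂]) hM₁ hM₂ hK hε hε1 hn (hδhat ▸ hδhat1) hp hp2 hqk hW hN hind hid
  rw [← hδhat, ← hγ] at hdev
  refine ⟨B, hB, hPB, fun ω hω => ?_⟩
  have hform : ∀ θ ξ, (1 - δ) * GramOLS.quadForm P X Y θ ξ ≤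
        GramOLS.empForm (fun i => Xs i ω) (fun i => Ys i ω) θ ξ ∧
      GramOLS.empForm (fun i => Xs i ω) (fun i => Ys i ω) θ ξ ≤
        (1 + δ) * GramOLS.quadForm P X Y θ ξ := by
    intro θ ξ
    have hN0 : 0 ≤ GramOLS.quadForm P X Y θ ξ := integral_nonneg fun ω => sq_nonneg _
    obtain ⟨h1, h2⟩ := hdev ω hω θ ξ
    exact ⟨(mul_le_mul_of_nonneg_right hlo hN0).trans h1,
      h2.trans (mul_le_mul_of_nonneg_right hup hN0)⟩
  refine ⟨fun θ ξ => ⟨fun h0 => ?_, fun hpos => ?_⟩, fun hδ1 θhat hols =>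
    hols.excess_risk_le hn.pos hX hY hmin hδ0 hδ1 hform⟩
  -- The two-sided bound in product form covers N(θ, ξ) = 0 too: it forces the empirical form to
  -- vanish, which is the convention 0/0 = 1.
  · obtain ⟨h1, h2⟩ := hform θ ξ
    rw [h0, mul_zero] at h1 h2
    exact le_antisymm h2 h1
  · obtain ⟨h1, h2⟩ := hform θ ξ
    have h3 := (le_div_iff₀ hpos).2 h1
    have h4 := (div_le_iff₀ hpos).2 h2
    rw [abs_le]
    constructor <;> linarith
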